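/- For integers $n_0>1$, $m\ge 1$ and $N=n_0m$, let $H_0=[\,I\mid \mathbf 1\,]$ be the $(n_0-1)\times n_0$ parity check matrix and $G_0=(1\cdots1)$ the generator matrix of the binary repetition code of length $n_0$. For a binary $r\times m$ matrix $H_2$ let $\mathscr Q(n_0,H_2)$ be the CSS code on $N$ qubits for which $\mathscr H_X=H_2(I_m\otimes G_0)$ checks the $X$-errors and $\mathscr H_Z=I_m\otimes H_0$ checks the $Z$-errors: its stabilizer group is generated by the operators $Z(h)$, $h$ a row of $\mathscr H_X$, and $X(h)$, $h$ a row of $\mathscr H_Z$. The syndrome of a Pauli error $X(a)Z(b)$ is $(\mathscr H_Xa^T,\mathscr H_Zb^T)$, and its weight is the number of qubits on which it acts nontrivially. The minimum distance is the least weight of a Pauli error that commutes with the stabilizer group but does not belong to it up to a phase. There are binary $r_m\times m$ matrices $H_2^{(m)}$ with $r_m\le m$, for all $m$, and two fixed programs $\mathcal D_{\rm seq}$, $\mathcal D_{\rm par}$ for a parallel random access machine with shared memory and words of $O(\log N)$ bits, such that the following holds for all $\alpha,\beta>0$. There are constants $c,C>0$ such that for all integers $n_0>1$ and $N>1$ with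 $n_0\mid N$ and $\alpha\sqrt N\le n_0\le\beta\sqrt N$ (that is, $n_0=\Theta(\sqrt N)$), with $m=N/n_0$, the code $\mathscr Q_1=\mathscr Q(n_0,H_2^{(m)})$ has the following properties. 1. $\mathscr Q_1=[[N,k,d]]$, i.e. it is a subspace of dimension $2^k$ and of minimum distance $d$, with $k\ge c\sqrt N$ and $d\ge c\sqrt N$. 2. Given $n_0$, $m$, $r_m$, $H_2^{(m)}$ and a syndrome as input, $\mathcal D_{\rm seq}$ outputs a Pauli recovery operator in at most $CN$ steps on one processor. If the syndrome is that of a Pauli error of weight less than $\tfrac12c\sqrt N$, the recovery operator corrects this error, i.e. it restores every code state up to a global phase. 3. The same holds for $\mathcal D_{\rm par}$ with at most $C\sqrt N$ parallel steps on at most $C\sqrt N$ processors. 4. There is a circuit of Hadamard and CNOT gates with at most $CN$ gates and depth at most $C\sqrt N$ that encodes $\mathscr Q_1$: it maps the states $|\psi\rangle\otimes|0\cdots0\rangle$, with $|\psi\rangle$ an arbitrary state of a fixed set of qubits, onto $\mathscr Q_1$. Moreover, for fixed $0\le p_z<1/4$, if every qubit independently suffers a $Z$-error with probability $p_z$, then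 for each of the two decoders the probability $\mathcal P_Z$ that the resulting error is not corrected satisfies $N^{e}\mathcal P_Z\to0$ for every $e\ge 0$ as $N\to\infty$, uniformly over all $n_0$ as above. -/

import Mathlib

open scoped Matrix Kronecker

namespace PCCSS

/-! ### Qubits, Pauli operators, stabilizer codes -/

section Quantum

variable {ι : Type} [Fintype ι] [DecidableEq ι]

/-- Bit vectors indexed by the set `ι` of qubits. -/
abbrev Bits (ι : Type) : Type := ι → ZMod 2

/-- The state space `ℂ^(2^|ι|)`; `φ x` is the amplitude of the basis state `|x⟩`. -/
abbrev QState (ι : Type) : Type := Bits ι → ℂ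

/-- `X(u)|x⟩ = |x + u⟩`. -/
def pauliX (u : Bits ι) : QState ι ≃ₗ[ℂ] QState ι :=
  LinearEquiv.funCongrLeft ℂ ℂ (Equiv.subRight u)

/-- `(-1)^b`. -/
def sign (b : ZMod 2) : ℂ := (-1) ^ b.val

theorem sign_mul_sign (b : ZMod 2) : sign b * sign b = 1 := by
  unfold sign
  rw [← mul_pow]
  norm_num

/-- `Z(v)|x⟩ = (-1)^(v·x)|x⟩`. -/
def pauliZ (v : Bits ι) : QState ι ≃ₗ[ℂ] QState ι where
  toFun φ := fun x => sign (v ⬝ᵥ x) * φ x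
  invFun φ := fun x => sign (v ⬝ᵥ x) * φ x
  map_add' φ ψ := by
    funext x
    simp [mul_add]
  map_smul' c φ := by
    funext x
    simp [mul_left_comm]
  left_inv φ := by
    funext x
    simp [← mul_assoc, sign_mul_sign]
  right_inv φ := by
    funext x
    simp [← mul_assoc, sign_mul_sign]

/-- The Pauli error `X(a)Z(b)`; up to a phase these are all Pauli errors. -/
def pauli (a b : Bits ι) : QState ι ≃ₗ[ℂ] QState ι := pauliX a * pauliZ b

/-- The number of qubits on which `X(a)Z(b)` acts nontrivially. -/
def pauliWeight (a b : Bits ι) : ℕ :=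
  (Finset.univ.filter fun i => a i ≠ 0 ∨ b i ≠ 0).card

/-- The stabilizer group of the CSS code in which the rows of `HX` check the `X`-errors
(so they are `Z`-type generators) and the rows of `HZ` check the `Z`-errors. -/
def stabilizer {ρ σ : Type} (HX : Matrix ρ ι (ZMod 2)) (HZ : Matrix σ ι (ZMod 2)) :
    Subgroup (QState ι ≃ₗ[ℂ] QState ι) :=
  Subgroup.closure
    (Set.range (fun i => pauliZ (HX i)) ∪ Set.range (fun j => pauliX (HZ j)))

/-- The subspace fixed by a group of operators. -/
def codeSpace (S : Subgroup (QState ι ≃ₗ[ℂ] QState ι)) : Submodule ℂ (QState ι) where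
  carrier := {φ | ∀ s ∈ S, s φ = φ}
  add_mem' hφ hψ s hs := by rw [map_add, hφ s hs, hψ s hs]
  zero_mem' s _ := map_zero s
  smul_mem' c φ hφ s hs := by rw [map_smul, hφ s hs]

/-- The minimum weight of a Pauli error that commutes with the whole stabilizer group and does
not belong to it, even after multiplication by a phase (`0` if there is no such error). -/
noncomputable def minDist (S : Subgroup (QState ι ≃ₗ[ℂ] QState ι)) : ℕ :=
  sInf {w | ∃ a b : Bits ι, pauliWeight a b = w ∧
    (∀ s ∈ S, Commute (pauli a b) s) ∧
    ¬ ∃ s ∈ S, ∃ ω : ℂ, ∀ φ, pauli a b φ = ω • s φ}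

/-- Applying the Pauli operator `X(r.1)Z(r.2)` undoes the error `X(a)Z(b)` on every code state,
up to a global phase. -/
def Corrects (Q : Submodule ℂ (QState ι)) (r : Bits ι × Bits ι) (a b : Bits ι) : Prop :=
  ∃ ω : ℂ, ‖ω‖ = 1 ∧ ∀ φ ∈ Q, pauli r.1 r.2 (pauli a b φ) = ω • φ

/-! ### Quantum circuits -/

/-- Hadamard and controlled-NOT gates. -/
inductive Gate (ι : Type) : Type
  | had (i : ι) : Gate ι
  | cnot (control target : ι) (ne : control ≠ target) : Gate ι

/-- The qubits a gate acts on. -/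
def Gate.support : Gate ι → Finset ι
  | .had i => {i}
  | .cnot c t _ => {c, t}

/-- The unitary operator of a gate. -/
noncomputable def Gate.op : Gate ι → Module.End ℂ (QState ι)
  | .had i =>
    { toFun := fun φ x => ((Real.sqrt 2 : ℝ) : ℂ)⁻¹ *
        ∑ y : ZMod 2, sign (y * x i) * φ (Function.update x i y)
      map_add' := by
        intro φ ψ
        funext x
        simp [mul_add, Finset.sum_add_distrib]
      map_smul' := by
        intro c φ
        funext x
        simp only [Pi.smul_apply, smul_eq_mul, RingHom.id_apply, Finset.mul_sum]
        exact Finset.sum_congr rfl fun y _ => by ring }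
  | .cnot c t _ => LinearMap.funLeft ℂ ℂ fun x => Function.update x t (x t + x c)

/-- A circuit is a list of layers, applied from left to right. -/
abbrev Circuit (ι : Type) : Type := List (List (Gate ι))

/-- Gates in the same layer act on disjoint sets of qubits. -/
def Circuit.WellFormed (c : Circuit ι) : Prop :=
  ∀ layer ∈ c, layer.Pairwise fun g h => Disjoint g.support h.support

/-- The number of gates. -/
def Circuit.size (c : Circuit ι) : ℕ := c.flatten.length

/-- The number of layers. -/
def Circuit.depth (c : Circuit ι) : ℕ := c.length

/-- The unitary operator of a circuit. -/
noncomputable def Circuit.op (c : Circuit ι) : Module.End ℂ (QState ι) :=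
  (c.flatten.map Gate.op).reverse.prod

/-- The states `|ψ⟩ ⊗ |0⋯0⟩` with `|ψ⟩` an arbitrary state of the qubits in `M`. -/
def messageSpace (M : Finset ι) : Submodule ℂ (QState ι) where
  carrier := {φ | ∀ x : Bits ι, (∃ i ∉ M, x i ≠ 0) → φ x = 0}
  add_mem' hφ hψ x hx := by simp [hφ x hx, hψ x hx]
  zero_mem' _ _ := rfl
  smul_mem' c φ hφ x hx := by simp [hφ x hx]

/-- The circuit maps the message states, with all other qubits initialized to `|0⟩`, unitarily
onto the code `Q`. -/
def Circuit.Encodes (c : Circuit ι) (Q : Submodule ℂ (QState ι)) : Prop :=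
  c.WellFormed ∧ ∃ M : Finset ι, (messageSpace M).map c.op = Q

end Quantum

/-! ### The partially concatenated codes -/

/-- The parity check matrix `[I | 1]` of the repetition code of length `n₀`. -/
def repCheck (n₀ : ℕ) : Matrix (Fin (n₀ - 1)) (Fin n₀) (ZMod 2) :=
  fun i j => if j.val = i.val ∨ j.val = n₀ - 1 then 1 else 0

/-- The generator matrix `(1 ⋯ 1)` of the repetition code of length `n₀`. -/
def repGen (n₀ : ℕ) : Matrix (Fin 1) (Fin n₀) (ZMod 2) := fun _ _ => 1

/-- The qubits: `m` blocks of `n₀` qubits. -/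
abbrev Qubit (n₀ m : ℕ) : Type := Fin m × Fin n₀

/-- `H₁ = I ⊗ H₀`, which checks the `Z`-errors. -/
def checkZ (n₀ m : ℕ) : Matrix (Fin m × Fin (n₀ - 1)) (Qubit n₀ m) (ZMod 2) :=
  (1 : Matrix (Fin m) (Fin m) (ZMod 2)) ⊗ₖ repCheck n₀

/-- `G₁ = I ⊗ G₀`. -/
def innerGen (n₀ m : ℕ) : Matrix (Fin m) (Qubit n₀ m) (ZMod 2) :=
  ((1 : Matrix (Fin m) (Fin m) (ZMod 2)) ⊗ₖ repGen n₀).submatrix (fun i => (i, 0)) id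

/-- `H₂ G₁`, which checks the `X`-errors. -/
def checkX (n₀ : ℕ) {m r : ℕ} (H₂ : Matrix (Fin r) (Fin m) (ZMod 2)) :
    Matrix (Fin r) (Qubit n₀ m) (ZMod 2) :=
  H₂ * innerGen n₀ m

/-- The stabilizer group of the code built from `H₂` and the repetition code of length `n₀`. -/
def stab (n₀ : ℕ) {m r : ℕ} (H₂ : Matrix (Fin r) (Fin m) (ZMod 2)) :
    Subgroup (QState (Qubit n₀ m) ≃ₗ[ℂ] QState (Qubit n₀ m)) :=
  stabilizer (checkX n₀ H₂) (checkZ n₀ m)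

/-- The code built from `H₂` and the repetition code of length `n₀`. -/
def code (n₀ : ℕ) {m r : ℕ} (H₂ : Matrix (Fin r) (Fin m) (ZMod 2)) :
    Submodule ℂ (QState (Qubit n₀ m)) :=
  codeSpace (stab n₀ H₂)

/-! ### Parallel random access machine -/

/-- Programs of a synchronous parallel random access machine with word arithmetic. Each processor
has its own registers, numbered by `ℕ`, and all processors share one memory. Register numbers and
constants are part of the program. -/
inductive Prog : Type
  /-- `R_d := c` -/
  | const (d c : ℕ) : Prog
  /-- `R_d :=` number of the processor -/
  | procId (d : ℕ) : Prog
  /-- `R_d := R_a + R_b` -/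
  | add (d a b : ℕ) : Prog
  /-- `R_d := max(R_a - R_b, 0)` -/
  | sub (d a b : ℕ) : Prog
  /-- `R_d := R_a * R_b` -/
  | mul (d a b : ℕ) : Prog
  /-- `R_d := memory[R_a]` -/
  | load (d a : ℕ) : Prog
  /-- `memory[R_a] := R_b` -/
  | store (a b : ℕ) : Prog
  /-- first `s`, then `t` -/
  | seq (s t : Prog) : Prog
  /-- repeat `body`; the number of repetitions is the content, on entry, of `R_a` of
  processor `0`, which controls all processors -/
  | loop (a : ℕ) (body : Prog) : Prog

/-- The configuration: `reg p d` is register `d` of processor `p`. -/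
structure Config : Type where
  reg : ℕ → ℕ → ℕ
  mem : ℕ → ℕ

/-- Every processor `p < P` sets its register `d` to `f p`, reduced to a word. -/
def Config.setReg (W P : ℕ) (s : Config) (d : ℕ) (f : ℕ → ℕ) : Config :=
  { s with reg := fun p => if p < P then Function.update (s.reg p) d (f p % W) else s.reg p }

/-- Every processor `p < P` writes `R_b` to address `R_a`. If several processors write to the
same address, the one with the smallest number succeeds. -/
def Config.storeAll (P : ℕ) (s : Config) (a b : ℕ) : Config :=
  { s with mem := fun x =>
      match (List.range P).find? (fun p => s.reg p a = x) with
      | some p => s.reg p b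
      | none => s.mem x }

/-- The configuration after running a program on `P` processors with words in `{0, …, W - 1}`,
and the number of steps. An elementary instruction, executed by all processors simultaneously,
takes one step; entering a loop and each of its repetitions cost one additional step. -/
def Prog.run (W P : ℕ) : Prog → Config → Config × ℕ
  | .const d c, s => (s.setReg W P d fun _ => c, 1)
  | .procId d, s => (s.setReg W P d fun p => p, 1)
  | .add d a b, s => (s.setReg W P d fun p => s.reg p a + s.reg p b, 1)
  | .sub d a b, s => (s.setReg W P d fun p => s.reg p a - s.reg p b, 1)
  | .mul d a b, s => (s.setReg W P d fun p => s.reg p a * s.reg p b, 1)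
  | .load d a, s => (s.setReg W P d fun p => s.mem (s.reg p a), 1)
  | .store a b, s => (s.storeAll P a b, 1)
  | .seq t u, s => ((u.run W P (t.run W P s).1).1, (t.run W P s).2 + (u.run W P (t.run W P s).1).2)
  | .loop a body, s =>
      (fun q : Config × ℕ => ((body.run W P q.1).1, q.2 + (body.run W P q.1).2 + 1))^[s.reg 0 a]
        (s, 1)

/-- The number of different words when a word has `κ * (⌊log₂ N⌋ + 1)` bits. -/
def wordCount (κ N : ℕ) : ℕ := 2 ^ (κ * (Nat.log 2 N + 1))

/-! ### Syndrome decoders -/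

/-- The input of a syndrome decoder: the numbers `n₀`, `m`, `r`, the entries of `H₂` row by row,
and the two parts of the syndrome. -/
def decoderInput (n₀ : ℕ) {m r : ℕ} (H₂ : Matrix (Fin r) (Fin m) (ZMod 2))
    (sX : Fin r → ZMod 2) (sZ : Fin m × Fin (n₀ - 1) → ZMod 2) : List ℕ :=
  [n₀, m, r]
    ++ List.ofFn (fun i : Fin (r * m) =>
        (H₂ (finProdFinEquiv.symm i).1 (finProdFinEquiv.symm i).2).val)
    ++ List.ofFn (fun i : Fin r => (sX i).val)
    ++ List.ofFn (fun i : Fin (m * (n₀ - 1)) => (sZ (finProdFinEquiv.symm i)).val)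

/-- The initial configuration: the input stands at the beginning of the memory, and all other
cells and all registers are `0`. -/
def initConfig (inp : List ℕ) : Config where
  reg := fun _ _ => 0
  mem := fun x => inp.getD x 0

/-- The run of a decoder program on `P` processors with words of `O(log N)` bits. -/
def decoderRun (prog : Prog) (κ P n₀ : ℕ) {m r : ℕ} (H₂ : Matrix (Fin r) (Fin m) (ZMod 2))
    (sX : Fin r → ZMod 2) (sZ : Fin m × Fin (n₀ - 1) → ZMod 2) : Config × ℕ :=
  prog.run (wordCount κ (n₀ * m)) P (initConfig (decoderInput n₀ H₂ sX sZ))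

/-- The number of steps of the decoder. -/
def decoderTime (prog : Prog) (κ P n₀ : ℕ) {m r : ℕ} (H₂ : Matrix (Fin r) (Fin m) (ZMod 2))
    (sX : Fin r → ZMod 2) (sZ : Fin m × Fin (n₀ - 1) → ZMod 2) : ℕ :=
  (decoderRun prog κ P n₀ H₂ sX sZ).2

/-- The output of the decoder, read from the memory directly behind the input: first the bits of
the `X`-part, then those of the `Z`-part of the recovery operator, block by block. -/
def decoderOutput (prog : Prog) (κ P n₀ : ℕ) {m r : ℕ} (H₂ : Matrix (Fin r) (Fin m) (ZMod 2))
    (sX : Fin r → ZMod 2) (sZ : Fin m × Fin (n₀ - 1) → ZMod 2) :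
    Bits (Qubit n₀ m) × Bits (Qubit n₀ m) :=
  let out : ℕ → ZMod 2 := fun x => ((decoderRun prog κ P n₀ H₂ sX sZ).1.mem
    ((decoderInput n₀ H₂ sX sZ).length + x) : ZMod 2)
  (fun i => out (finProdFinEquiv i).val, fun i => out (m * n₀ + (finProdFinEquiv i).val))

/-- The decoder, given only the syndrome of the error `X(a)Z(b)`, corrects this error. -/
def DecoderCorrects (prog : Prog) (κ P n₀ : ℕ) {m r : ℕ} (H₂ : Matrix (Fin r) (Fin m) (ZMod 2))
    (a b : Bits (Qubit n₀ m)) : Prop :=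
  Corrects (code n₀ H₂)
    (decoderOutput prog κ P n₀ H₂ (checkX n₀ H₂ *ᵥ a) (checkZ n₀ m *ᵥ b)) a b

/-- The probability that the decoder does not correct a random `Z`-error, in which every qubit
suffers a `Z` independently with probability `p`. -/
noncomputable def failProb (prog : Prog) (κ P n₀ : ℕ) {m r : ℕ}
    (H₂ : Matrix (Fin r) (Fin m) (ZMod 2)) (p : ℝ) : ℝ :=
  ∑ b : Bits (Qubit n₀ m),
    {b | ¬ DecoderCorrects prog κ P n₀ H₂ 0 b}.indicator
      (fun b => ∏ i, if b i = 1 then p else 1 - p) b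

end PCCSS

set_option linter.unusedSectionVars false

namespace PCCSS

/-! ### Pauli operators and CSS codes -/

section CSS

variable {ι : Type} [Fintype ι] [DecidableEq ι]

/-! The X side depends only on the parities of the `m` blocks. The rows of `checkZ` span exactly the
vectors whose block parities all vanish (`mem_span_checkZ`, `blockParity_checkZ`), and the
X-syndrome of `a` is `H₂` applied to its parity vector (`checkX_mulVec`). So, up to stabilizers, an
X-error is an error of the outer classical code, while a Z-error is a family of `m` independent
errors of the repetition code. A nonzero Z-part commuting with all checks is constant on blocks and
costs weight `n₀`; if the Z-part vanishes, a nontrivial X-part has a nonzero outer codeword as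
parity vector. Hence the distance is at least the smaller of `n₀` and the outer distance
(`le_minDist`).

The outer code is an expander code of left degree 8. A union bound (`exists_expander`) yields a
graph in which every small set `S` of variables has more than `6|S|` neighbours. A small nonzero
error then violates more than four checks per wrong bit (`four_mul_weight_lt`). This gives linear
distance, and it shows that some bit has a majority of unsatisfied checks; flipping such bits one at
a time terminates at the true error (`flipSteps_correct`).

The decoder applies the estimated parities to the first qubits of the blocks and takes a majority
vote in each block for the Z-part. Bit flipping needs at most as many rounds as there are checks,
which is `O(√N)`. One round is `O(1)` steps for `m` processors and `O(m)` steps for one, whence the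
two running times. A small program logic (`wp`) verifies both versions at once: `wp_forEach`
abstracts from the way the items are distributed over processors.

For the encoder, the kernel of `H₂` is put into systematic form. Controlled-NOTs create the outer
codeword on the first qubits, Hadamards put the other qubits into superposition, and controlled-NOTs
inside the blocks turn first bits into block parities (`map_encoder`).

Under random Z-errors a block can fail only if at least half of its qubits are hit. The exponential
moment of the number of hits bounds this by `(7/8)^n₀`, and with `n₀` of order `√N` this beats every
power of `N`, even after a union over the blocks. -/

theorem sign_zero : sign 0 = 1 := by simp [sign]

theorem sign_one : sign 1 = -1 := by simp [sign, ZMod.val_one]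

theorem zmod_two_cases (a : ZMod 2) : a = 0 ∨ a = 1 := by
  revert a; decide

theorem sign_add (a b : ZMod 2) : sign (a + b) = sign a * sign b := by
  have h : (1 + 1 : ZMod 2) = 0 := by decide
  rcases zmod_two_cases a with rfl | rfl <;> rcases zmod_two_cases b with rfl | rfl <;>
    simp [sign_zero, sign_one, h]

theorem sign_eq_one_iff {a : ZMod 2} : sign a = 1 ↔ a = 0 := by
  rcases zmod_two_cases a with rfl | rfl
  · simp [sign_zero]
  · simp only [sign_one, one_ne_zero, iff_false]
    norm_num

theorem norm_sign (a : ZMod 2) : ‖sign a‖ = 1 := by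
  simp [sign]

theorem bits_add_self {κ : Type} (u : κ → ZMod 2) : u + u = 0 := by
  funext i
  exact CharTwo.add_self_eq_zero _

theorem bits_sub {κ : Type} (u v : κ → ZMod 2) : u - v = u + v := by
  funext i
  exact CharTwo.sub_eq_add _ _

theorem pauliX_apply (u : Bits ι) (φ : QState ι) (x : Bits ι) : pauliX u φ x = φ (x + u) := by
  rw [← bits_sub]
  rfl

theorem pauliZ_apply (v : Bits ι) (φ : QState ι) (x : Bits ι) :
    pauliZ v φ x = sign (v ⬝ᵥ x) * φ x := rfl

theorem pauli_apply (a b : Bits ι) (φ : QState ι) (x : Bits ι) :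
    pauli a b φ x = sign (b ⬝ᵥ (x + a)) * φ (x + a) := by
  change pauliX a (pauliZ b φ) x = _
  rw [pauliX_apply, pauliZ_apply]

theorem pauliX_zero : pauliX (0 : Bits ι) = 1 := by
  ext φ x
  rw [pauliX_apply, add_zero]
  rfl

theorem pauliX_add (u v : Bits ι) : pauliX (u + v) = pauliX u * pauliX v := by
  ext φ x
  change _ = pauliX u (pauliX v φ) x
  rw [pauliX_apply, pauliX_apply, pauliX_apply, add_assoc]

variable {ρ σ : Type} (HX : Matrix ρ ι (ZMod 2)) (HZ : Matrix σ ι (ZMod 2))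

/-- Fixing a vector passes to products and inverses, so generators suffice. A Z-type generator
restricts the support, an X-type generator imposes a translation invariance; from here on the code
is handled through amplitudes. -/
theorem mem_codeSpace_stabilizer {φ : QState ι} :
    φ ∈ codeSpace (stabilizer HX HZ) ↔
      (∀ i x, φ x ≠ 0 → HX i ⬝ᵥ x = 0) ∧ ∀ j x, φ (x + HZ j) = φ x := by
  have key : φ ∈ codeSpace (stabilizer HX HZ) ↔
      (∀ i, pauliZ (HX i) φ = φ) ∧ ∀ j, pauliX (HZ j) φ = φ := by
    constructor
    · intro h
      exact ⟨fun i => h _ (Subgroup.subset_closure (Or.inl ⟨i, rfl⟩)),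
        fun j => h _ (Subgroup.subset_closure (Or.inr ⟨j, rfl⟩))⟩
    · rintro ⟨hX, hZ⟩ s hs
      induction hs using Subgroup.closure_induction with
      | mem s hs =>
        rcases hs with ⟨i, rfl⟩ | ⟨j, rfl⟩
        · exact hX i
        · exact hZ j
      | one => rfl
      | mul s t _ _ ihs iht =>
        change s (t φ) = φ
        rw [iht, ihs]
      | inv s _ ih =>
        conv_lhs => rw [← ih]
        exact s.symm_apply_apply φ
  rw [key]
  refine and_congr (forall_congr' fun i => ?_) (forall_congr' fun j => ?_)
  · rw [funext_iff]
    refine forall_congr' fun x => ?_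
    rw [pauliZ_apply]
    constructor
    · intro h h0
      exact sign_eq_one_iff.1 (mul_right_cancel₀ h0 (by rw [h, one_mul]))
    · intro h
      by_cases h0 : φ x = 0
      · rw [h0, mul_zero]
      · rw [h h0, sign_zero, one_mul]
  · rw [funext_iff]
    refine forall_congr' fun x => ?_
    rw [pauliX_apply]

theorem pauliX_mem_stabilizer {u : Bits ι} (hu : u ∈ Submodule.span (ZMod 2) (Set.range HZ)) :
    pauliX u ∈ stabilizer HX HZ := by
  induction hu using Submodule.span_induction with
  | mem u hu =>
    obtain ⟨j, rfl⟩ := hu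
    exact Subgroup.subset_closure (Or.inr ⟨j, rfl⟩)
  | zero =>
    rw [pauliX_zero]
    exact one_mem _
  | add u v _ _ hu hv =>
    rw [pauliX_add]
    exact mul_mem hu hv
  | smul c u _ hu =>
    rcases zmod_two_cases c with rfl | rfl
    · rw [zero_smul, pauliX_zero]
      exact one_mem _
    · rwa [one_smul]

/-- A recovery operator with the right `Z`-part and with an `X`-part that is right up to the row
space of `HZ` corrects the error. -/
theorem corrects_of_mem_span {r₁ a b : Bits ι}
    (h : r₁ + a ∈ Submodule.span (ZMod 2) (Set.range HZ)) :
    Corrects (codeSpace (stabilizer HX HZ)) (r₁, b) a b := by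
  -- The phase is the price of moving `Z(b)` past `X(a)`; what remains is `X(r₁ + a)`, a stabilizer
  -- element.
  refine ⟨sign (b ⬝ᵥ a), norm_sign _, fun φ hφ => ?_⟩
  have hinv : ∀ x, φ (x + (r₁ + a)) = φ x := fun x => by
    rw [← pauliX_apply _ φ x, hφ _ (pauliX_mem_stabilizer HX HZ h)]
  funext x
  simp only [pauli_apply, Pi.smul_apply, smul_eq_mul]
  rw [add_assoc x r₁ a, hinv, ← mul_assoc, ← sign_add, ← dotProduct_add]
  congr 3
  rw [← add_assoc x r₁ a, ← add_assoc, bits_add_self, zero_add]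

/-- Comparing the two products on the all-ones vector at a single basis state isolates the
commutation sign. The next lemma does the same with the basis state `a`. -/
theorem dotProduct_eq_zero_of_commute_pauliZ {a b h : Bits ι}
    (hc : Commute (pauli a b) (pauliZ h)) : h ⬝ᵥ a = 0 := by
  have h1 := congrFun (LinearEquiv.congr_fun hc.eq (fun _ => 1)) 0
  change pauli a b (pauliZ h (fun _ => 1)) 0 = pauliZ h (pauli a b (fun _ => 1)) 0 at h1
  simp only [pauli_apply, pauliZ_apply, zero_add, dotProduct_zero, sign_zero, mul_one,
    one_mul] at h1
  have h2 : sign (b ⬝ᵥ a) ≠ 0 := fun h0 => by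
    have := norm_sign (b ⬝ᵥ a)
    rw [h0, norm_zero] at this
    exact zero_ne_one this
  exact sign_eq_one_iff.1 (mul_left_cancel₀ h2 (by rw [h1, mul_one]))

theorem dotProduct_eq_zero_of_commute_pauliX {a b h : Bits ι}
    (hc : Commute (pauli a b) (pauliX h)) : h ⬝ᵥ b = 0 := by
  have h1 := congrFun (LinearEquiv.congr_fun hc.eq (fun _ => 1)) a
  change pauli a b (pauliX h (fun _ => 1)) a = pauliX h (pauli a b (fun _ => 1)) a at h1
  simp only [pauli_apply, pauliX_apply, mul_one] at h1
  rw [add_right_comm, bits_add_self, zero_add, dotProduct_zero, sign_zero, eq_comm,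
    sign_eq_one_iff, dotProduct_comm] at h1
  exact h1

end CSS

/-! ### The checks of the partially concatenated code -/

section Checks

variable {n₀ m r : ℕ}

/-- The parities of the blocks. -/
def blockParity (a : Bits (Qubit n₀ m)) : Fin m → ZMod 2 := fun v => ∑ i, a (v, i)

theorem blockParity_add (a b : Bits (Qubit n₀ m)) :
    blockParity (a + b) = blockParity a + blockParity b := by
  funext v
  simp [blockParity, Finset.sum_add_distrib]

theorem checkX_apply (H₂ : Matrix (Fin r) (Fin m) (ZMod 2)) (c : Fin r) (i : Qubit n₀ m) :
    checkX n₀ H₂ c i = H₂ c i.1 := by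
  simp [checkX, innerGen, Matrix.mul_apply, repGen, Matrix.one_apply]

/-- This reduces the X side to the outer code: the syndrome sees a block only through its parity. -/
theorem checkX_mulVec (H₂ : Matrix (Fin r) (Fin m) (ZMod 2)) (a : Bits (Qubit n₀ m)) :
    checkX n₀ H₂ *ᵥ a = H₂ *ᵥ blockParity a := by
  funext c
  simp only [Matrix.mulVec, dotProduct, checkX_apply, Fintype.sum_prod_type, blockParity,
    Finset.mul_sum]

theorem checkZ_apply (v v' : Fin m) (i : Fin (n₀ - 1)) (j : Fin n₀) :
    checkZ n₀ m (v, i) (v', j) =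
      if v = v' ∧ (j.val = i.val ∨ j.val = n₀ - 1) then 1 else 0 := by
  simp only [checkZ, repCheck, Matrix.kroneckerMap_apply, Matrix.one_apply]
  by_cases h : v = v' <;> simp [h]

theorem checkZ_succ_apply {n : ℕ} (v v' : Fin m) (i : Fin n) (j : Fin (n + 1)) :
    checkZ (n + 1) m (v, i) (v', j) =
      if v = v' ∧ (j = i.castSucc ∨ j = Fin.last n) then 1 else 0 := by
  refine (checkZ_apply (n₀ := n + 1) v v' i j).trans ?_
  simp only [Fin.ext_iff, Fin.val_castSucc, Fin.val_last, Nat.add_sub_cancel]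

theorem checkZ_mulVec (n : ℕ) (b : Bits (Qubit (n + 1) m)) (v : Fin m) (i : Fin n) :
    (checkZ (n + 1) m *ᵥ b) (v, i) = b (v, i.castSucc) + b (v, Fin.last n) := by
  have e : (checkZ (n + 1) m *ᵥ b) (v, i) = ∑ v', ∑ j,
      (if v = v' ∧ (j = i.castSucc ∨ j = Fin.last n) then 1 else 0) * b (v', j) := by
    simp only [Matrix.mulVec, dotProduct, Fintype.sum_prod_type]
    exact Finset.sum_congr rfl fun v' _ => Finset.sum_congr rfl fun j _ =>
      congrArg (· * b (v', j)) (checkZ_succ_apply v v' i j)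
  rw [e, Finset.sum_eq_single v]
  · rw [Fin.sum_univ_castSucc]
    simp [(Fin.castSucc_lt_last _).ne, (Fin.castSucc_lt_last _).ne']
  · intro v' _ hv
    simp [Ne.symm hv]
  · simp

/-- Within a block the rows are `e_i + e_last`. The coefficient of row `i` must be the `i`-th bit of
`u`, and the last bit then comes out right because the parity is zero. -/
theorem mem_span_checkZ {u : Bits (Qubit n₀ m)} (hn : 0 < n₀) (hu : blockParity u = 0) :
    u ∈ Submodule.span (ZMod 2) (Set.range (checkZ n₀ m)) := by
  obtain ⟨n, rfl⟩ : ∃ n, n₀ = n + 1 := ⟨n₀ - 1, by omega⟩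
  have h : u = ∑ v : Fin m, ∑ i : Fin n, u (v, i.castSucc) • checkZ (n + 1) m (v, i) := by
    funext ⟨v, j⟩
    rw [Finset.sum_apply, Finset.sum_eq_single v]
    · rw [Finset.sum_apply]
      simp only [Pi.smul_apply, checkZ_succ_apply, smul_eq_mul]
      have hv : ∑ i : Fin n, u (v, i.castSucc) + u (v, Fin.last n) = 0 := by
        rw [← Fin.sum_univ_castSucc (fun i => u (v, i))]
        exact congrFun hu v
      refine Fin.lastCases ?_ (fun j => ?_) j
      · simp [CharTwo.add_eq_zero.1 hv]
      · simp
    · intro v' _ hv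
      rw [Finset.sum_apply]
      refine Finset.sum_eq_zero fun i _ => ?_
      rw [Pi.smul_apply, checkZ_succ_apply, if_neg (fun h => hv h.1), smul_zero]
    · simp
  rw [h]
  exact Submodule.sum_mem _ fun v _ => Submodule.sum_mem _ fun i _ =>
    Submodule.smul_mem _ _ (Submodule.subset_span ⟨(v, i), rfl⟩)

theorem blockParity_checkZ (j : Fin m × Fin (n₀ - 1)) : blockParity (checkZ n₀ m j) = 0 := by
  obtain ⟨v, i⟩ := j
  obtain ⟨n, rfl⟩ : ∃ n, n₀ = n + 1 := ⟨n₀ - 1, by have := i.isLt; omega⟩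
  change Fin n at i
  funext v'
  simp only [blockParity, Fin.sum_univ_castSucc, checkZ_succ_apply]
  by_cases hv : v = v'
  · simp [hv, CharTwo.add_self_eq_zero]
  · simp [hv]

/-- A code state is thus a function of the block parities, supported on outer codewords. This is the
form that the encoder has to reach. -/
theorem mem_code {H₂ : Matrix (Fin r) (Fin m) (ZMod 2)} (hn : 0 < n₀)
    {φ : QState (Qubit n₀ m)} :
    φ ∈ code n₀ H₂ ↔ (∀ x, φ x ≠ 0 → H₂ *ᵥ blockParity x = 0) ∧
      ∀ x u, blockParity u = 0 → φ (x + u) = φ x := by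
  constructor
  · intro h
    refine ⟨fun x hx => ?_, fun x u hu => ?_⟩
    · rw [← checkX_mulVec]
      funext c
      exact ((mem_codeSpace_stabilizer _ _).1 h).1 c x hx
    · rw [← pauliX_apply _ φ x, h _ (pauliX_mem_stabilizer _ _ (mem_span_checkZ hn hu))]
  · rintro ⟨h1, h2⟩
    refine (mem_codeSpace_stabilizer _ _).2 ⟨fun c x hx => ?_, fun j x => ?_⟩
    · have := h1 x hx
      rw [← checkX_mulVec] at this
      exact congrFun this c
    · exact h2 x _ (blockParity_checkZ j)

/-- The Hamming weight. -/
def weight {κ : Type} [Fintype κ] (y : κ → ZMod 2) : ℕ :=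
  (Finset.univ.filter fun i => y i ≠ 0).card

theorem weight_le_pauliWeight_left (a b : Bits (Qubit n₀ m)) : weight a ≤ pauliWeight a b :=
  Finset.card_le_card fun i hi => by
    simp only [Finset.mem_filter, Finset.mem_univ, true_and] at hi ⊢
    exact Or.inl hi

theorem weight_le_pauliWeight_right (a b : Bits (Qubit n₀ m)) : weight b ≤ pauliWeight a b :=
  Finset.card_le_card fun i hi => by
    simp only [Finset.mem_filter, Finset.mem_univ, true_and] at hi ⊢
    exact Or.inr hi

theorem weight_blockParity_le (a : Bits (Qubit n₀ m)) : weight (blockParity a) ≤ weight a := by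
  classical
  refine le_trans (Finset.card_le_card (t := (Finset.univ.filter fun i => a i ≠ 0).image Prod.fst)
    fun v hv => ?_) Finset.card_image_le
  simp only [Finset.mem_filter, Finset.mem_univ, true_and, Finset.mem_image] at hv ⊢
  obtain ⟨i, _, hi⟩ := Finset.exists_ne_zero_of_sum_ne_zero hv
  exact ⟨(v, i), hi, rfl⟩

theorem weight_block_le (b : Bits (Qubit n₀ m)) (v : Fin m) :
    weight (fun i => b (v, i)) ≤ weight b :=
  Finset.card_le_card_of_injOn (fun i => (v, i)) (fun i hi => by simpa using hi)
    fun i _ j _ h => (Prod.ext_iff.1 h).2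

theorem code_corrects {H₂ : Matrix (Fin r) (Fin m) (ZMod 2)} (hn : 0 < n₀)
    {a b : Bits (Qubit n₀ m)} {R : Bits (Qubit n₀ m) × Bits (Qubit n₀ m)}
    (hX : blockParity R.1 = blockParity a) (hZ : R.2 = b) : Corrects (code n₀ H₂) R a b := by
  obtain ⟨r₁, r₂⟩ := R
  subst hZ
  refine corrects_of_mem_span _ _ (mem_span_checkZ hn ?_)
  rw [blockParity_add, hX, bits_add_self]

/-- A block whose parity can be prescribed by its first qubit. -/
def firstQubits (hn : 0 < n₀) (y : Fin m → ZMod 2) : Bits (Qubit n₀ m) :=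
  fun i => if i.2 = ⟨0, hn⟩ then y i.1 else 0

theorem blockParity_firstQubits (hn : 0 < n₀) (y : Fin m → ZMod 2) :
    blockParity (firstQubits hn y) = y := by
  funext v
  simp [blockParity, firstQubits]

theorem le_minDist {H₂ : Matrix (Fin r) (Fin m) (ZMod 2)} {d : ℕ} (hn : 0 < n₀) (hd : d ≤ n₀)
    (hH : ∀ y, H₂ *ᵥ y = 0 → y ≠ 0 → d ≤ weight y) (hk : ∃ y, H₂ *ᵥ y = 0 ∧ y ≠ 0) :
    d ≤ minDist (stab n₀ H₂) := by
  refine le_csInf ?_ ?_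
  -- The infimum of the empty set would be `0`, so a logical operator must be exhibited: an outer
  -- codeword written on the first qubits.
  · obtain ⟨y, hy, hy0⟩ := hk
    refine ⟨_, firstQubits hn y, 0, rfl, ?_, ?_⟩
    · intro s hs
      induction hs using Subgroup.closure_induction with
      | mem s hs =>
        rcases hs with ⟨c, rfl⟩ | ⟨j, rfl⟩
        · refine LinearEquiv.ext fun φ => funext fun x => ?_
          change pauli _ 0 (pauliZ _ φ) x = pauliZ _ (pauli _ 0 φ) x
          have : checkX n₀ H₂ c ⬝ᵥ firstQubits hn y = 0 := by
            have h := checkX_mulVec H₂ (firstQubits hn y)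
            rw [blockParity_firstQubits, hy] at h
            exact congrFun h c
          simp only [pauli_apply, pauliZ_apply, zero_dotProduct, sign_zero, one_mul,
            dotProduct_add, this, add_zero]
        · refine LinearEquiv.ext fun φ => funext fun x => ?_
          change pauli _ 0 (pauliX _ φ) x = pauliX _ (pauli _ 0 φ) x
          simp only [pauli_apply, pauliX_apply, zero_dotProduct, sign_zero, one_mul,
            add_right_comm]
      | one => exact Commute.one_right _
      | mul s t _ _ hs ht => exact hs.mul_right ht
      | inv s _ hs => exact hs.inv_right
    · rintro ⟨s, hs, ω, hω⟩
      -- This code state is moved to a state of disjoint support by the operator, so no stabilizer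
      -- element can agree with it up to a scalar.
      have hφ : (fun x => if blockParity x = 0 then 1 else 0 : QState (Qubit n₀ m)) ∈
          code n₀ H₂ := by
        refine (mem_code hn).2 ⟨fun x hx => ?_, fun x u hu => ?_⟩
        · have : blockParity x = 0 := by
            by_contra h
            simp [h] at hx
          rw [this, Matrix.mulVec_zero]
        · simp only [blockParity_add, hu, add_zero]
      have h := hω (fun x => if blockParity x = 0 then 1 else 0)
      rw [hφ s hs] at h
      have h0 := congrFun h 0
      have h1 := congrFun h (firstQubits hn y)
      simp only [pauli_apply, zero_dotProduct, sign_zero, one_mul, Pi.smul_apply, zero_add,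
        bits_add_self, blockParity_firstQubits, hy0, if_false, smul_eq_mul, mul_zero] at h0 h1
      rw [if_pos (by funext v; simp [blockParity])] at h1
      exact one_ne_zero h1
  · rintro w ⟨a, b, rfl, hcomm, hnot⟩
    -- Commuting with the generators `X(e_i + e_last)` makes the Z-part constant on every block, so
    -- a nonzero Z-part fills a whole block.
    have hb : ∀ v i, b (v, i) = b (v, ⟨n₀ - 1, by omega⟩) := by
      obtain ⟨n, rfl⟩ : ∃ n, n₀ = n + 1 := ⟨n₀ - 1, by omega⟩
      intro v i
      refine Fin.lastCases rfl (fun i => ?_) i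
      have h : (checkZ (n + 1) m *ᵥ b) (v, i) = 0 :=
        dotProduct_eq_zero_of_commute_pauliX
          (hcomm _ (Subgroup.subset_closure (Or.inr ⟨(v, i), rfl⟩)))
      rw [checkZ_mulVec] at h
      exact CharTwo.add_eq_zero.1 h
    by_cases hb0 : b = 0
    · have ha : H₂ *ᵥ blockParity a = 0 := by
        rw [← checkX_mulVec]
        funext c
        exact dotProduct_eq_zero_of_commute_pauliZ
          (hcomm _ (Subgroup.subset_closure (Or.inl ⟨c, rfl⟩)))
      refine (hH _ ha fun h0 => hnot ?_).trans
        ((weight_blockParity_le a).trans (weight_le_pauliWeight_left a b))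
      refine ⟨pauliX a, pauliX_mem_stabilizer _ _ (mem_span_checkZ hn h0), 1, fun φ => ?_⟩
      rw [hb0, one_smul]
      funext x
      simp [pauli_apply, pauliX_apply, sign_zero]
    · obtain ⟨⟨v, i⟩, hi⟩ := Function.ne_iff.1 hb0
      refine le_trans ?_ ((weight_block_le b v).trans (weight_le_pauliWeight_right a b))
      have : weight (fun i => b (v, i)) = n₀ := by
        rw [weight, Finset.filter_true_of_mem, Finset.card_univ, Fintype.card_fin]
        intro j _
        rw [hb v j, ← hb v i]
        exact hi
      omega

end Checks

/-! ### Circuits -/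

section Circuits

variable {ι : Type} [Fintype ι] [DecidableEq ι]

theorem had_apply (i : ι) (φ : QState ι) (x : Bits ι) :
    (Gate.had i).op φ x = ((Real.sqrt 2 : ℝ) : ℂ)⁻¹ *
      (φ (Function.update x i 0) + sign (x i) * φ (Function.update x i 1)) := by
  change ((Real.sqrt 2 : ℝ) : ℂ)⁻¹ *
    (∑ y : ZMod 2, sign (y * x i) * φ (Function.update x i y)) = _
  rw [show (∑ y : ZMod 2, sign (y * x i) * φ (Function.update x i y)) = _ from
    Fin.sum_univ_two fun y : ZMod 2 => sign (y * x i) * φ (Function.update x i y)]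
  change _ * (sign (0 * x i) * φ (Function.update x i 0) +
    sign (1 * x i) * φ (Function.update x i 1)) = _
  rw [zero_mul, one_mul, sign_zero, one_mul]

theorem cnot_apply (c t : ι) (h : c ≠ t) (φ : QState ι) (x : Bits ι) :
    (Gate.cnot c t h).op φ x = φ (x + Pi.single t (x c)) := by
  change φ (Function.update x t (x t + x c)) = _
  congr 1
  funext i
  by_cases hi : i = t
  · subst hi
    simp
  · simp [hi]

theorem inv_sqrt_two_mul_self :
    ((Real.sqrt 2 : ℝ) : ℂ)⁻¹ * ((Real.sqrt 2 : ℝ) : ℂ)⁻¹ = 2⁻¹ := by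
  rw [← mul_inv, ← Complex.ofReal_mul, Real.mul_self_sqrt (by norm_num)]
  norm_num

theorem Gate.op_op (g : Gate ι) (φ : QState ι) : g.op (g.op φ) = φ := by
  funext x
  cases g with
  | had i =>
    simp only [had_apply, Function.update_self, Function.update_idem, sign_zero, sign_one]
    have h : φ x = φ (Function.update x i (x i)) := by rw [Function.update_eq_self]
    have h2 := inv_sqrt_two_mul_self
    rw [h]
    rcases zmod_two_cases (x i) with h0 | h0 <;> rw [h0] <;> simp only [sign_zero, sign_one]
    · linear_combination (2 * φ (Function.update x i 0)) * h2
    · linear_combination (2 * φ (Function.update x i 1)) * h2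
  | cnot c t h =>
    simp only [cnot_apply, Pi.add_apply, Pi.single_eq_of_ne h, add_zero]
    rw [add_assoc, bits_add_self, add_zero]

/-- The operator of a list of gates, applied from left to right. -/
noncomputable def gatesOp (l : List (Gate ι)) : Module.End ℂ (QState ι) :=
  (l.map Gate.op).reverse.prod

theorem gatesOp_nil (φ : QState ι) : gatesOp ([] : List (Gate ι)) φ = φ := rfl

theorem gatesOp_cons (g : Gate ι) (l : List (Gate ι)) (φ : QState ι) :
    gatesOp (g :: l) φ = gatesOp l (g.op φ) := by
  simp [gatesOp]

theorem gatesOp_append (l l' : List (Gate ι)) (φ : QState ι) :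
    gatesOp (l ++ l') φ = gatesOp l' (gatesOp l φ) := by
  induction l generalizing φ with
  | nil => rfl
  | cons g l ih => rw [List.cons_append, gatesOp_cons, ih, gatesOp_cons]

theorem gatesOp_injective (l : List (Gate ι)) : Function.Injective (gatesOp l) := by
  induction l with
  | nil => exact fun _ _ h => h
  | cons g l ih =>
    intro φ ψ h
    rw [gatesOp_cons, gatesOp_cons] at h
    rw [← g.op_op φ, ih h, g.op_op]

/-- The bits which a gate adds to the basis state `x`, if it is a controlled-NOT gate. -/
def Gate.toggle : Gate ι → Bits ι → Bits ι
  | .had _, _ => 0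
  | .cnot c t _, x => Pi.single t (x c)

/-- The gate is a controlled-NOT gate with control in `S` and target outside of `S`. -/
def Gate.CnotFrom (S : Set ι) : Gate ι → Prop
  | .had _ => False
  | .cnot c t _ => c ∈ S ∧ t ∉ S

theorem Gate.CnotFrom.toggle_apply {S : Set ι} {g : Gate ι} (hg : g.CnotFrom S) (x : Bits ι)
    {i : ι} (hi : i ∈ S) : g.toggle x i = 0 := by
  cases g with
  | had i => exact hg.elim
  | cnot c t h => exact Pi.single_eq_of_ne (fun h : i = t => hg.2 (h ▸ hi)) _

theorem toggles_apply {S : Set ι} {l : List (Gate ι)} (hl : ∀ g ∈ l, g.CnotFrom S) (x : Bits ι)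
    {i : ι} (hi : i ∈ S) : (l.map fun g => g.toggle x).sum i = 0 := by
  induction l with
  | nil => rfl
  | cons g l ih =>
    rw [List.map_cons, List.sum_cons, Pi.add_apply, (hl g (by simp)).toggle_apply x hi,
      ih fun g hg => hl g (by simp [hg]), add_zero]

/-- No gate changes a control of another, so every gate reads the original bits and the order of the
gates does not matter. -/
theorem gatesOp_cnots {S : Set ι} {l : List (Gate ι)} (hl : ∀ g ∈ l, g.CnotFrom S) (φ : QState ι)
    (x : Bits ι) : gatesOp l φ x = φ (x + (l.map fun g => g.toggle x).sum) := by
  induction l generalizing φ with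
  | nil => simp [gatesOp_nil]
  | cons g l ih =>
    have hl' : ∀ g ∈ l, g.CnotFrom S := fun g hg => hl g (by simp [hg])
    rw [gatesOp_cons, ih hl']
    cases g with
    | had i => exact (hl (.had i) (by simp)).elim
    | cnot c t h =>
      have hc : c ∈ S := (hl (.cnot c t h) (by simp)).1
      rw [cnot_apply, Pi.add_apply, toggles_apply hl' x hc, add_zero, List.map_cons,
        List.sum_cons, add_assoc, add_comm (List.sum _)]
      rfl

/-- States supported on basis states with `pred` in which the qubits of `J` outside of `D`
are `0`, and not depending on the qubits in `D`. -/
def plusStates (pred : Bits ι → Prop) (J D : Set ι) : Set (QState ι) :=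
  {φ | (∀ x, φ x ≠ 0 → pred x ∧ ∀ i ∈ J, i ∉ D → x i = 0) ∧
    ∀ x x', (∀ i ∉ D, x i = x' i) → φ x = φ x'}

/-- A Hadamard gate turns a qubit in state `0` into one on which the amplitude does not depend, and
conversely. As the gate is an involution, the second inclusion is again a computation of the image
of a state. -/
theorem image_had {pred : Bits ι → Prop} {J D : Set ι}
    (hpred : ∀ x, ∀ i ∈ J, ∀ y, pred (Function.update x i y) → pred x) {i : ι} (hJ : i ∈ J)
    (hD : i ∉ D) :
    (Gate.had i).op '' plusStates pred J D = plusStates pred J (insert i D) := by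
  have s0 : ((Real.sqrt 2 : ℝ) : ℂ)⁻¹ ≠ 0 := by simp
  apply Set.Subset.antisymm
  · rintro _ ⟨φ, ⟨h1, h2⟩, rfl⟩
    have h : ∀ x, (Gate.had i).op φ x =
        ((Real.sqrt 2 : ℝ) : ℂ)⁻¹ * φ (Function.update x i 0) := fun x => by
      have : φ (Function.update x i 1) = 0 := by
        by_contra h0
        simpa using (h1 _ h0).2 i hJ hD
      rw [had_apply, this, mul_zero, add_zero]
    refine ⟨fun x hx => ?_, fun x x' hxx => ?_⟩
    · rw [h] at hx
      obtain ⟨h3, h4⟩ := h1 _ (right_ne_zero_of_mul hx)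
      refine ⟨hpred x i hJ _ h3, fun j hj hjD => ?_⟩
      rw [Set.mem_insert_iff, not_or] at hjD
      simpa [hjD.1] using h4 j hj hjD.2
    · rw [h, h]
      refine congrArg _ (h2 _ _ fun j hj => ?_)
      by_cases hji : j = i
      · subst hji
        simp
      · simpa [hji] using hxx j (by simp [hji, hj])
  · rintro φ ⟨h1, h2⟩
    have h : ∀ x, (Gate.had i).op φ x =
        ((Real.sqrt 2 : ℝ) : ℂ)⁻¹ * (1 + sign (x i)) * φ x := fun x => by
      have hu : ∀ y, φ (Function.update x i y) = φ x := fun y => h2 _ _ fun j hj => by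
        rw [Set.mem_insert_iff, not_or] at hj
        simp [hj.1]
      rw [had_apply, hu, hu]
      ring
    refine ⟨(Gate.had i).op φ, ⟨fun x hx => ?_, fun x x' hxx => ?_⟩, Gate.op_op _ _⟩
    · rw [h] at hx
      obtain ⟨h3, h4⟩ := h1 _ (right_ne_zero_of_mul hx)
      refine ⟨h3, fun j hj hjD => ?_⟩
      by_cases hji : j = i
      · subst hji
        rcases zmod_two_cases (x j) with h0 | h0
        · exact h0
        · exact absurd (by simp [h0, sign_one]) hx
      · exact h4 j hj (by simp [hji, hjD])
    · rw [h, h, hxx i hD, h2 x x' fun j hj => hxx j fun hjD => hj (Set.mem_insert_of_mem _ hjD)]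

theorem image_hads {pred : Bits ι → Prop} {J : Set ι}
    (hpred : ∀ x, ∀ i ∈ J, ∀ y, pred (Function.update x i y) → pred x) (l : List ι) {D : Set ι}
    (hl : l.Nodup) (hJ : ∀ i ∈ l, i ∈ J) (hD : ∀ i ∈ l, i ∉ D) :
    gatesOp (l.map Gate.had) '' plusStates pred J D = plusStates pred J (D ∪ {i | i ∈ l}) := by
  induction l generalizing D with
  | nil =>
    have : (gatesOp (([] : List ι).map Gate.had) : QState ι → QState ι) = id := rfl
    rw [this, Set.image_id]
    simp
  | cons i l ih =>
    have h : (gatesOp ((i :: l).map Gate.had) : QState ι → QState ι) =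
        gatesOp (l.map Gate.had) ∘ (Gate.had i).op := funext fun φ => gatesOp_cons _ _ _
    rw [h, Set.image_comp, image_had hpred (hJ i (by simp)) (hD i (by simp)),
      ih (List.nodup_cons.1 hl).2 (fun j hj => hJ j (by simp [hj]))]
    · congr 1
      ext j
      simp only [Set.mem_union, Set.mem_insert_iff, Set.mem_ofPred_eq, List.mem_cons]
      tauto
    · intro j hj
      rw [Set.mem_insert_iff, not_or]
      refine ⟨fun h => (List.nodup_cons.1 hl).1 (h ▸ hj), hD j (by simp [hj])⟩

/-- The circuit acts by pullback along `A`. Since `A` is an involution, equality of the image with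
`V'` amounts to two membership statements of the same shape. -/
theorem image_cnots {S : Set ι} {l : List (Gate ι)} (hl : ∀ g ∈ l, g.CnotFrom S)
    {V V' : Set (QState ι)} {A : Bits ι → Bits ι}
    (hA : ∀ x, x + (l.map fun g => g.toggle x).sum = A x) (hAA : ∀ x, A (A x) = x)
    (h1 : ∀ φ ∈ V, φ ∘ A ∈ V') (h2 : ∀ φ ∈ V', φ ∘ A ∈ V) : gatesOp l '' V = V' := by
  have h : ∀ φ, gatesOp l φ = φ ∘ A := fun φ => funext fun x => by
    rw [gatesOp_cnots hl, hA]
    rfl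
  apply Set.Subset.antisymm
  · rintro _ ⟨φ, hφ, rfl⟩
    rw [h]
    exact h1 φ hφ
  · intro φ hφ
    refine ⟨φ ∘ A, h2 φ hφ, ?_⟩
    rw [h]
    funext x
    simp [hAA]

theorem finrank_messageSpace (M : Finset ι) :
    Module.finrank ℂ (messageSpace M) = 2 ^ M.card := by
  classical
  let ext : (M → ZMod 2) → Bits ι := fun y i => if h : i ∈ M then y ⟨i, h⟩ else 0
  have hext : ∀ x : Bits ι, (∀ i ∉ M, x i = 0) → ext (fun i => x i) = x := fun x hx => by
    funext i
    by_cases h : i ∈ M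
    · simp [ext, h]
    · simp [ext, h, hx i h]
  let e : messageSpace M ≃ₗ[ℂ] ((M → ZMod 2) → ℂ) :=
    { toFun := fun φ y => φ.1 (ext y)
      map_add' := fun _ _ => rfl
      map_smul' := fun _ _ => rfl
      invFun := fun ψ => ⟨fun x => if ∀ i ∉ M, x i = 0 then ψ (fun i => x i) else 0,
        fun x ⟨i, hi, h0⟩ => if_neg fun h => h0 (h i hi)⟩
      left_inv := fun φ => by
        refine Subtype.ext (funext fun x => ?_)
        by_cases hx : ∀ i ∉ M, x i = 0
        · simp only [if_pos hx, hext x hx]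
        · simp only [if_neg hx]
          push Not at hx
          obtain ⟨i, hi, h0⟩ := hx
          exact (φ.2 x ⟨i, hi, h0⟩).symm
      right_inv := fun ψ => by
        funext y
        have h : ∀ i ∉ M, ext y i = 0 := fun i hi => by simp [ext, hi]
        simp only [if_pos h]
        congr 1
        funext i
        simp [ext, i.2] }
  rw [e.finrank_eq, Module.finrank_fintype_fun_eq_card]
  simp [ZMod.card]

end Circuits

/-! ### Encoding -/

section Encoding

variable {n₀ m r : ℕ}

/-- The kernel of a binary matrix in systematic form. -/
theorem exists_systematic (H : Matrix (Fin r) (Fin m) (ZMod 2)) :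
    ∃ (T : Finset (Fin m)) (B : Fin m → Fin m → ZMod 2), T.card ≤ r ∧
      ∀ y, H *ᵥ y = 0 ↔ ∀ p ∈ T, y p = ∑ f ∈ Tᶜ, B p f * y f := by
  classical
  -- `T` indexes a maximal independent set of columns, hence has at most `r` elements. The expansion
  -- of all columns in these gives `B`; the bits outside of `T` are free and determine those in `T`.
  obtain ⟨b, -, -, hspan, hli⟩ := exists_linearIndepOn_extension (K := ZMod 2) (v := H.col)
    (s := ∅) (t := Set.univ) (linearIndepOn_empty _ _) (Set.subset_univ _)
  obtain ⟨T, rfl⟩ : ∃ T : Finset (Fin m), (T : Set (Fin m)) = b := ⟨b.toFinset, by simp⟩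
  have hB : ∀ f, ∃ B : Fin m → ZMod 2, ∑ p ∈ T, B p • H.col p = H.col f := fun f =>
    (Submodule.mem_span_image_finset_iff_exists_fun' _).1 (hspan ⟨f, Set.mem_univ _, rfl⟩)
  choose B hB using hB
  refine ⟨T, fun p f => B f p, ?_, fun y => ?_⟩
  · have h := LinearIndependent.fintype_card_le_finrank hli
    simpa using h
  · have h : H *ᵥ y = ∑ p ∈ T, (y p + ∑ f ∈ Tᶜ, B f p * y f) • H.col p := by
      have h1 : H *ᵥ y = ∑ v, y v • H.col v := by
        funext c
        simp [Matrix.mulVec, dotProduct, Finset.sum_apply, mul_comm]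
      rw [h1, ← Finset.sum_add_sum_compl T]
      simp only [add_smul, Finset.sum_add_distrib, Finset.sum_smul]
      congr 1
      rw [Finset.sum_comm]
      refine Finset.sum_congr rfl fun f _ => ?_
      rw [← hB f, Finset.smul_sum]
      refine Finset.sum_congr rfl fun p _ => ?_
      rw [smul_smul, mul_comm]
    rw [h]
    constructor
    · intro h0 p hp
      exact CharTwo.add_eq_zero.1 (linearIndepOn_finset_iff.1 hli _ h0 p hp)
    · intro h0
      refine Finset.sum_eq_zero fun p hp => ?_
      rw [h0 p hp, CharTwo.add_self_eq_zero, zero_smul]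

/-- Controlled-NOT gates from the first qubits of the blocks outside of `T` to those in `T`. -/
def outerGate (hn : 0 < n₀) (T : Finset (Fin m)) (B : Fin m → Fin m → ZMod 2) (p f : Fin m) :
    List (Gate (Qubit n₀ m)) :=
  if h : p ∈ T ∧ f ∉ T ∧ B p f ≠ 0 then
    [Gate.cnot (f, ⟨0, hn⟩) (p, ⟨0, hn⟩) fun e => h.2.1 (by
      rw [show f = p from (Prod.ext_iff.1 e).1]
      exact h.1)]
  else []

/-- The controlled-NOT gate from qubit `i` to the first qubit of the block `v`. -/
def innerGate (hn : 0 < n₀) (i : Fin n₀) (v : Fin m) : List (Gate (Qubit n₀ m)) :=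
  if h : i = ⟨0, hn⟩ then [] else
    [Gate.cnot (v, i) (v, ⟨0, hn⟩) fun e => h (Prod.ext_iff.1 e).2]

/-- Encode the outer code into the first qubits of the blocks. -/
def outerLayers [NeZero m] (hn : 0 < n₀) (T : Finset (Fin m)) (B : Fin m → Fin m → ZMod 2) :
    Circuit (Qubit n₀ m) :=
  -- Layer `t` contains the gates whose control and target blocks add up to `t` modulo `m`. Within a
  -- layer each of the two blocks determines the other, and targets lie in `T` while controls do
  -- not, so the gates are disjoint.
  (List.finRange m).map fun t => (List.finRange m).flatMap fun p => outerGate hn T B p (t - p)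

/-- Encode the inner code, starting from superpositions on the other qubits of the blocks. -/
def innerLayers (m : ℕ) (hn : 0 < n₀) : Circuit (Qubit n₀ m) :=
  (List.finRange n₀).map fun i => (List.finRange m).flatMap fun v => innerGate hn i v

/-- The qubits which are not the first of their block. -/
def restQubits (m : ℕ) (hn : 0 < n₀) : Finset (Qubit n₀ m) :=
  Finset.univ.filter fun i => i.2 ≠ ⟨0, hn⟩

/-- The encoding circuit. -/
noncomputable def encoder [NeZero m] (hn : 0 < n₀) (T : Finset (Fin m))
    (B : Fin m → Fin m → ZMod 2) : Circuit (Qubit n₀ m) :=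
  outerLayers hn T B ++ [(restQubits m hn).toList.map Gate.had] ++ innerLayers m hn

theorem sum_map_flatten_flatMap {α M : Type} [AddCommMonoid M] {k l : ℕ}
    (g : Fin k → Fin l → List α) (f : α → M) :
    ((((List.finRange k).map fun t => (List.finRange l).flatMap fun p => g t p).flatten).map
      f).sum = ∑ t, ∑ p, ((g t p).map f).sum := by
  rw [List.map_flatten, List.sum_flatten, List.map_map, List.map_map, ← Fin.sum_univ_def]
  refine Finset.sum_congr rfl fun t _ => ?_
  simp only [Function.comp_apply, List.flatMap, List.map_flatten, List.sum_flatten, List.map_map]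
  rw [← Fin.sum_univ_def]
  rfl

theorem mem_outerLayers [NeZero m] {hn : 0 < n₀} {T : Finset (Fin m)}
    {B : Fin m → Fin m → ZMod 2} {g : Gate (Qubit n₀ m)}
    (hg : g ∈ (outerLayers hn T B).flatten) :
    ∃ p f h, g = Gate.cnot (f, ⟨0, hn⟩) (p, ⟨0, hn⟩) h ∧ p ∈ T ∧ f ∉ T := by
  simp only [outerLayers, List.mem_flatten, List.mem_map, List.mem_finRange, true_and] at hg
  obtain ⟨_, ⟨t, rfl⟩, hg⟩ := hg
  obtain ⟨p, -, hg⟩ := List.mem_flatMap.1 hg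
  rw [outerGate] at hg
  split_ifs at hg with h
  · exact ⟨p, _, _, List.mem_singleton.1 hg, h.1, h.2.1⟩
  · simp at hg

theorem mem_innerLayers {hn : 0 < n₀} {g : Gate (Qubit n₀ m)}
    (hg : g ∈ (innerLayers m hn).flatten) :
    ∃ v i h, g = Gate.cnot (v, i) (v, ⟨0, hn⟩) h ∧ i ≠ ⟨0, hn⟩ := by
  simp only [innerLayers, List.mem_flatten, List.mem_map, List.mem_finRange, true_and] at hg
  obtain ⟨_, ⟨i, rfl⟩, hg⟩ := hg
  obtain ⟨v, -, hg⟩ := List.mem_flatMap.1 hg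
  rw [innerGate] at hg
  split_ifs at hg with h
  · simp at hg
  · exact ⟨v, i, _, List.mem_singleton.1 hg, h⟩

theorem toggles_outerLayers [NeZero m] (hn : 0 < n₀) (T : Finset (Fin m))
    (B : Fin m → Fin m → ZMod 2) (x : Bits (Qubit n₀ m)) :
    ((outerLayers hn T B).flatten.map fun g => g.toggle x).sum = firstQubits hn fun p =>
      if p ∈ T then ∑ f ∈ Tᶜ, B p f * x (f, ⟨0, hn⟩) else 0 := by
  have h : ∀ p f, ((outerGate hn T B p f).map fun g => g.toggle x).sum =
      firstQubits hn (Pi.single p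
        (if p ∈ T ∧ f ∉ T then B p f * x (f, ⟨0, hn⟩) else 0)) := fun p f => by
    rw [outerGate]
    split_ifs with h1 h2 h2
    · rcases zmod_two_cases (B p f) with h0 | h0
      · exact absurd h0 h1.2.2
      funext ⟨v, i⟩
      simp only [List.map_cons, List.map_nil, List.sum_cons, List.sum_nil, add_zero, Gate.toggle,
        firstQubits, Pi.single_apply, Prod.mk.injEq, h0, one_mul]
      split_ifs <;> tauto
    · tauto
    · have : B p f = 0 := by
        by_contra h0
        exact h1 ⟨h2.1, h2.2, h0⟩
      funext ⟨v, i⟩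
      simp [this, firstQubits]
    · funext ⟨v, i⟩
      simp [firstQubits]
  rw [outerLayers, sum_map_flatten_flatMap (fun t p => outerGate hn T B p (t - p)),
    Finset.sum_comm]
  simp only [h]
  funext ⟨v, i⟩
  simp only [Finset.sum_apply, firstQubits]
  by_cases hi : i = ⟨0, hn⟩
  · simp only [hi, if_true]
    rw [Finset.sum_eq_single v]
    · simp only [Pi.single_eq_same]
      -- For a fixed target block, running through the layers is running through all control blocks.
      rw [show (∑ t, if v ∈ T ∧ t - v ∉ T then B v (t - v) * x (t - v, ⟨0, hn⟩) else 0) = _ from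
        (Equiv.subRight v).sum_comp
        (fun f => if v ∈ T ∧ f ∉ T then B v f * x (f, ⟨0, hn⟩) else 0)]
      by_cases hv : v ∈ T
      · simp only [hv, true_and, if_true]
        rw [← Finset.sum_filter]
        congr 1
        ext f
        simp
      · simp [hv]
    · intro p _ hp
      simp [Pi.single_eq_of_ne (Ne.symm hp)]
    · simp
  · simp [hi]

theorem toggles_innerLayers (hn : 0 < n₀) (x : Bits (Qubit n₀ m)) :
    ((innerLayers m hn).flatten.map fun g => g.toggle x).sum =
      firstQubits hn (blockParity x + fun v => x (v, ⟨0, hn⟩)) := by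
  have h : ∀ (i : Fin n₀) (v : Fin m), ((innerGate hn i v).map fun g => g.toggle x).sum =
      firstQubits hn (Pi.single v (if i = ⟨0, hn⟩ then 0 else x (v, i))) := fun i v => by
    rw [innerGate]
    split_ifs with h1
    · funext ⟨v, i⟩
      simp [firstQubits]
    · funext ⟨v', i'⟩
      simp only [List.map_cons, List.map_nil, List.sum_cons, List.sum_nil, add_zero, Gate.toggle,
        firstQubits, Pi.single_apply, Prod.mk.injEq]
      split_ifs <;> tauto
  rw [innerLayers, sum_map_flatten_flatMap (fun i v => innerGate hn i v)]
  simp only [h]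
  funext ⟨v, i⟩
  simp only [Finset.sum_apply, firstQubits]
  by_cases hi : i = ⟨0, hn⟩
  · simp only [hi, if_true, Pi.add_apply, blockParity]
    rw [Finset.sum_comm, Finset.sum_eq_single v]
    · simp only [Pi.single_eq_same]
      rw [← Finset.add_sum_erase _ _ (Finset.mem_univ ⟨0, hn⟩),
        ← Finset.add_sum_erase (a := ⟨0, hn⟩) _ (fun i => x (v, i)) (Finset.mem_univ _)]
      rw [if_pos rfl, zero_add, add_comm (x _), add_assoc, CharTwo.add_self_eq_zero, add_zero]
      refine Finset.sum_congr rfl fun i hi => if_neg (Finset.ne_of_mem_erase hi)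
    · intro p _ hp
      simp [Pi.single_eq_of_ne (Ne.symm hp)]
    · simp
  · simp [hi]

theorem pairwise_flatMap_finRange {ι : Type} [DecidableEq ι] {k : ℕ} (g : Fin k → List (Gate ι))
    (h1 : ∀ p, (g p).length ≤ 1)
    (h2 : ∀ p p', p ≠ p' → ∀ a ∈ g p, ∀ b ∈ g p', Disjoint a.support b.support) :
    ((List.finRange k).flatMap g).Pairwise fun a b => Disjoint a.support b.support := by
  rw [List.pairwise_flatMap]
  refine ⟨fun p _ => ?_, (List.nodup_finRange k).imp fun hne => h2 _ _ hne⟩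
  have := h1 p
  match g p, this with
  | [], _ => exact List.Pairwise.nil
  | [a], _ => exact List.pairwise_singleton _ a

theorem length_flatMap_finRange_le {α : Type} {k : ℕ} (g : Fin k → List α)
    (h1 : ∀ p, (g p).length ≤ 1) : ((List.finRange k).flatMap g).length ≤ k := by
  rw [List.length_flatMap, ← Fin.sum_univ_def]
  exact (Finset.sum_le_card_nsmul _ _ 1 fun p _ => h1 p).trans (by simp)

theorem outerGate_length_le (hn : 0 < n₀) (T : Finset (Fin m)) (B : Fin m → Fin m → ZMod 2)
    (p f : Fin m) : (outerGate hn T B p f).length ≤ 1 := by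
  rw [outerGate]
  split_ifs <;> simp

theorem innerGate_length_le (hn : 0 < n₀) (i : Fin n₀) (v : Fin m) :
    (innerGate hn i v).length ≤ 1 := by
  rw [innerGate]
  split_ifs <;> simp

theorem length_flatten_map_finRange_le {α : Type} {k l : ℕ} (g : Fin k → List α)
    (h : ∀ p, (g p).length ≤ l) : ((List.finRange k).map g).flatten.length ≤ k * l := by
  rw [List.length_flatten, List.map_map, ← Fin.sum_univ_def]
  exact (Finset.sum_le_card_nsmul _ _ l fun p _ => h p).trans (by simp)

theorem encoder_wellFormed [NeZero m] (hn : 0 < n₀) (T : Finset (Fin m))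
    (B : Fin m → Fin m → ZMod 2) : (encoder hn T B).WellFormed := by
  intro layer hlayer
  simp only [encoder, List.mem_append, List.mem_singleton, or_assoc] at hlayer
  rcases hlayer with h | rfl | h
  · obtain ⟨t, -, rfl⟩ := List.mem_map.1 h
    refine pairwise_flatMap_finRange _ (fun p => outerGate_length_le _ _ _ _ _) ?_
    intro p p' hne a ha b hb
    rw [outerGate] at ha hb
    split_ifs at ha with h1
    on_goal 2 => simp at ha
    split_ifs at hb with h2
    on_goal 2 => simp at hb
    rw [List.mem_singleton] at ha hb
    subst ha hb
    have h3 : p ≠ t - p' := fun h => h2.2.1 (h ▸ h1.1)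
    have h4 : t - p ≠ p' := fun h => h1.2.1 (h ▸ h2.1)
    have h5 : t - p ≠ t - p' := fun h => hne (sub_right_injective h)
    simp [Gate.support, h3.symm, Ne.symm h4, Ne.symm h5, Ne.symm hne]
  · rw [List.pairwise_map]
    refine (Finset.nodup_toList _).imp fun hne => ?_
    simpa [Gate.support] using hne
  · obtain ⟨i, -, rfl⟩ := List.mem_map.1 h
    refine pairwise_flatMap_finRange _ (fun p => innerGate_length_le _ _ _) ?_
    intro p p' hne a ha b hb
    rw [innerGate] at ha hb
    split_ifs at ha with h1
    · simp at ha
    split_ifs at hb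
    rw [List.mem_singleton] at ha hb
    subst ha hb
    simp [Gate.support, Ne.symm hne]

theorem encoder_size_le [NeZero m] (hn : 0 < n₀) (T : Finset (Fin m))
    (B : Fin m → Fin m → ZMod 2) : (encoder hn T B).size ≤ m * m + 2 * (n₀ * m) := by
  have h1 : (outerLayers hn T B).flatten.length ≤ m * m :=
    length_flatten_map_finRange_le _ fun t =>
      length_flatMap_finRange_le _ fun p => outerGate_length_le _ _ _ _ _
  have h2 : (innerLayers m hn).flatten.length ≤ n₀ * m :=
    length_flatten_map_finRange_le _ fun t =>
      length_flatMap_finRange_le _ fun p => innerGate_length_le _ _ _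
  have h3 : (restQubits m hn).card ≤ n₀ * m :=
    (Finset.card_le_univ _).trans (by simp [mul_comm])
  simp only [Circuit.size, encoder, List.flatten_append, List.length_append, List.flatten_cons,
    List.flatten_nil, List.append_nil, List.length_map, Finset.length_toList]
  omega

theorem encoder_depth [NeZero m] (hn : 0 < n₀) (T : Finset (Fin m))
    (B : Fin m → Fin m → ZMod 2) : (encoder hn T B).depth = m + 1 + n₀ := by
  simp [Circuit.depth, encoder, outerLayers, innerLayers]
  ring

/-- The circuit is the pullback along the involution adding `∑ B p f * x f` to the bit of each `p ∈
T`. It exchanges the condition that these bits vanish with the systematic equations of the kernel.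
-/
theorem image_outerLayers [NeZero m] (hn : 0 < n₀) {T : Finset (Fin m)}
    {B : Fin m → Fin m → ZMod 2} {H : Matrix (Fin r) (Fin m) (ZMod 2)}
    (hTB : ∀ y, H *ᵥ y = 0 ↔ ∀ p ∈ T, y p = ∑ f ∈ Tᶜ, B p f * y f) :
    gatesOp (outerLayers hn T B).flatten ''
        messageSpace (Finset.univ.filter fun i : Qubit n₀ m => i.2 = ⟨0, hn⟩ ∧ i.1 ∉ T) =
      plusStates (fun x => H *ᵥ (fun v => x (v, ⟨0, hn⟩)) = 0) (restQubits m hn) ∅ := by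
  have hfst : ∀ (y : Fin m → ZMod 2) v, firstQubits hn y (v, ⟨0, hn⟩) = y v := fun y v => by
    simp [firstQubits]
  have hrest : ∀ (y : Fin m → ZMod 2) (i : Qubit n₀ m), i.2 ≠ ⟨0, hn⟩ → firstQubits hn y i = 0 :=
    fun y i hi => by simp [firstQubits, hi]
  let A : Bits (Qubit n₀ m) → Bits (Qubit n₀ m) := fun x => x + firstQubits hn fun p =>
      if p ∈ T then ∑ f ∈ Tᶜ, B p f * x (f, ⟨0, hn⟩) else 0
  have hAf : ∀ x, ∀ f ∉ T, A x (f, ⟨0, hn⟩) = x (f, ⟨0, hn⟩) := fun x f hf => by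
    simp [A, hfst, hf]
  have hAp : ∀ x, ∀ p ∈ T, A x (p, ⟨0, hn⟩) =
      x (p, ⟨0, hn⟩) + ∑ f ∈ Tᶜ, B p f * x (f, ⟨0, hn⟩) := fun x p hp => by
    simp [A, hfst, hp]
  have hAr : ∀ x i, i.2 ≠ ⟨0, hn⟩ → A x i = x i := fun x i hi => by
    simp [A, hrest _ i hi]
  have hsum : ∀ x p, ∑ f ∈ Tᶜ, B p f * A x (f, ⟨0, hn⟩) =
      ∑ f ∈ Tᶜ, B p f * x (f, ⟨0, hn⟩) := fun x p =>
    Finset.sum_congr rfl fun f hf => by rw [hAf x f (Finset.mem_compl.1 hf)]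
  refine image_cnots (S := {i | i.1 ∉ T}) (A := A) ?_ ?_ ?_ ?_ ?_
  · intro g hg
    obtain ⟨p, f, h, rfl, hp, hf⟩ := mem_outerLayers hg
    exact ⟨hf, fun h => h hp⟩
  · intro x
    rw [toggles_outerLayers]
  · intro x
    funext ⟨v, i⟩
    by_cases hi : i = ⟨0, hn⟩
    · subst hi
      by_cases hv : v ∈ T
      · rw [hAp _ _ hv, hAp _ _ hv, hsum, add_assoc, CharTwo.add_self_eq_zero, add_zero]
      · rw [hAf _ _ hv, hAf _ _ hv]
    · rw [hAr _ _ hi, hAr _ _ hi]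
  · intro φ hφ
    refine ⟨fun x hx => ?_, fun x x' hxx => ?_⟩
    · have hz : ∀ i : Qubit n₀ m, ¬ (i.2 = ⟨0, hn⟩ ∧ i.1 ∉ T) → A x i = 0 := fun i hi => by
        by_contra h0
        exact hx (hφ (A x) ⟨i, by simpa using hi, h0⟩)
      refine ⟨(hTB _).2 fun p hp => ?_, fun i hi _ => ?_⟩
      · have := hz (p, ⟨0, hn⟩) (by simp [hp])
        rw [hAp _ _ hp] at this
        exact CharTwo.add_eq_zero.1 this
      · have hi' : i.2 ≠ ⟨0, hn⟩ := by simpa [restQubits] using hi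
        rw [← hAr x i hi']
        exact hz i fun h => hi' h.1
    · rw [show x = x' from funext fun i => hxx i (Set.notMem_empty i)]
  · rintro φ ⟨h1, -⟩ x ⟨⟨v, i⟩, hi, hxi⟩
    by_contra h0
    obtain ⟨h2, h3⟩ := h1 _ h0
    by_cases hi0 : i = ⟨0, hn⟩
    · subst hi0
      have hv : v ∈ T := by
        by_contra hv
        simp [hv] at hi
      have h4 := (hTB _).1 h2 v hv
      rw [hAp _ _ hv, hsum] at h4
      exact hxi (by simpa using h4)
    · rw [← hAr x (v, i) hi0] at hxi
      exact hxi (h3 (v, i) (by simp [restQubits, hi0]) (Set.notMem_empty _))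

/-- The circuit is the pullback along the involution that exchanges the first bit of each block with
the parity of the block. Depending on first bits only thus becomes depending on parities only. -/
theorem image_innerLayers (hn : 0 < n₀) (H : Matrix (Fin r) (Fin m) (ZMod 2)) :
    gatesOp (innerLayers m hn).flatten ''
        plusStates (fun x => H *ᵥ (fun v => x (v, ⟨0, hn⟩)) = 0) (restQubits m hn)
          (restQubits m hn) = code n₀ H := by
  have hfst : ∀ (y : Fin m → ZMod 2) v, firstQubits hn y (v, ⟨0, hn⟩) = y v := fun y v => by
    simp [firstQubits]
  have hrest : ∀ (y : Fin m → ZMod 2) (i : Qubit n₀ m), i.2 ≠ ⟨0, hn⟩ → firstQubits hn y i = 0 :=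
    fun y i hi => by simp [firstQubits, hi]
  let A : Bits (Qubit n₀ m) → Bits (Qubit n₀ m) := fun x =>
    x + firstQubits hn (blockParity x + fun v => x (v, ⟨0, hn⟩))
  have hA0 : ∀ x v, A x (v, ⟨0, hn⟩) = blockParity x v := fun x v => by
    simp only [A, Pi.add_apply, hfst]
    rw [add_comm, add_assoc, CharTwo.add_self_eq_zero, add_zero]
  have hAr : ∀ x i, i.2 ≠ ⟨0, hn⟩ → A x i = x i := fun x i hi => by
    simp [A, hrest _ i hi]
  have hAb : ∀ x, blockParity (A x) = fun v => x (v, ⟨0, hn⟩) := fun x => by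
    simp only [A, blockParity_add, blockParity_firstQubits]
    rw [← add_assoc, bits_add_self, zero_add]
  refine image_cnots (S := {i | i.2 ≠ ⟨0, hn⟩}) (A := A) ?_ ?_ ?_ ?_ ?_
  · intro g hg
    obtain ⟨v, i, h, rfl, hi⟩ := mem_innerLayers hg
    exact ⟨hi, fun h => h rfl⟩
  · intro x
    rw [toggles_innerLayers]
  · intro x
    funext ⟨v, i⟩
    by_cases hi : i = ⟨0, hn⟩
    · subst hi
      rw [hA0, hAb]
    · rw [hAr _ _ hi, hAr _ _ hi]
  · rintro φ ⟨h1, h2⟩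
    refine (mem_code hn).2 ⟨fun x hx => ?_, fun x u hu => ?_⟩
    · have := (h1 _ hx).1
      simpa only [hA0] using this
    · refine h2 _ _ fun ⟨v, i⟩ hi => ?_
      have hi : i = ⟨0, hn⟩ := by simpa [restQubits] using hi
      subst hi
      rw [hA0, hA0, blockParity_add, hu, add_zero]
  · intro φ hφ
    obtain ⟨h1, h2⟩ := (mem_code hn).1 hφ
    refine ⟨fun x hx => ⟨?_, fun i hi hi' => absurd hi hi'⟩, fun x x' hxx => ?_⟩
    · have := h1 _ hx
      rwa [hAb] at this
    · have h : blockParity (A x + A x') = 0 := by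
        rw [blockParity_add, hAb, hAb]
        funext v
        rw [Pi.add_apply, hxx (v, ⟨0, hn⟩) (by simp [restQubits]), CharTwo.add_self_eq_zero]
        rfl
      have h3 := h2 (A x) _ h
      rw [← add_assoc, bits_add_self, zero_add] at h3
      exact h3.symm

theorem map_encoder [NeZero m] (hn : 0 < n₀) {T : Finset (Fin m)}
    {B : Fin m → Fin m → ZMod 2} {H : Matrix (Fin r) (Fin m) (ZMod 2)}
    (hTB : ∀ y, H *ᵥ y = 0 ↔ ∀ p ∈ T, y p = ∑ f ∈ Tᶜ, B p f * y f) :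
    (messageSpace (Finset.univ.filter fun i : Qubit n₀ m => i.2 = ⟨0, hn⟩ ∧ i.1 ∉ T)).map
      (encoder hn T B).op = code n₀ H := by
  apply SetLike.coe_injective
  rw [Submodule.map_coe, ← image_innerLayers hn H]
  have h : ((encoder hn T B).op : QState (Qubit n₀ m) → QState (Qubit n₀ m)) =
      gatesOp (innerLayers m hn).flatten ∘ gatesOp ((restQubits m hn).toList.map Gate.had) ∘
        gatesOp (outerLayers hn T B).flatten := by
    funext φ
    change gatesOp (encoder hn T B).flatten φ = _
    simp only [encoder, List.flatten_append, List.flatten_cons, List.flatten_nil, List.append_nil,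
      gatesOp_append, Function.comp_apply]
  rw [h, Set.image_comp, Set.image_comp, image_outerLayers hn hTB, image_hads]
  · simp only [Set.empty_union, Finset.mem_toList]
    rfl
  · intro x i hi y
    have hi : i.2 ≠ ⟨0, hn⟩ := by simpa [restQubits] using hi
    have : ∀ v, (v, ⟨0, hn⟩) ≠ i := fun v h => hi (h ▸ rfl)
    simp [Function.update_of_ne (this _)]
  · exact Finset.nodup_toList _
  · intro i hi
    simpa using hi
  · simp

/-- The encoder is injective, so the code has the dimension of the message space. The message qubits
are the first qubits of the blocks outside of `T`, and `T` has at most `r` elements. -/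
theorem exists_encoder (hm : 0 < m) (hn : 0 < n₀) (H : Matrix (Fin r) (Fin m) (ZMod 2)) :
    (∃ k, Module.finrank ℂ (code n₀ H) = 2 ^ k ∧ m ≤ k + r) ∧
    ∃ circ : Circuit (Qubit n₀ m), circ.Encodes (code n₀ H) ∧
      circ.size ≤ m * m + 2 * (n₀ * m) ∧ circ.depth ≤ m + 1 + n₀ := by
  have : NeZero m := ⟨hm.ne'⟩
  obtain ⟨T, B, hT, hTB⟩ := exists_systematic H
  have hmap := map_encoder hn hTB
  refine ⟨⟨(Finset.univ.filter fun i : Qubit n₀ m => i.2 = ⟨0, hn⟩ ∧ i.1 ∉ T).card, ?_, ?_⟩,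
    encoder hn T B, ⟨encoder_wellFormed hn T B, _, hmap⟩,
    encoder_size_le hn T B, (encoder_depth hn T B).le⟩
  · rw [← finrank_messageSpace, ← hmap]
    exact (Submodule.equivMapOfInjective _ (gatesOp_injective _) _).finrank_eq.symm
  · have : Tᶜ.card ≤
        (Finset.univ.filter fun i : Qubit n₀ m => i.2 = ⟨0, hn⟩ ∧ i.1 ∉ T).card :=
      Finset.card_le_card_of_injOn (fun v => (v, ⟨0, hn⟩)) (fun v hv => by simpa using hv)
        fun v _ w _ h => (Prod.ext_iff.1 h).1
    rw [Finset.card_compl, Fintype.card_fin] at this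
    omega

end Encoding

/-! ### Lossless expanders -/

section Expander

variable {m q : ℕ}

/-- The neighbours of a set of variables in the bipartite graph in which the variable `v` is joined
to the check `f v j` of the `j`-th block, for each `j`. -/
def nbrs (f : Fin m → Fin 8 → Fin q) (S : Finset (Fin m)) : Finset (Fin 8 × Fin q) :=
  (S ×ˢ Finset.univ).image fun e => (e.2, f e.1 e.2)

theorem mem_nbrs {f : Fin m → Fin 8 → Fin q} {S : Finset (Fin m)} {c : Fin 8 × Fin q} :
    c ∈ nbrs f S ↔ ∃ v ∈ S, f v c.1 = c.2 := by
  simp only [nbrs, Finset.mem_image, Finset.mem_product, Finset.mem_univ, and_true, Prod.exists]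
  constructor
  · rintro ⟨v, j, hv, rfl⟩
    exact ⟨v, hv, rfl⟩
  · rintro ⟨v, hv, h⟩
    exact ⟨v, c.1, hv, by rw [h]⟩

/-- From `k! ≥ (k/e)^k` and `e < 3`. -/
theorem choose_le_three_mul_div_pow (n k : ℕ) (hk : 0 < k) :
    (n.choose k : ℝ) ≤ (3 * n / k) ^ k := by
  have h1 : (n.choose k : ℝ) ≤ (n : ℝ) ^ k / k.factorial := Nat.choose_le_pow_div k n
  have h2 : (k : ℝ) ^ k / k.factorial ≤ 3 ^ k := by
    refine (Real.pow_div_factorial_le_exp _ (Nat.cast_nonneg k) k).trans ?_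
    rw [← Real.exp_one_pow]
    exact pow_le_pow_left₀ (Real.exp_pos _).le (by linarith [Real.exp_one_lt_d9]) _
  have hk' : (0 : ℝ) < (k : ℝ) ^ k := by positivity
  have hf : (0 : ℝ) < k.factorial := by positivity
  rw [div_le_iff₀ hf] at h2
  refine h1.trans ?_
  rw [div_pow, mul_pow, div_le_div_iff₀ hf hk']
  have hn : (0 : ℝ) ≤ (n : ℝ) ^ k := by positivity
  nlinarith [mul_le_mul_of_nonneg_left h2 hn]

theorem prod_le_mean_pow (k : Fin 8 → ℕ) : (∏ j, (k j : ℝ)) ≤ ((∑ j, k j : ℕ) / 8 : ℝ) ^ 8 := by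
  have h := Real.geom_mean_le_arith_mean_weighted Finset.univ (fun _ : Fin 8 => (1 / 8 : ℝ))
    (fun j => (k j : ℝ)) (fun _ _ => by norm_num) (by simp) (fun j _ => Nat.cast_nonneg _)
  rw [← Finset.mul_sum] at h
  have h8 : (∏ j, (k j : ℝ)) = (∏ j, (k j : ℝ) ^ (1 / 8 : ℝ)) ^ 8 := by
    rw [← Finset.prod_pow]
    refine Finset.prod_congr rfl fun j _ => ?_
    rw [← Real.rpow_natCast, ← Real.rpow_mul (Nat.cast_nonneg _)]
    norm_num
  rw [h8]
  refine pow_le_pow_left₀ (Finset.prod_nonneg fun j _ => by positivity) (h.trans (le_of_eq ?_)) 8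
  push_cast
  ring

/-- A variable in `S` chooses its neighbour in each block from the part of `K` in that block. The
product of the eight part sizes is at most `(|K|/8)^8` by the inequality of the means. The other
variables are free. -/
theorem card_graphs_into (S : Finset (Fin m)) (K : Finset (Fin 8 × Fin q)) :
    (((Finset.univ.filter fun f : Fin m → Fin 8 → Fin q => nbrs f S ⊆ K).card : ℕ) : ℝ) ≤
      ((K.card / 8 : ℝ) ^ 8) ^ S.card * ((q : ℝ) ^ 8) ^ (m - S.card) := by
  classical
  let k : Fin 8 → ℕ := fun j => (Finset.univ.filter fun t => (j, t) ∈ K).card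
  have hk : ∑ j, k j = K.card := by
    rw [← Finset.card_sigma]
    refine Finset.card_bij (fun a _ => (a.1, a.2)) ?_ ?_ ?_
    · rintro ⟨j, t⟩ h
      simpa using h
    · rintro ⟨j, t⟩ _ ⟨j', t'⟩ _ h
      simpa using h
    · rintro ⟨j, t⟩ h
      exact ⟨⟨j, t⟩, by simpa using h, rfl⟩
  have hsub : (Finset.univ.filter fun f : Fin m → Fin 8 → Fin q => nbrs f S ⊆ K) ⊆
      Fintype.piFinset fun v => if v ∈ S then
        Fintype.piFinset fun j => Finset.univ.filter fun t => (j, t) ∈ K else Finset.univ := by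
    intro f hf
    rw [Finset.mem_filter] at hf
    rw [Fintype.mem_piFinset]
    intro v
    split_ifs with hv
    · rw [Fintype.mem_piFinset]
      intro j
      simpa using hf.2 (mem_nbrs.2 ⟨v, hv, rfl⟩)
    · simp
  have hcard := Finset.card_le_card hsub
  rw [Fintype.card_piFinset] at hcard
  have hprod : (∏ v, (if v ∈ S then
        Fintype.piFinset fun j => Finset.univ.filter fun t => (j, t) ∈ K
          else (Finset.univ : Finset (Fin 8 → Fin q))).card) =
      (∏ j, k j) ^ S.card * (q ^ 8) ^ (m - S.card) := by
    rw [← Finset.prod_mul_prod_compl S]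
    congr 1
    · rw [Finset.prod_congr rfl fun v hv => by rw [if_pos hv, Fintype.card_piFinset],
        Finset.prod_const]
    · rw [Finset.prod_congr rfl fun v hv => by rw [if_neg (Finset.mem_compl.1 hv)],
        Finset.prod_const, Finset.card_compl, Fintype.card_fin]
      simp
  rw [hprod] at hcard
  refine (Nat.cast_le.2 hcard).trans ?_
  push_cast
  refine mul_le_mul_of_nonneg_right ?_ (by positivity)
  refine pow_le_pow_left₀ (Finset.prod_nonneg fun _ _ => Nat.cast_nonneg _) ?_ _
  have := prod_le_mean_pow k
  rwa [hk] at this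

/-- The term of the union bound for sets of size `s`. Per element of the set the powers of `q / s`
are 1 from the choice of variables, 6 from the choice of checks and -8 from the edges, so a factor
`s / q` survives and can be made small. -/
theorem expander_term_le {s : ℕ} (hs : 0 < s) (hsm : s ≤ m) (hm : m ≤ 32 * q)
    (hsq : s * 2 ^ 18 ≤ q) :
    (m.choose s : ℝ) * (((8 * q).choose (6 * s) : ℝ) *
      (((((6 * s : ℕ) : ℝ) / 8) ^ 8) ^ s * ((q : ℝ) ^ 8) ^ (m - s))) ≤
      (1 / 4) ^ s * ((q : ℝ) ^ 8) ^ m := by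
  have hs' : (0 : ℝ) < s := by exact_mod_cast hs
  have hq' : (0 : ℝ) < q := by
    have : 0 < q := by omega
    exact_mod_cast this
  have h1 : (m.choose s : ℝ) ≤ (96 * q / s) ^ s := by
    refine (choose_le_three_mul_div_pow m s hs).trans (pow_le_pow_left₀ (by positivity) ?_ _)
    have : (m : ℝ) ≤ 32 * q := by exact_mod_cast hm
    exact div_le_div_of_nonneg_right (by linarith) hs'.le
  have h2 : ((8 * q).choose (6 * s) : ℝ) ≤ ((4 * q / s) ^ 6) ^ s := by
    refine (choose_le_three_mul_div_pow (8 * q) (6 * s) (by omega)).trans (le_of_eq ?_)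
    rw [← pow_mul]
    congr 1
    push_cast
    field_simp
    ring
  have h3 : ((q : ℝ) ^ 8) ^ m = ((q : ℝ) ^ 8) ^ s * ((q : ℝ) ^ 8) ^ (m - s) := by
    rw [← pow_add]
    congr 1
    omega
  rw [h3]
  calc _ ≤ (96 * q / s : ℝ) ^ s * (((4 * q / s : ℝ) ^ 6) ^ s *
        (((((6 * s : ℕ) : ℝ) / 8) ^ 8) ^ s * ((q : ℝ) ^ 8) ^ (m - s))) := by gcongr
    -- `39366 = 96 · 4^6 · (6/8)^8`, and it is below `2^18 / 4`.
    _ = (39366 * (s / q) * (q : ℝ) ^ 8) ^ s * ((q : ℝ) ^ 8) ^ (m - s) := by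
      rw [← mul_assoc, ← mul_assoc, ← mul_pow, ← mul_pow]
      congr 2
      push_cast
      field_simp
      ring
    _ ≤ (1 / 4 * (q : ℝ) ^ 8) ^ s * ((q : ℝ) ^ 8) ^ (m - s) := by
      have : (s / q : ℝ) ≤ 1 / 2 ^ 18 := by
        rw [div_le_div_iff₀ hq' (by positivity), one_mul]
        exact_mod_cast hsq
      gcongr
      linarith
    _ = _ := by rw [mul_pow, mul_assoc]

theorem sum_quarter_pow (T : ℕ) : ∑ s ∈ Finset.Icc 1 T, (1 / 4 : ℝ) ^ s < 1 := by
  have h : ∑ s ∈ Finset.Icc 1 T, (1 / 4 : ℝ) ^ s = (1 - (1 / 4) ^ T) / 3 := by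
    induction T with
    | zero => simp
    | succ T ih =>
      rw [Finset.sum_Icc_succ_top (by omega), ih]
      ring
  rw [h]
  have : (0 : ℝ) < (1 / 4) ^ T := by positivity
  linarith

/-- If every graph were bad, the graphs sending some `S` into some `K` with `|K| = 6|S|` would be
all graphs; but they make up less than a fraction `∑ 4^(-s) < 1`. -/
theorem exists_expander {T : ℕ} (hq : 0 < q) (hm : m ≤ 32 * q) (hT : T * 2 ^ 18 ≤ q) :
    ∃ f : Fin m → Fin 8 → Fin q, ∀ S : Finset (Fin m), S.Nonempty → S.card ≤ T →
      6 * S.card < (nbrs f S).card := by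
  classical
  by_contra hcon
  push Not at hcon
  let U : Finset (Fin m → Fin 8 → Fin q) := (Finset.Icc 1 T).biUnion fun s =>
    (Finset.powersetCard s Finset.univ).biUnion fun S =>
      (Finset.powersetCard (6 * s) Finset.univ).biUnion fun K =>
        Finset.univ.filter fun f => nbrs f S ⊆ K
  have hU : (Finset.univ : Finset (Fin m → Fin 8 → Fin q)) ⊆ U := by
    intro f _
    obtain ⟨S, hS, hST, hbad⟩ := hcon f
    have hpos := Finset.card_pos.2 hS
    -- The small neighbourhood is padded to exactly `6|S|` checks; there is room because `|S| ≤ T ≤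
    -- q`.
    obtain ⟨K, hK, hKc⟩ := Finset.exists_superset_card_eq hbad (by
      rw [Fintype.card_prod, Fintype.card_fin, Fintype.card_fin]
      omega)
    simp only [U, Finset.mem_biUnion, Finset.mem_Icc, Finset.mem_powersetCard, Finset.mem_filter,
      Finset.mem_univ, true_and, Finset.subset_univ]
    exact ⟨S.card, ⟨hpos, hST⟩, S, rfl, K, hKc, hK⟩
  have hcard : ((Finset.univ : Finset (Fin m → Fin 8 → Fin q)).card : ℝ) = ((q : ℝ) ^ 8) ^ m := by
    simp
  have hUle : (U.card : ℝ) ≤ ∑ s ∈ Finset.Icc 1 T, (1 / 4) ^ s * ((q : ℝ) ^ 8) ^ m := by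
    refine (Nat.cast_le.2 Finset.card_biUnion_le).trans ?_
    rw [Nat.cast_sum]
    refine Finset.sum_le_sum fun s hs => ?_
    rw [Finset.mem_Icc] at hs
    have hinner : ∀ S ∈ Finset.powersetCard s (Finset.univ : Finset (Fin m)),
        ((((Finset.powersetCard (6 * s) Finset.univ).biUnion fun K =>
          Finset.univ.filter fun f : Fin m → Fin 8 → Fin q => nbrs f S ⊆ K).card : ℕ) : ℝ) ≤
        ((8 * q).choose (6 * s) : ℝ) *
          (((((6 * s : ℕ) : ℝ) / 8) ^ 8) ^ s * ((q : ℝ) ^ 8) ^ (m - s)) := by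
      intro S hS
      rw [Finset.mem_powersetCard] at hS
      refine (Nat.cast_le.2 Finset.card_biUnion_le).trans ?_
      rw [Nat.cast_sum]
      refine (Finset.sum_le_card_nsmul _ _
        (((((6 * s : ℕ) : ℝ) / 8) ^ 8) ^ s * ((q : ℝ) ^ 8) ^ (m - s)) fun K hK => ?_).trans
        (le_of_eq ?_)
      · rw [Finset.mem_powersetCard] at hK
        have := card_graphs_into S K
        rwa [hS.2, hK.2] at this
      · rw [Finset.card_powersetCard, nsmul_eq_mul]
        simp
    refine (Nat.cast_le.2 Finset.card_biUnion_le).trans ?_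
    rw [Nat.cast_sum]
    refine (Finset.sum_le_card_nsmul _ _ _ hinner).trans ?_
    rw [Finset.card_powersetCard, nsmul_eq_mul, Finset.card_univ, Fintype.card_fin]
    by_cases hsm : s ≤ m
    · exact expander_term_le (by omega) hsm hm
        ((Nat.mul_le_mul_right _ hs.2).trans hT)
    · rw [Nat.choose_eq_zero_of_lt (by omega), Nat.cast_zero, zero_mul]
      positivity
  rw [← Finset.sum_mul] at hUle
  have hle : ((q : ℝ) ^ 8) ^ m ≤ U.card := by
    rw [← hcard]
    exact_mod_cast Finset.card_le_card hU
  have hqpos : (0 : ℝ) < ((q : ℝ) ^ 8) ^ m := by positivity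
  nlinarith [sum_quarter_pow T]

end Expander

/-! ### Sequential bit flipping -/

section BitFlip

variable {m q : ℕ}

/-- The support of a binary vector. -/
def supp {κ : Type} [Fintype κ] (y : κ → ZMod 2) : Finset κ := Finset.univ.filter fun i => y i ≠ 0

theorem mem_supp {κ : Type} [Fintype κ] {y : κ → ZMod 2} {i : κ} : i ∈ supp y ↔ y i ≠ 0 := by
  simp [supp]

theorem card_supp {κ : Type} [Fintype κ] (y : κ → ZMod 2) : (supp y).card = weight y := rfl

theorem supp_nonempty {κ : Type} [Fintype κ] {y : κ → ZMod 2} (hy : y ≠ 0) :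
    (supp y).Nonempty := by
  obtain ⟨i, hi⟩ := Function.ne_iff.1 hy
  exact ⟨i, mem_supp.2 hi⟩

/-- The checks of a variable, as a bit vector. -/
def checkCol (f : Fin m → Fin 8 → Fin q) (w : Fin m) : Fin 8 × Fin q → ZMod 2 :=
  fun c => if f w c.1 = c.2 then 1 else 0

/-- The syndrome of an error vector. -/
def synd (f : Fin m → Fin 8 → Fin q) (y : Fin m → ZMod 2) : Fin 8 × Fin q → ZMod 2 :=
  fun c => ∑ v, if f v c.1 = c.2 then y v else 0

/-- The number of unsatisfied checks of a variable. -/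
def unsat (f : Fin m → Fin 8 → Fin q) (s : Fin 8 × Fin q → ZMod 2) (v : Fin m) : ℕ :=
  (Finset.univ.filter fun j => s (j, f v j) ≠ 0).card

/-- Flip a variable most of whose checks are unsatisfied, if there is one. -/
def FlipStep (f : Fin m → Fin 8 → Fin q) (a b : (Fin 8 × Fin q → ZMod 2) × (Fin m → ZMod 2)) :
    Prop :=
  (∃ w, 4 < unsat f a.1 w ∧ b.1 = a.1 + checkCol f w ∧ b.2 = a.2 + Pi.single w 1) ∨
    ((∀ w, ¬ 4 < unsat f a.1 w) ∧ b = a)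

/-- The number of variables of `S` that are joined to the check `c`. -/
def degIn (f : Fin m → Fin 8 → Fin q) (S : Finset (Fin m)) (c : Fin 8 × Fin q) : ℕ :=
  (S.filter fun v => f v c.1 = c.2).card

theorem synd_eq_degIn (f : Fin m → Fin 8 → Fin q) (y : Fin m → ZMod 2) (c : Fin 8 × Fin q) :
    synd f y c = (degIn f (supp y) c : ZMod 2) := by
  have h : ∀ v, y v = if y v ≠ 0 then 1 else 0 := fun v => by
    rcases zmod_two_cases (y v) with h | h <;> simp [h]
  rw [degIn, Finset.card_filter, supp, Finset.sum_filter, Nat.cast_sum, synd]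
  refine Finset.sum_congr rfl fun v _ => ?_
  rw [h v]
  by_cases h1 : y v = 0 <;> by_cases h2 : f v c.1 = c.2 <;> simp [h1, h2]

theorem one_le_degIn {f : Fin m → Fin 8 → Fin q} {y : Fin m → ZMod 2} {c : Fin 8 × Fin q}
    (h : synd f y c ≠ 0) : 1 ≤ degIn f (supp y) c := by
  by_contra h0
  rw [synd_eq_degIn, show degIn f (supp y) c = 0 by omega] at h
  exact h Nat.cast_zero

theorem sum_degIn (f : Fin m → Fin 8 → Fin q) (S : Finset (Fin m)) :
    ∑ c, degIn f S c = 8 * S.card := by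
  simp only [degIn, Finset.card_filter, Fintype.sum_prod_type]
  have : ∀ j : Fin 8, ∑ t : Fin q, ∑ v ∈ S, (if f v j = t then 1 else 0) = S.card := fun j => by
    rw [Finset.sum_comm]
    simp
  simp only [this]
  simp

/-- A neighbour of the support has either at least two edges into it or an odd number of them, in
which case it is unsatisfied. So twice the number of neighbours is at most edges plus unsatisfied
checks; with more than `6|S|` neighbours and `8|S|` edges, more than `4|S|` checks are unsatisfied.
-/
theorem four_mul_weight_lt {f : Fin m → Fin 8 → Fin q} {T : ℕ}
    (hf : ∀ S : Finset (Fin m), S.Nonempty → S.card ≤ T → 6 * S.card < (nbrs f S).card)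
    {y : Fin m → ZMod 2} (hy : y ≠ 0) (hT : weight y ≤ T) :
    4 * weight y < weight (synd f y) := by
  have h1 := hf (supp y) (supp_nonempty hy) hT
  have h2 : 2 * (nbrs f (supp y)).card ≤ ∑ c, degIn f (supp y) c + weight (synd f y) := by
    calc 2 * (nbrs f (supp y)).card = ∑ c ∈ nbrs f (supp y), 2 := by simp [mul_comm]
      _ ≤ ∑ c ∈ nbrs f (supp y), (degIn f (supp y) c + if synd f y c ≠ 0 then 1 else 0) := by
        refine Finset.sum_le_sum fun c hc => ?_
        obtain ⟨v, hv, hvc⟩ := mem_nbrs.1 hc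
        have h0 : 0 < degIn f (supp y) c := Finset.card_pos.2 ⟨v, by simp [hv, hvc]⟩
        split_ifs with hs
        · omega
        · have h1 : degIn f (supp y) c ≠ 1 := fun h1 => by
            rw [synd_eq_degIn, h1] at hs
            exact hs (by decide)
          omega
      _ ≤ ∑ c, (degIn f (supp y) c + if synd f y c ≠ 0 then 1 else 0) :=
        Finset.sum_le_sum_of_subset (Finset.subset_univ _)
      _ = _ := by
        rw [Finset.sum_add_distrib, weight, Finset.card_filter]
  rw [sum_degIn, card_supp] at h2
  rw [card_supp] at h1
  omega

/-- Every unsatisfied check touches the support, so the wrong variables have more than four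
unsatisfied checks on average. -/
theorem exists_unsat {f : Fin m → Fin 8 → Fin q} {T : ℕ}
    (hf : ∀ S : Finset (Fin m), S.Nonempty → S.card ≤ T → 6 * S.card < (nbrs f S).card)
    {y : Fin m → ZMod 2} (hy : y ≠ 0) (hT : weight y ≤ T) :
    ∃ w, 4 < unsat f (synd f y) w := by
  by_contra hcon
  push Not at hcon
  have h1 := four_mul_weight_lt hf hy hT
  have h2 : ∑ v ∈ supp y, unsat f (synd f y) v =
      ∑ c, if synd f y c ≠ 0 then degIn f (supp y) c else 0 := by
    have hL : ∀ v, unsat f (synd f y) v =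
        ∑ c : Fin 8 × Fin q, if f v c.1 = c.2 ∧ synd f y c ≠ 0 then 1 else 0 := fun v => by
      rw [unsat, Finset.card_filter, Fintype.sum_prod_type]
      refine Finset.sum_congr rfl fun j _ => ?_
      simp only [ite_and]
      rw [Finset.sum_ite_eq]
      simp
    simp only [hL]
    rw [Finset.sum_comm]
    refine Finset.sum_congr rfl fun c _ => ?_
    split_ifs with hs
    · simp [hs, degIn]
    · simp [hs]
  have h3 : weight (synd f y) ≤ ∑ v ∈ supp y, unsat f (synd f y) v := by
    rw [h2, weight, Finset.card_filter]
    refine Finset.sum_le_sum fun c _ => ?_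
    split_ifs with hs
    · exact one_le_degIn hs
    · exact le_rfl
  have h4 := Finset.sum_le_card_nsmul (supp y) (fun v => unsat f (synd f y) v) 4 fun v _ => hcon v
  rw [card_supp, smul_eq_mul] at h4
  omega

/-- A flip exchanges satisfied and unsatisfied among the eight distinct checks of `w`. With more
than four unsatisfied, the syndrome weight drops. -/
theorem weight_add_checkCol_le (f : Fin m → Fin 8 → Fin q) (s : Fin 8 × Fin q → ZMod 2)
    (w : Fin m) : weight (s + checkCol f w) + 2 * unsat f s w ≤ weight s + 8 := by
  classical
  let A : Finset (Fin 8 × Fin q) :=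
    (Finset.univ.filter fun j => s (j, f w j) ≠ 0).image fun j => (j, f w j)
  let B : Finset (Fin 8 × Fin q) :=
    (Finset.univ.filter fun j => ¬ s (j, f w j) ≠ 0).image fun j => (j, f w j)
  have hA : A.card = unsat f s w :=
    Finset.card_image_of_injective _ fun i j h => (Prod.ext_iff.1 h).1
  have hB : B.card + unsat f s w ≤ 8 := by
    have h1 : B.card ≤ _ := Finset.card_image_le
    have h2 := Finset.card_filter_add_card_filter_not (s := (Finset.univ : Finset (Fin 8)))
      fun j => s (j, f w j) ≠ 0
    rw [Finset.card_univ, Fintype.card_fin] at h2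
    have h3 : unsat f s w = _ := rfl
    unfold unsat at h3 ⊢
    omega
  have hsub : supp (s + checkCol f w) ⊆ (supp s \ A) ∪ B := by
    rintro ⟨j, t⟩ hc
    rw [mem_supp, Pi.add_apply, checkCol] at hc
    rw [Finset.mem_union, Finset.mem_sdiff, mem_supp]
    by_cases h : f w j = t
    · subst h
      right
      refine Finset.mem_image.2 ⟨j, ?_, rfl⟩
      simp only [Finset.mem_filter, Finset.mem_univ, true_and, not_not]
      rcases zmod_two_cases (s (j, f w j)) with h0 | h0
      · exact h0
      · simp [h0, CharTwo.add_self_eq_zero] at hc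
    · left
      refine ⟨by simpa [h] using hc, fun hA => ?_⟩
      obtain ⟨j', -, hj⟩ := Finset.mem_image.1 hA
      obtain ⟨rfl, rfl⟩ := Prod.ext_iff.1 hj
      exact h rfl
  have hAs : A ⊆ supp s := by
    intro c hc
    obtain ⟨j, hj, rfl⟩ := Finset.mem_image.1 hc
    exact mem_supp.2 (Finset.mem_filter.1 hj).2
  have h1 := (Finset.card_le_card hsub).trans (Finset.card_union_le _ _)
  rw [Finset.card_sdiff_of_subset hAs] at h1
  have h2 := Finset.card_le_card hAs
  rw [card_supp] at h1 h2
  rw [card_supp] at h1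
  omega

theorem weight_synd_le (f : Fin m → Fin 8 → Fin q) (y : Fin m → ZMod 2) :
    weight (synd f y) ≤ 8 * weight y := by
  rw [← card_supp y, ← sum_degIn f, weight, Finset.card_filter]
  refine Finset.sum_le_sum fun c _ => ?_
  split_ifs with h
  · exact one_le_degIn h
  · exact Nat.zero_le _

theorem synd_add_single (f : Fin m → Fin 8 → Fin q) (y : Fin m → ZMod 2) (w : Fin m) :
    synd f (y + Pi.single w 1) = synd f y + checkCol f w := by
  funext c
  simp only [synd, Pi.add_apply, checkCol]
  have : ∀ v, (if f v c.1 = c.2 then y v + (Pi.single w 1 : Fin m → ZMod 2) v else 0) =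
      (if f v c.1 = c.2 then y v else 0) +
        if v = w then (if f w c.1 = c.2 then 1 else 0) else 0 := fun v => by
    by_cases h : v = w
    · subst h
      by_cases h2 : f v c.1 = c.2 <;> simp [h2]
    · simp [h]
  simp only [this, Finset.sum_add_distrib, Finset.sum_ite_eq', Finset.mem_univ, if_true]

theorem weight_add_single_le (y : Fin m → ZMod 2) (w : Fin m) :
    weight (y + Pi.single w 1) ≤ weight y + 1 := by
  classical
  refine (Finset.card_le_card (t := insert w (supp y)) fun v hv => ?_).trans
    (Finset.card_insert_le _ _)
  rw [Finset.mem_insert, mem_supp]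
  by_cases h : v = w
  · exact Or.inl h
  · right
    simpa [h] using hv

theorem weight_eq_zero {κ : Type} [Fintype κ] {y : κ → ZMod 2} (h : weight y = 0) : y = 0 := by
  by_contra h0
  exact (Finset.card_pos.2 (supp_nonempty h0)).ne' h

theorem weight_zero {κ : Type} [Fintype κ] : weight (0 : κ → ZMod 2) = 0 := by
  simp [weight]

theorem synd_zero (f : Fin m → Fin 8 → Fin q) : synd f 0 = 0 :=
  weight_eq_zero (Nat.le_zero.1 ((weight_synd_le f 0).trans (by rw [weight_zero])))

/-- Bit flipping corrects up to `T / 2` errors in at most `8 q` steps. -/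
theorem flipSteps_correct {f : Fin m → Fin 8 → Fin q} {T : ℕ}
    (hf : ∀ S : Finset (Fin m), S.Nonempty → S.card ≤ T → 6 * S.card < (nbrs f S).card)
    {e : Fin m → ZMod 2} (he : 2 * weight e ≤ T)
    {st : ℕ → (Fin 8 × Fin q → ZMod 2) × (Fin m → ZMod 2)} (h0 : st 0 = (synd f e, 0))
    (hst : ∀ i < 8 * q, FlipStep f (st i) (st (i + 1))) : (st (8 * q)).2 = e := by
  -- The residual error never leaves the expanding range: four times its weight is less than the
  -- syndrome weight, which never exceeds `8 * weight e`. So before each flip it is below `2 *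
  -- weight e`, and after it at most `T`. Until the residual vanishes, each step lowers the syndrome
  -- weight.
  have key : ∀ i ≤ 8 * q, (st i).1 = synd f (e + (st i).2) ∧ weight (e + (st i).2) ≤ T ∧
      weight (st i).1 ≤ 8 * weight e ∧
      (e + (st i).2 = 0 ∨ weight (st i).1 + i ≤ weight (synd f e)) := by
    intro i
    induction i with
    | zero =>
      intro _
      rw [h0]
      simp only [add_zero, true_and, le_refl, or_true, and_true]
      exact ⟨by omega, weight_synd_le f e⟩
    | succ i ih =>
      intro hi
      obtain ⟨h1, h2, h3, h4⟩ := ih (by omega)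
      by_cases hz : e + (st i).2 = 0
      -- Once the residual is zero the syndrome is zero, no variable qualifies, and the state stays
      -- put.
      · rcases hst i (by omega) with ⟨w, hw, -, -⟩ | ⟨-, heq⟩
        · rw [h1, hz, synd_zero] at hw
          simp [unsat] at hw
        · rw [heq]
          exact ⟨h1, h2, h3, Or.inl hz⟩
      · have h5 := four_mul_weight_lt hf hz h2
        rw [← h1] at h5
        rcases hst i (by omega) with ⟨w, hw, e1, e2⟩ | ⟨hno, -⟩
        · have h6 := weight_add_checkCol_le f (st i).1 w
          have h7 := weight_add_single_le (e + (st i).2) w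
          rw [e1, e2, ← add_assoc]
          refine ⟨?_, by omega, by omega, Or.inr ?_⟩
          · rw [synd_add_single, ← h1]
          · have := h4.resolve_left hz
            omega
        · obtain ⟨w, hw⟩ := exists_unsat hf hz h2
          rw [← h1] at hw
          exact absurd hw (hno w)
  obtain ⟨h1, h2, -, h4⟩ := key _ le_rfl
  have hz : e + (st (8 * q)).2 = 0 := by
    by_contra hz
    have h5 := four_mul_weight_lt hf hz h2
    rw [← h1] at h5
    have h6 := h4.resolve_left hz
    have h7 : weight (synd f e) ≤ 8 * q := (Finset.card_le_univ _).trans (by simp)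
    omega
  have h8 := congrArg (e + ·) hz
  simp only [← add_assoc, bits_add_self, zero_add, add_zero] at h8
  exact h8

end BitFlip

/-! ### Programs built from expressions -/

/-- Arithmetic expressions in the registers and the memory. -/
inductive Arith : Type
  | lit (c : ℕ) : Arith
  | pid : Arith
  | var (d : ℕ) : Arith
  | add (a b : Arith) : Arith
  | sub (a b : Arith) : Arith
  | mul (a b : Arith) : Arith
  | load (a : Arith) : Arith

namespace Arith

/-- The value of an expression for processor `p`, without reduction to a word. -/
def eval (p : ℕ) (R M : ℕ → ℕ) : Arith → ℕ
  | lit c => c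
  | pid => p
  | var d => R d
  | add a b => a.eval p R M + b.eval p R M
  | sub a b => a.eval p R M - b.eval p R M
  | mul a b => a.eval p R M * b.eval p R M
  | load a => M (a.eval p R M)

/-- No overflow occurs in the evaluation of an expression. -/
def Fits (W p : ℕ) (R M : ℕ → ℕ) : Arith → Prop
  | lit c => c < W
  | pid => p < W
  | var d => R d < W
  | add a b => a.Fits W p R M ∧ b.Fits W p R M ∧ a.eval p R M + b.eval p R M < W
  | sub a b => a.Fits W p R M ∧ b.Fits W p R M
  | mul a b => a.Fits W p R M ∧ b.Fits W p R M ∧ a.eval p R M * b.eval p R M < W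
  | load a => a.Fits W p R M ∧ M (a.eval p R M) < W

/-- All registers of the expression have a number less than `n`. -/
def Below (n : ℕ) : Arith → Prop
  | lit _ => True
  | pid => True
  | var d => d < n
  | add a b => a.Below n ∧ b.Below n
  | sub a b => a.Below n ∧ b.Below n
  | mul a b => a.Below n ∧ b.Below n
  | load a => a.Below n

/-- Evaluate an expression into register `k`, using only registers from `k` on. -/
def compile : Arith → ℕ → Prog
  | lit c, k => .const k c
  | pid, k => .procId k
  -- There is no copy instruction; a register is copied by adding zero.
  | var d, k => .seq (.const (k + 1) 0) (.add k d (k + 1))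
  | add a b, k => .seq (a.compile k) (.seq (b.compile (k + 1)) (.add k k (k + 1)))
  | sub a b, k => .seq (a.compile k) (.seq (b.compile (k + 1)) (.sub k k (k + 1)))
  | mul a b, k => .seq (a.compile k) (.seq (b.compile (k + 1)) (.mul k k (k + 1)))
  | load a, k => .seq (a.compile k) (.load k k)

/-- The number of steps of the evaluation. -/
def cost : Arith → ℕ
  | lit _ => 1
  | pid => 1
  | var _ => 2
  | add a b => a.cost + (b.cost + 1)
  | sub a b => a.cost + (b.cost + 1)
  | mul a b => a.cost + (b.cost + 1)
  | load a => a.cost + 1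

theorem Fits.eval_lt {W p : ℕ} {R M : ℕ → ℕ} {e : Arith} (h : e.Fits W p R M) :
    e.eval p R M < W := by
  induction e with
  | lit c => exact h
  | pid => exact h
  | var d => exact h
  | add a b _ _ => exact h.2.2
  | sub a b iha _ => exact (Nat.sub_le _ _).trans_lt (iha h.1)
  | mul a b _ _ => exact h.2.2
  | load a _ => exact h.2

theorem eval_congr {p n : ℕ} {R R' M : ℕ → ℕ} (hR : ∀ d < n, R' d = R d) {e : Arith}
    (he : e.Below n) : e.eval p R' M = e.eval p R M := by
  induction e with
  | lit c => rfl
  | pid => rfl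
  | var d => exact hR d he
  | add a b iha ihb => simp only [eval, iha he.1, ihb he.2]
  | sub a b iha ihb => simp only [eval, iha he.1, ihb he.2]
  | mul a b iha ihb => simp only [eval, iha he.1, ihb he.2]
  | load a iha => simp only [eval, iha he]

theorem Fits.congr {W p n : ℕ} {R R' M : ℕ → ℕ} (hR : ∀ d < n, R' d = R d) {e : Arith}
    (he : e.Below n) (h : e.Fits W p R M) : e.Fits W p R' M := by
  induction e with
  | lit c => exact h
  | pid => exact h
  | var d => simpa only [Fits, hR d he] using h
  | add a b iha ihb =>
    refine ⟨iha he.1 h.1, ihb he.2 h.2.1, ?_⟩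
    rw [eval_congr hR he.1, eval_congr hR he.2]
    exact h.2.2
  | sub a b iha ihb => exact ⟨iha he.1 h.1, ihb he.2 h.2⟩
  | mul a b iha ihb =>
    refine ⟨iha he.1 h.1, ihb he.2 h.2.1, ?_⟩
    rw [eval_congr hR he.1, eval_congr hR he.2]
    exact h.2.2
  | load a iha => exact ⟨iha he h.1, by rw [eval_congr (e := a) hR he]; exact h.2⟩

theorem Below.mono {n n' : ℕ} (hn : n ≤ n') {e : Arith} (he : e.Below n) : e.Below n' := by
  induction e with
  | lit c => trivial
  | pid => trivial
  | var d => exact lt_of_lt_of_le he hn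
  | add a b iha ihb => exact ⟨iha he.1, ihb he.2⟩
  | sub a b iha ihb => exact ⟨iha he.1, ihb he.2⟩
  | mul a b iha ihb => exact ⟨iha he.1, ihb he.2⟩
  | load a iha => exact iha he

end Arith

theorem Config.setReg_reg {W P d : ℕ} {s : Config} {f : ℕ → ℕ} {p : ℕ} (hp : p < P) (x : ℕ) :
    (s.setReg W P d f).reg p x = if x = d then f p % W else s.reg p x := by
  simp only [Config.setReg, hp, if_true, Function.update_apply]

theorem Config.setReg_mem (W P d : ℕ) (s : Config) (f : ℕ → ℕ) :
    (s.setReg W P d f).mem = s.mem := rfl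

/-- The effect of the evaluation of an expression into register `k`. -/
structure Evaluates (W P : ℕ) (prog : Prog) (k : ℕ) (s : Config) (val : ℕ → ℕ) (t : ℕ) : Prop where
  mem : (prog.run W P s).1.mem = s.mem
  val : ∀ p < P, (prog.run W P s).1.reg p k = val p
  frame : ∀ p < P, ∀ d < k, (prog.run W P s).1.reg p d = s.reg p d
  time : (prog.run W P s).2 = t

theorem evaluates_binary {W P k : ℕ} {s : Config} {a b : Prog} {va vb vo : ℕ → ℕ} {ta tb : ℕ}
    {o : Prog} {op : ℕ → ℕ → ℕ} (ho : ∀ s, o.run W P s =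
      (s.setReg W P k fun p => op (s.reg p k) (s.reg p (k + 1)), 1))
    (ha : Evaluates W P a k s va ta)
    (hb : Evaluates W P b (k + 1) (a.run W P s).1 vb tb)
    (hv : ∀ p < P, op (va p) (vb p) = vo p) (hlt : ∀ p < P, vo p < W) :
    Evaluates W P (.seq a (.seq b o)) k s vo (ta + (tb + 1)) := by
  have e : (Prog.seq a (.seq b o)).run W P s =
      ((b.run W P (a.run W P s).1).1.setReg W P k fun p =>
        op ((b.run W P (a.run W P s).1).1.reg p k) ((b.run W P (a.run W P s).1).1.reg p (k + 1)),
        (a.run W P s).2 + ((b.run W P (a.run W P s).1).2 + 1)) := by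
    simp only [Prog.run, ho]
  constructor
  · rw [e, Config.setReg_mem, hb.mem, ha.mem]
  · intro p hp
    rw [e, Config.setReg_reg hp, if_pos rfl, hb.val p hp, hb.frame p hp k (by omega), ha.val p hp,
      hv p hp, Nat.mod_eq_of_lt (hlt p hp)]
  · intro p hp d hd
    rw [e, Config.setReg_reg hp, if_neg (by omega), hb.frame p hp d (by omega),
      ha.frame p hp d hd]
  · rw [e, ha.time, hb.time]

/-- The registers from `k` on act as a stack: the second operand is evaluated one level higher and
cannot destroy the first, and the registers named in the expression lie below. `Fits` makes all
reductions modulo `W` trivial. -/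
theorem evaluates_compile {W P : ℕ} (e : Arith) : ∀ (k : ℕ) (s : Config), e.Below k →
    (∀ p < P, e.Fits W p (s.reg p) s.mem) →
    Evaluates W P (e.compile k) k s (fun p => e.eval p (s.reg p) s.mem) e.cost := by
  have bin : ∀ (a b : Arith) (k : ℕ) (s : Config), a.Below k → b.Below k →
      (∀ p < P, a.Fits W p (s.reg p) s.mem) → (∀ p < P, b.Fits W p (s.reg p) s.mem) →
      (∀ (k : ℕ) (s : Config), a.Below k → (∀ p < P, a.Fits W p (s.reg p) s.mem) →
        Evaluates W P (a.compile k) k s (fun p => a.eval p (s.reg p) s.mem) a.cost) →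
      (∀ (k : ℕ) (s : Config), b.Below k → (∀ p < P, b.Fits W p (s.reg p) s.mem) →
        Evaluates W P (b.compile k) k s (fun p => b.eval p (s.reg p) s.mem) b.cost) →
      Evaluates W P (a.compile k) k s (fun p => a.eval p (s.reg p) s.mem) a.cost ∧
      Evaluates W P (b.compile (k + 1)) (k + 1) ((a.compile k).run W P s).1
        (fun p => b.eval p (((a.compile k).run W P s).1.reg p) s.mem) b.cost ∧
      ∀ p < P, b.eval p (((a.compile k).run W P s).1.reg p) s.mem =
        b.eval p (s.reg p) s.mem := by
    intro a b k s ha hb hfa hfb iha ihb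
    have h1 := iha k s ha hfa
    have h2 := ihb (k + 1) ((a.compile k).run W P s).1 (hb.mono (by omega)) fun p hp => by
      rw [h1.mem]
      exact (hfb p hp).congr (h1.frame p hp) hb
    rw [h1.mem] at h2
    exact ⟨h1, h2, fun p hp => Arith.eval_congr (h1.frame p hp) hb⟩
  induction e with
  | lit c =>
    intro k s _ hf
    refine ⟨rfl, fun p hp => ?_, fun p hp d hd => ?_, rfl⟩
    · exact (Config.setReg_reg hp _).trans ((if_pos rfl).trans (Nat.mod_eq_of_lt (hf p hp)))
    · exact (Config.setReg_reg hp _).trans (if_neg (by omega))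
  | pid =>
    intro k s _ hf
    refine ⟨rfl, fun p hp => ?_, fun p hp d hd => ?_, rfl⟩
    · exact (Config.setReg_reg hp _).trans ((if_pos rfl).trans (Nat.mod_eq_of_lt (hf p hp)))
    · exact (Config.setReg_reg hp _).trans (if_neg (by omega))
  | var d =>
    intro k s hd hf
    have hd : d < k := hd
    refine ⟨rfl, fun p hp => ?_, fun p hp d' hd' => ?_, rfl⟩
    · refine (Config.setReg_reg hp _).trans ((if_pos rfl).trans ?_)
      change ((Config.setReg W P s (k + 1) fun _ => 0).reg p d +
        (Config.setReg W P s (k + 1) fun _ => 0).reg p (k + 1)) % W = _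
      rw [Config.setReg_reg hp, Config.setReg_reg hp, if_neg (by omega), if_pos rfl,
        Nat.zero_mod, add_zero, Nat.mod_eq_of_lt (hf p hp)]
      rfl
    · refine (Config.setReg_reg hp _).trans ((if_neg (by omega)).trans ?_)
      exact (Config.setReg_reg hp _).trans (if_neg (by omega))
  | add a b iha ihb =>
    intro k s he hf
    obtain ⟨h1, h2, h3⟩ := bin a b k s he.1 he.2 (fun p hp => (hf p hp).1)
      (fun p hp => (hf p hp).2.1) iha ihb
    refine evaluates_binary (op := fun x y => x + y) (fun s => rfl) h1 h2 (fun p hp => ?_)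
      fun p hp => (hf p hp).eval_lt
    simp only [h3 p hp, Arith.eval]
  | sub a b iha ihb =>
    intro k s he hf
    obtain ⟨h1, h2, h3⟩ := bin a b k s he.1 he.2 (fun p hp => (hf p hp).1)
      (fun p hp => (hf p hp).2) iha ihb
    refine evaluates_binary (op := fun x y => x - y) (fun s => rfl) h1 h2 (fun p hp => ?_)
      fun p hp => (hf p hp).eval_lt
    simp only [h3 p hp, Arith.eval]
  | mul a b iha ihb =>
    intro k s he hf
    obtain ⟨h1, h2, h3⟩ := bin a b k s he.1 he.2 (fun p hp => (hf p hp).1)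
      (fun p hp => (hf p hp).2.1) iha ihb
    refine evaluates_binary (op := fun x y => x * y) (fun s => rfl) h1 h2 (fun p hp => ?_)
      fun p hp => (hf p hp).eval_lt
    simp only [h3 p hp, Arith.eval]
  | load a iha =>
    intro k s he hf
    have h1 := iha k s he fun p hp => (hf p hp).1
    refine ⟨h1.mem, fun p hp => ?_, fun p hp d hd => ?_, ?_⟩
    · refine (Config.setReg_reg hp _).trans ((if_pos rfl).trans ?_)
      rw [h1.mem, h1.val p hp]
      exact Nat.mod_eq_of_lt (hf p hp).2
    · exact (Config.setReg_reg hp _).trans ((if_neg (by omega)).trans (h1.frame p hp d hd))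
    · change _ + 1 = _
      rw [h1.time]
      rfl

/-- `R_d := e` for a register `d < 16`. -/
def assign (d : ℕ) (e : Arith) : Prog :=
  .seq (e.compile 16) (.seq (.const 17 0) (.add d 16 17))

/-- `memory[a] := b`. -/
def write (a b : Arith) : Prog :=
  .seq (a.compile 16) (.seq (b.compile 17) (.store 16 17))

/-- Simultaneous writing; the processor with the smallest number succeeds. -/
def parWrite (P : ℕ) (addr val : ℕ → ℕ) (M : ℕ → ℕ) : ℕ → ℕ := fun x =>
  match (List.range P).find? (fun p => addr p = x) with
  | some p => val p
  | none => M x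

theorem parWrite_cases (P : ℕ) (addr val M : ℕ → ℕ) (x : ℕ) :
    (∃ p < P, addr p = x ∧ parWrite P addr val M x = val p) ∨
      ((∀ p < P, addr p ≠ x) ∧ parWrite P addr val M x = M x) := by
  unfold parWrite
  cases h : (List.range P).find? (fun p => addr p = x) with
  | some p =>
    left
    have h1 := List.mem_of_find?_eq_some h
    have h2 := List.find?_some h
    exact ⟨p, List.mem_range.1 h1, by simpa using h2, rfl⟩
  | none =>
    right
    rw [List.find?_eq_none] at h
    exact ⟨fun p hp => by simpa using h p (List.mem_range.2 hp), rfl⟩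

theorem parWrite_congr {P : ℕ} {addr addr' val val' : ℕ → ℕ} (M : ℕ → ℕ)
    (ha : ∀ p < P, addr p = addr' p) (hv : ∀ p < P, val p = val' p) :
    parWrite P addr val M = parWrite P addr' val' M := by
  have h : ∀ x, (List.range P).find? (fun p => decide (addr p = x)) =
      (List.range P).find? (fun p => decide (addr' p = x)) := fun x =>
    List.find?_congr fun p hp => by rw [ha p (List.mem_range.1 hp)]
  funext x
  unfold parWrite
  rw [h x]
  cases h' : (List.range P).find? (fun p => decide (addr' p = x)) with
  | some p => exact hv p (List.mem_range.1 (List.mem_of_find?_eq_some h'))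
  | none => rfl

theorem parWrite_same {P : ℕ} (hP : 0 < P) {addr val M : ℕ → ℕ} {a b : ℕ}
    (ha : ∀ p < P, addr p = a) (hv : ∀ p < P, val p = b) :
    parWrite P addr val M = Function.update M a b := by
  funext x
  rw [Function.update_apply]
  rcases parWrite_cases P addr val M x with ⟨p, hp, h1, h2⟩ | ⟨h1, h2⟩
  · rw [h2, hv p hp, if_pos (by rw [← h1, ha p hp])]
  · rw [h2, if_neg fun h => h1 0 hP (by rw [ha 0 hP, h])]

open Classical in
/-- The memory `F` on the addresses in `D`, and `M` elsewhere. -/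
noncomputable def overlay (D : ℕ → Prop) (F M : ℕ → ℕ) : ℕ → ℕ := fun x => if D x then F x else M x

theorem overlay_pos {D : ℕ → Prop} {F M : ℕ → ℕ} {x : ℕ} (h : D x) : overlay D F M x = F x :=
  if_pos h

theorem overlay_neg {D : ℕ → Prop} {F M : ℕ → ℕ} {x : ℕ} (h : ¬ D x) : overlay D F M x = M x :=
  if_neg h

theorem overlay_false (F M : ℕ → ℕ) : overlay (fun _ => False) F M = M := funext fun _ => if_neg id

/-- If the value written is a function of the address, conflicts are harmless and the memory is
described by the set of addresses written so far. The same invariant then serves one processor and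
many. -/
theorem parWrite_overlay {P : ℕ} {addr val F M : ℕ → ℕ} {D D' : ℕ → Prop}
    (hv : ∀ p < P, val p = F (addr p)) (hD : ∀ x, D' x ↔ D x ∨ ∃ p < P, addr p = x) :
    parWrite P addr val (overlay D F M) = overlay D' F M := by
  funext x
  rcases parWrite_cases P addr val (overlay D F M) x with ⟨p, hp, h1, h2⟩ | ⟨h1, h2⟩
  · rw [h2, hv p hp, h1, overlay_pos ((hD x).2 (Or.inr ⟨p, hp, h1⟩))]
  · rw [h2]
    by_cases h : D x
    · rw [overlay_pos h, overlay_pos ((hD x).2 (Or.inl h))]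
    · rw [overlay_neg h, overlay_neg]
      rw [hD]
      rintro (h3 | ⟨p, hp, h3⟩)
      · exact h h3
      · exact h1 p hp h3

/-- The two configurations agree on the memory and on the registers below `16`. -/
def Sim (P : ℕ) (s σ : Config) : Prop :=
  s.mem = σ.mem ∧ ∀ p < P, ∀ d < 16, s.reg p d = σ.reg p d

/-- Started in the configuration `σ`, the program ends in a configuration and after a number of
steps with the property `Q`, up to the contents of registers from `16` on. -/
def wp (W P : ℕ) (prog : Prog) (σ : Config) (Q : Config → ℕ → Prop) : Prop :=
  ∀ s, Sim P s σ → ∃ σ', Sim P (prog.run W P s).1 σ' ∧ Q σ' (prog.run W P s).2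

/-- The configuration after an assignment. -/
def Config.assign (σ : Config) (d : ℕ) (e : Arith) : Config where
  reg := fun p => Function.update (σ.reg p) d (e.eval p (σ.reg p) σ.mem)
  mem := σ.mem

/-- The configuration after writing to the memory. -/
def Config.write (P : ℕ) (σ : Config) (a b : Arith) : Config where
  reg := σ.reg
  mem := parWrite P (fun p => a.eval p (σ.reg p) σ.mem) (fun p => b.eval p (σ.reg p) σ.mem) σ.mem

theorem Config.write_reg (P : ℕ) (σ : Config) (a b : Arith) : (σ.write P a b).reg = σ.reg := rfl

theorem Config.assign_reg (σ : Config) (d : ℕ) (e : Arith) (p x : ℕ) :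
    (σ.assign d e).reg p x = if x = d then e.eval p (σ.reg p) σ.mem else σ.reg p x :=
  Function.update_apply _ _ _ _

theorem Config.assign_mem (σ : Config) (d : ℕ) (e : Arith) : (σ.assign d e).mem = σ.mem := rfl

/-! ### Proof rules of the program logic -/

variable {W P : ℕ}

theorem wp_mono {prog : Prog} {σ : Config} {Q Q' : Config → ℕ → Prop}
    (h : wp W P prog σ Q) (hQ : ∀ σ' t, Q σ' t → Q' σ' t) : wp W P prog σ Q' := fun s hs =>
  let ⟨σ', h1, h2⟩ := h s hs
  ⟨σ', h1, hQ _ _ h2⟩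

theorem wp_seq {a b : Prog} {σ : Config} {Q : Config → ℕ → Prop}
    (h : wp W P a σ fun σ' t => wp W P b σ' fun σ'' t' => Q σ'' (t + t')) :
    wp W P (.seq a b) σ Q := fun s hs =>
  let ⟨_, h1, h2⟩ := h s hs
  h2 _ h1

theorem wp_assign {d : ℕ} {e : Arith} {σ : Config} {Q : Config → ℕ → Prop} (he : e.Below 16)
    (hf : ∀ p < P, e.Fits W p (σ.reg p) σ.mem)
    (hQ : Q (σ.assign d e) (e.cost + 2)) : wp W P (assign d e) σ Q := by
  intro s hs
  have h := evaluates_compile (W := W) (P := P) e 16 s he fun p hp => by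
    rw [hs.1]
    exact (hf p hp).congr (hs.2 p hp) he
  refine ⟨σ.assign d e, ⟨h.mem.trans hs.1, fun p hp x hx => ?_⟩, ?_⟩
  · refine (Config.setReg_reg hp x).trans ?_
    rw [Config.assign_reg]
    by_cases hxd : x = d
    · rw [if_pos hxd, if_pos hxd]
      change ((Config.setReg W P ((e.compile 16).run W P s).1 17 fun _ => 0).reg p 16 +
        (Config.setReg W P ((e.compile 16).run W P s).1 17 fun _ => 0).reg p 17) % W = _
      rw [Config.setReg_reg hp, Config.setReg_reg hp, if_neg (by omega), if_pos rfl,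
        Nat.zero_mod, add_zero, h.val p hp, hs.1, Arith.eval_congr (hs.2 p hp) he]
      exact Nat.mod_eq_of_lt (hf p hp).eval_lt
    · rw [if_neg hxd, if_neg hxd]
      refine (Config.setReg_reg hp x).trans ?_
      rw [if_neg (by omega), h.frame p hp x hx, hs.2 p hp x hx]
  · change Q _ (_ + 2)
    rw [h.time]
    exact hQ

theorem wp_write {a b : Arith} {σ : Config} {Q : Config → ℕ → Prop} (ha : a.Below 16)
    (hb : b.Below 16) (hfa : ∀ p < P, a.Fits W p (σ.reg p) σ.mem)
    (hfb : ∀ p < P, b.Fits W p (σ.reg p) σ.mem)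
    (hQ : Q (σ.write P a b) (a.cost + (b.cost + 1))) : wp W P (write a b) σ Q := by
  intro s hs
  have h := evaluates_compile (W := W) (P := P) a 16 s ha fun p hp => by
    rw [hs.1]
    exact (hfa p hp).congr (hs.2 p hp) ha
  have hreg : ∀ p < P, ∀ d < 16, ((a.compile 16).run W P s).1.reg p d = σ.reg p d :=
    fun p hp d hd => (h.frame p hp d hd).trans (hs.2 p hp d hd)
  have h' := evaluates_compile (W := W) (P := P) b 17 ((a.compile 16).run W P s).1
    (hb.mono (by omega)) fun p hp => by
      rw [h.mem, hs.1]
      exact (hfb p hp).congr (hreg p hp) hb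
  refine ⟨σ.write P a b, ⟨?_, fun p hp x hx => ?_⟩, ?_⟩
  · change parWrite P _ _ _ = parWrite P _ _ _
    rw [h'.mem, h.mem, hs.1]
    refine parWrite_congr _ (fun p hp => ?_) fun p hp => ?_
    · rw [h'.frame p hp 16 (by omega), h.val p hp, hs.1, Arith.eval_congr (hs.2 p hp) ha]
    · rw [h'.val p hp, h.mem, hs.1, Arith.eval_congr (hreg p hp) hb]
  · exact (h'.frame p hp x (by omega)).trans (hreg p hp x hx)
  · change Q _ (_ + (_ + 1))
    rw [h.time, h'.time]
    exact hQ

/-- The number of repetitions is fixed on entry, so an invariant indexed by the iteration and a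
uniform bound `T` on the body determine both the result and the time. -/
theorem wp_loop {a : ℕ} {body : Prog} {σ : Config} {Q : Config → ℕ → Prop} (n T : ℕ)
    (I : ℕ → Config → Prop) (hP : 0 < P) (ha : a < 16) (hn : σ.reg 0 a = n) (h0 : I 0 σ)
    (hI : ∀ i < n, ∀ σ', I i σ' → wp W P body σ' fun σ'' t => I (i + 1) σ'' ∧ t ≤ T)
    (hQ : ∀ σ' t, I n σ' → t ≤ 1 + n * (T + 1) → Q σ' t) : wp W P (.loop a body) σ Q := by
  intro s hs
  have key : ∀ i ≤ n, ∃ σ', Sim P ((fun q : Config × ℕ => ((body.run W P q.1).1,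
      q.2 + (body.run W P q.1).2 + 1))^[i] (s, 1)).1 σ' ∧ I i σ' ∧
      ((fun q : Config × ℕ => ((body.run W P q.1).1,
        q.2 + (body.run W P q.1).2 + 1))^[i] (s, 1)).2 ≤ 1 + i * (T + 1) := by
    intro i
    induction i with
    | zero => exact fun _ => ⟨σ, hs, h0, by simp⟩
    | succ i ih =>
      intro hi
      obtain ⟨σ', h1, h2, h3⟩ := ih (by omega)
      obtain ⟨σ'', h4, h5, h6⟩ := hI i (by omega) σ' h2 _ h1
      rw [Function.iterate_succ_apply']
      refine ⟨σ'', h4, h5, ?_⟩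
      rw [add_one_mul]
      change _ + _ + 1 ≤ _
      omega
  have hreg : s.reg 0 a = n := (hs.2 0 hP a ha).trans hn
  obtain ⟨σ', h1, h2, h3⟩ := key n le_rfl
  have e : (Prog.loop a body).run W P s = (fun q : Config × ℕ => ((body.run W P q.1).1,
      q.2 + (body.run W P q.1).2 + 1))^[n] (s, 1) := by
    rw [← hreg]
    rfl
  rw [e]
  exact ⟨σ', h1, hQ _ _ h2 h3⟩

/-! ### The decoder programs -/

instance : Add Arith := ⟨Arith.add⟩
instance : Sub Arith := ⟨Arith.sub⟩
instance : Mul Arith := ⟨Arith.mul⟩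

namespace Arith

variable {W p n : ℕ} {R M : ℕ → ℕ} (a b : Arith)

theorem eval_add : (a + b).eval p R M = a.eval p R M + b.eval p R M := rfl
theorem eval_sub : (a - b).eval p R M = a.eval p R M - b.eval p R M := rfl
theorem eval_mul : (a * b).eval p R M = a.eval p R M * b.eval p R M := rfl
theorem fits_add : (a + b).Fits W p R M ↔
    a.Fits W p R M ∧ b.Fits W p R M ∧ a.eval p R M + b.eval p R M < W := Iff.rfl
theorem fits_sub : (a - b).Fits W p R M ↔ a.Fits W p R M ∧ b.Fits W p R M := Iff.rfl
theorem fits_mul : (a * b).Fits W p R M ↔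
    a.Fits W p R M ∧ b.Fits W p R M ∧ a.eval p R M * b.eval p R M < W := Iff.rfl
theorem below_add : (a + b).Below n ↔ a.Below n ∧ b.Below n := Iff.rfl
theorem below_sub : (a - b).Below n ↔ a.Below n ∧ b.Below n := Iff.rfl
theorem below_mul : (a * b).Below n ↔ a.Below n ∧ b.Below n := Iff.rfl
theorem cost_add : (a + b).cost = a.cost + (b.cost + 1) := rfl
theorem cost_sub : (a - b).cost = a.cost + (b.cost + 1) := rfl
theorem cost_mul : (a * b).cost = a.cost + (b.cost + 1) := rfl

end Arith

attribute [simp] Arith.eval Arith.Fits Arith.Below Arith.cost Arith.eval_add Arith.eval_sub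
  Arith.eval_mul Arith.fits_add Arith.fits_sub Arith.fits_mul Arith.below_add Arith.below_sub
  Arith.below_mul Arith.cost_add Arith.cost_sub Arith.cost_mul Config.assign_reg Config.assign_mem
  Config.write_reg

open PCCSS.Arith (lit var pid)

/-- The address of the `X`-part of the syndrome. -/
def addrSX (m q : ℕ) : ℕ := 3 + 8 * q * m

/-- The address of the `Z`-part of the syndrome. -/
def addrSZ (m q : ℕ) : ℕ := addrSX m q + 8 * q

/-- The address of the `X`-part of the output. -/
def addrX (n₀ m q : ℕ) : ℕ := addrSZ m q + m * (n₀ - 1)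

/-- The address of the `Z`-part of the output. -/
def addrZ (n₀ m q : ℕ) : ℕ := addrX n₀ m q + m * n₀

/-- The address of the table of the checks of each variable. -/
def addrT (n₀ m q : ℕ) : ℕ := addrZ n₀ m q + m * n₀

/-- Load the parameters into the registers `0`, …, `3` (which are `n₀`, `m`, `r`, `r / 8`), and the
addresses into the registers `10`, …, `14`. Register `15` is the constant `8`. -/
def setup : Prog :=
  .seq (assign 0 (.load (lit 0))) <| .seq (assign 1 (.load (lit 1))) <|
  .seq (assign 2 (.load (lit 2))) <| .seq (assign 15 (lit 8)) <|
  .seq (assign 3 (lit 0)) <| .seq (assign 5 (lit 0)) <|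
  -- Division of `r` by 8 by counting the `i` with `8 * i < r`. As subtraction is truncated, `1 - (1
  -- - x)` is `min x 1`, the indicator of `x > 0`; this device recurs below.
  .seq (.loop 2 <|
    .seq (assign 3 (var 3 + (lit 1 - (lit 1 - (var 2 - var 15 * var 5)))))
      (assign 5 (var 5 + lit 1))) <|
  .seq (assign 12 (lit 3 + var 2 * var 1)) <| .seq (assign 13 (var 12 + var 2)) <|
  .seq (assign 10 (var 13 + var 1 * (var 0 - lit 1))) <|
  .seq (assign 14 (var 10 + var 1 * var 0)) (assign 11 (var 14 + var 1 * var 0))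

/-- Run `body` for all values less than `m` of register `4`, in parallel or one after another. -/
def forEach (par : Bool) (body : Prog) : Prog :=
  if par then .seq (assign 4 pid) body
  else .seq (assign 4 (lit 0)) (.loop 1 (.seq body (assign 4 (var 4 + lit 1))))

/-- Put the addresses of the checks of a variable into the table. -/
def tabulate : Prog :=
  .seq (assign 7 (lit 0)) <| .loop 15 <|
    .seq (assign 6 (lit 0)) <| .seq (assign 5 (lit 0)) <|
    -- Within block `j` the column of the variable has a single one, so summing `t` times the entry
    -- finds its row.
    .seq (.loop 3 <|
      .seq (assign 6 (var 6 + var 5 * .load (lit 3 + (var 7 * var 3 + var 5) * var 1 + var 4)))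
        (assign 5 (var 5 + lit 1))) <|
    .seq (write (var 11 + var 15 * var 4 + var 7) (var 12 + var 7 * var 3 + var 6))
      (assign 7 (var 7 + lit 1))

/-- Write the number of the variable to the cell `1` if most of its checks are unsatisfied, and to
the cell `2` otherwise. -/
def vote : Prog :=
  .seq (assign 6 (lit 0)) <| .seq (assign 7 (lit 0)) <|
  .seq (.loop 15 <|
    .seq (assign 6 (var 6 + .load (.load (var 11 + var 15 * var 4 + var 7))))
      (assign 7 (var 7 + lit 1))) <|
  -- There is no branching: the address is `1` if `2u > 8` for `u` unsatisfied checks, and the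
  -- scratch cell `2` otherwise.
  write (lit 2 - (lit 1 - (lit 1 - (var 6 + var 6 - var 15)))) (var 4)

/-- Flip the variable whose number is in the cell `1`. -/
def flip : Prog :=
  .seq (assign 9 (.load (lit 1))) <| .seq (assign 7 (lit 0)) <|
  .seq (.loop 15 <|
    .seq (write (.load (var 11 + var 15 * var 9 + var 7))
        (lit 1 - .load (.load (var 11 + var 15 * var 9 + var 7))))
      (assign 7 (var 7 + lit 1))) <|
  -- The output cell counts the flips; the output is read modulo 2.
  write (var 10 + var 9 * var 0) (.load (var 10 + var 9 * var 0) + lit 1)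

/-- One round of bit flipping. -/
def round (par : Bool) : Prog :=
  -- Cell `1` starts with the nonexistent variable `m`, which is then flipped harmlessly if nobody
  -- votes.
  .seq (write (lit 1) (var 1)) <| .seq (forEach par vote) flip

/-- Majority decoding of the `Z`-errors in one block. -/
def majority : Prog :=
  .seq (assign 6 (lit 0)) <| .seq (assign 5 (lit 0)) <| .seq (assign 8 (var 0 - lit 1)) <|
  .seq (.loop 8 <|
    .seq (assign 6 (var 6 + .load (var 13 + var 4 * var 8 + var 5)))
      (assign 5 (var 5 + lit 1))) <|
  .seq (assign 9 (lit 1 - (lit 1 - (var 6 + var 6 - var 0)))) <|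
  .seq (assign 5 (lit 0)) <|
  .seq (.loop 8 <|
    .seq (write (var 14 + var 4 * var 0 + var 5) (.load (var 13 + var 4 * var 8 + var 5) + var 9))
      (assign 5 (var 5 + lit 1))) <|
  write (var 14 + var 4 * var 0 + var 8) (var 9)

/-- The decoder, in its parallel and in its sequential version. -/
def decoder (par : Bool) : Prog :=
  .seq setup <| .seq (forEach par tabulate) <| .seq (.loop 2 (round par)) (forEach par majority)

/-! ### Verification of the decoder programs -/

/-- The registers contain the parameters. -/
structure Env (P n₀ m q : ℕ) (σ : Config) : Prop where
  hn : ∀ p < P, σ.reg p 0 = n₀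
  hm : ∀ p < P, σ.reg p 1 = m
  hr : ∀ p < P, σ.reg p 2 = 8 * q
  hq : ∀ p < P, σ.reg p 3 = q
  hX : ∀ p < P, σ.reg p 10 = addrX n₀ m q
  hT : ∀ p < P, σ.reg p 11 = addrT n₀ m q
  hSX : ∀ p < P, σ.reg p 12 = addrSX m q
  hSZ : ∀ p < P, σ.reg p 13 = addrSZ m q
  hZ : ∀ p < P, σ.reg p 14 = addrZ n₀ m q
  h8 : ∀ p < P, σ.reg p 15 = 8

/-- Words are large enough for all addresses. -/
def Roomy (W n₀ m q : ℕ) : Prop := 100 * (addrT n₀ m q + m + n₀ + q + 100) ≤ W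

section Verification

variable {W P n₀ m q : ℕ}

theorem Env.assign {σ : Config} (h : Env P n₀ m q σ) {d : ℕ} (h4 : 4 ≤ d) (h10 : d < 10)
    (e : Arith) : Env P n₀ m q (σ.assign d e) := by
  have key : ∀ p x, (x < 4 ∨ 10 ≤ x) → (σ.assign d e).reg p x = σ.reg p x := fun p x hx => by
    rw [Config.assign_reg, if_neg (by omega)]
  constructor <;> intro p hp <;> rw [key _ _ (by omega)]
  exacts [h.hn p hp, h.hm p hp, h.hr p hp, h.hq p hp, h.hX p hp, h.hT p hp, h.hSX p hp,
    h.hSZ p hp, h.hZ p hp, h.h8 p hp]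

theorem Env.write {σ : Config} (h : Env P n₀ m q σ) (a b : Arith) :
    Env P n₀ m q (σ.write P a b) :=
  ⟨h.hn, h.hm, h.hr, h.hq, h.hX, h.hT, h.hSX, h.hSZ, h.hZ, h.h8⟩

theorem wp_setup (hP : 0 < P) (hW : Roomy W n₀ m q) {σ : Config} (h0 : σ.mem 0 = n₀)
    (h1 : σ.mem 1 = m) (h2 : σ.mem 2 = 8 * q) :
    wp W P setup σ fun σ' t => Env P n₀ m q σ' ∧ σ'.mem = σ.mem ∧ t ≤ 100 + 8 * q * 30 := by
  simp only [Roomy, addrT, addrZ, addrX, addrSZ, addrSX] at hW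
  refine wp_seq (wp_assign (by simp) (fun p hp => by simp; omega) ?_)
  refine wp_seq (wp_assign (by simp) (fun p hp => by simp; omega) ?_)
  refine wp_seq (wp_assign (by simp) (fun p hp => by simp; omega) ?_)
  refine wp_seq (wp_assign (by simp) (fun p hp => by simp; omega) ?_)
  refine wp_seq (wp_assign (by simp) (fun p hp => by simp; omega) ?_)
  refine wp_seq (wp_assign (by simp) (fun p hp => by simp; omega) ?_)
  -- The counter in register `3` grows as long as `8 * i < 8 * q`, so it is `min i q`.
  refine wp_seq (wp_loop (8 * q) 29 (fun i σ' => σ'.mem = σ.mem ∧ ∀ p < P, σ'.reg p 0 = n₀ ∧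
    σ'.reg p 1 = m ∧ σ'.reg p 2 = 8 * q ∧ σ'.reg p 3 = min i q ∧ σ'.reg p 5 = i ∧
    σ'.reg p 15 = 8) hP (by norm_num) (by simpa using h2) (by simp [h0, h1, h2]) ?_ ?_)
  · rintro i hi σ' ⟨hm, hr⟩
    refine wp_seq (wp_assign (by simp) (fun p hp => ?_) (wp_assign (by simp) (fun p hp => ?_) ?_))
    · obtain ⟨a0, a1, a2, a3, a4, a5⟩ := hr p hp
      simp [a2, a3, a4, a5]
      omega
    · obtain ⟨a0, a1, a2, a3, a4, a5⟩ := hr p hp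
      simp [a4]
      omega
    · refine ⟨⟨hm, fun p hp => ?_⟩, by simp⟩
      obtain ⟨a0, a1, a2, a3, a4, a5⟩ := hr p hp
      simp [a0, a1, a2, a3, a4, a5]
      omega
  · rintro σ' t ⟨hm, hr⟩ ht
    have a0 := fun p hp => (hr p hp).1
    have a1 := fun p hp => (hr p hp).2.1
    have a2 := fun p hp => (hr p hp).2.2.1
    have a3 : ∀ p < P, σ'.reg p 3 = q := fun p hp => (hr p hp).2.2.2.1.trans (by omega)
    have a15 := fun p hp => (hr p hp).2.2.2.2.2
    refine wp_seq (wp_assign (by simp) (fun p hp => ?_) ?_)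
    · simp [a1 p hp, a2 p hp]
      omega
    refine wp_seq (wp_assign (by simp) (fun p hp => ?_) ?_)
    · simp [a1 p hp, a2 p hp]
      omega
    refine wp_seq (wp_assign (by simp) (fun p hp => ?_) ?_)
    · simp [a0 p hp, a1 p hp, a2 p hp]
      omega
    refine wp_seq (wp_assign (by simp) (fun p hp => ?_) ?_)
    · simp [a0 p hp, a1 p hp, a2 p hp]
      omega
    refine wp_assign (by simp) (fun p hp => ?_) ?_
    · simp [a0 p hp, a1 p hp, a2 p hp]
      omega
    refine ⟨?_, hm, by simp; omega⟩
    constructor <;> intro p hp <;>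
      simp [addrT, addrZ, addrX, addrSZ, addrSX, a0 p hp, a1 p hp, a2 p hp, a3 p hp, a15 p hp]

/-- The number of processors. -/
def processors (par : Bool) (m : ℕ) : ℕ := if par then m else 1

/-- The number of items that each processor deals with. -/
def repetitions (par : Bool) (m : ℕ) : ℕ := if par then 1 else m

/-- The invariant refers to the set `K` of items already treated, and the body is verified for an
arbitrary assignment `v` of items to processors. The parallel version is one batch with `v p = p`,
the sequential one `m` batches of one item. -/
theorem wp_forEach {par : Bool} {body : Prog} (hW : Roomy W n₀ m q) (T : ℕ)
    (Inv : (ℕ → Prop) → (ℕ → ℕ) → Prop)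
    (hbody : ∀ (K : ℕ → Prop) (v : ℕ → ℕ) (σ : Config), Env (processors par m) n₀ m q σ →
      (∀ p < processors par m, σ.reg p 4 = v p ∧ v p < m) → Inv K σ.mem →
      wp W (processors par m) body σ fun σ' t => Env (processors par m) n₀ m q σ' ∧
        (∀ p < processors par m, σ'.reg p 4 = v p) ∧
        Inv (fun k => K k ∨ ∃ p < processors par m, v p = k) σ'.mem ∧ t ≤ T)
    {σ : Config} (hσ : Env (processors par m) n₀ m q σ) (hInv : Inv (fun _ => False) σ.mem) :
    wp W (processors par m) (forEach par body) σ fun σ' t =>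
      Env (processors par m) n₀ m q σ' ∧ Inv (fun k => k < m) σ'.mem ∧
        t ≤ 10 + repetitions par m * (T + 10) := by
  simp only [Roomy] at hW
  cases par with
  | true =>
    change wp W m (.seq _ _) σ _
    refine wp_seq (wp_assign (by simp) (fun p hp => ?_) ?_)
    · change p < m at hp
      simp
      omega
    refine wp_mono (hbody (fun _ => False) (fun p => p) _ (hσ.assign (by norm_num) (by norm_num) _)
      (fun p hp => ⟨by simp, hp⟩) hInv) ?_
    rintro σ' t ⟨h1, -, h3, h4⟩
    refine ⟨h1, ?_, ?_⟩
    · convert h3 using 1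
      funext k
      simp [processors]
    · simp [repetitions]
      omega
  | false =>
    change wp W 1 (.seq _ (.loop _ _)) σ _
    refine wp_seq (wp_assign (by simp) (fun p hp => by simp; omega) ?_)
    refine wp_loop m (T + 6) (fun i σ' => Env 1 n₀ m q σ' ∧ σ'.reg 0 4 = i ∧
      Inv (fun k => k < i) σ'.mem) (by norm_num) (by norm_num) ?_ ?_ ?_ ?_
    · simpa using hσ.hm 0 (by norm_num [processors])
    · refine ⟨hσ.assign (by norm_num) (by norm_num) _, by simp, ?_⟩
      simpa using hInv
    · rintro i hi σ' ⟨h1, h2, h3⟩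
      refine wp_seq (wp_mono (hbody (fun k => k < i) (fun _ => i) σ' h1 (fun p hp => ?_) h3) ?_)
      · have hp : p = 0 := by
          simp only [processors] at hp
          simpa using hp
        rw [hp]
        exact ⟨h2, hi⟩
      rintro σ'' t ⟨h4, h5, h6, h7⟩
      have h8 : σ''.reg 0 4 = i := h5 0 (by norm_num [processors])
      refine wp_assign (by simp) (fun p hp => ?_)
        ⟨⟨h4.assign (by norm_num) (by norm_num) _, ?_, ?_⟩, ?_⟩
      · have hp : p = 0 := by omega
        simp [hp, h8]
        omega
      · simp [h8]
      · rw [Config.assign_mem]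
        convert h6 using 1
        funext k
        simp [processors]
        omega
      · simp
        omega
    · rintro σ' t ⟨h1, -, h3⟩ h4
      refine ⟨h1, h3, ?_⟩
      simp only [repetitions, Bool.false_eq_true, if_false, Arith.cost]
      nlinarith

end Verification

/-! ### Tabulating the neighbours of each variable -/

section Table

variable {W P n₀ m q : ℕ}

/-- The entry for the `j`-th check of the variable `k` in the table. -/
def tableEntry (m q : ℕ) (f : ℕ → ℕ → ℕ) (k j : ℕ) : ℕ :=
  -- The fallback `0` is what the search for the one in the column leaves when it finds none, as for
  -- `q = 0`.
  addrSX m q + j * q + if f k j < q then f k j else 0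

/-- The table, as contents of the memory. -/
def tableMem (n₀ m q : ℕ) (f : ℕ → ℕ → ℕ) (x : ℕ) : ℕ :=
  tableEntry m q f ((x - addrT n₀ m q) / 8) ((x - addrT n₀ m q) % 8)

theorem tableMem_apply (f : ℕ → ℕ → ℕ) (k : ℕ) {j : ℕ} (hj : j < 8) :
    tableMem n₀ m q f (addrT n₀ m q + 8 * k + j) = tableEntry m q f k j := by
  rw [tableMem, show (addrT n₀ m q + 8 * k + j - addrT n₀ m q) / 8 = k by omega,
    show (addrT n₀ m q + 8 * k + j - addrT n₀ m q) % 8 = j by omega]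

theorem row_mul_lt {j t v : ℕ} (hj : j < 8) (ht : t < q) (hv : v < m) :
    (j * q + t) * m + v < 8 * q * m := by
  have h1 : j * q + t + 1 ≤ 8 * q := by nlinarith
  have h2 := Nat.mul_le_mul_right m h1
  rw [add_one_mul] at h2
  omega

theorem wp_tabulate (hP : 0 < P) (hW : Roomy W n₀ m q) {f : ℕ → ℕ → ℕ} {M : ℕ → ℕ}
    (hM : ∀ j < 8, ∀ t < q, ∀ v < m,
      M (3 + (j * q + t) * m + v) = if f v j = t then 1 else 0)
    (K : ℕ → Prop) (v : ℕ → ℕ) (σ : Config) (hσ : Env P n₀ m q σ)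
    (hv : ∀ p < P, σ.reg p 4 = v p ∧ v p < m)
    (hK : σ.mem = overlay (fun x => ∃ k, K k ∧ ∃ j < 8, x = addrT n₀ m q + 8 * k + j)
      (tableMem n₀ m q f) M) :
    wp W P tabulate σ fun σ' t => Env P n₀ m q σ' ∧ (∀ p < P, σ'.reg p 4 = v p) ∧
      σ'.mem = overlay (fun x => ∃ k, (K k ∨ ∃ p < P, v p = k) ∧
        ∃ j < 8, x = addrT n₀ m q + 8 * k + j) (tableMem n₀ m q f) M ∧
      t ≤ 8 * (q * 50 + 60) + 20 := by
  simp only [Roomy] at hW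
  have e1 : addrT n₀ m q = addrZ n₀ m q + m * n₀ := rfl
  have e2 : addrZ n₀ m q = addrX n₀ m q + m * n₀ := rfl
  have e3 : addrX n₀ m q = addrSZ m q + m * (n₀ - 1) := rfl
  have e4 : addrSZ m q = addrSX m q + 8 * q := rfl
  have e5 : addrSX m q = 3 + 8 * q * m := rfl
  refine wp_seq (wp_assign (by simp) (fun p hp => by simp; omega) ?_)
  refine wp_loop 8 (q * 50 + 58) (fun j σ' => Env P n₀ m q σ' ∧
    (∀ p < P, σ'.reg p 4 = v p ∧ σ'.reg p 7 = j) ∧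
    σ'.mem = overlay (fun x => (∃ k, K k ∧ ∃ j < 8, x = addrT n₀ m q + 8 * k + j) ∨
      ∃ p < P, ∃ i < j, x = addrT n₀ m q + 8 * v p + i) (tableMem n₀ m q f) M)
    hP (by norm_num) ?_ ?_ ?_ ?_
  · simpa using hσ.h8 0 hP
  · refine ⟨hσ.assign (by norm_num) (by norm_num) _, fun p hp => ?_, ?_⟩
    · simp [(hv p hp).1]
    · simpa using hK
  · rintro j hj σ' ⟨hσ', hr, hmem⟩
    refine wp_seq (wp_assign (by simp) (fun p hp => by simp; omega) ?_)
    refine wp_seq (wp_assign (by simp) (fun p hp => by simp; omega) ?_)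
    -- Register `6` is `0` until the row with the one has been passed, and the number of that row
    -- afterwards.
    refine wp_seq (wp_loop q 48 (fun t σ'' => Env P n₀ m q σ'' ∧
      (∀ p < P, σ''.reg p 4 = v p ∧ σ''.reg p 7 = j ∧ σ''.reg p 5 = t ∧
        σ''.reg p 6 = if f (v p) j < t then f (v p) j else 0) ∧ σ''.mem = σ'.mem)
      hP (by norm_num) ?_ ?_ ?_ ?_)
    · simpa using hσ'.hq 0 hP
    · refine ⟨(hσ'.assign (by norm_num) (by norm_num) _).assign (by norm_num) (by norm_num) _,
        fun p hp => ?_, rfl⟩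
      simp [hr p hp]
    · rintro t ht σ'' ⟨hσ'', hr', hmem'⟩
      have hload : ∀ p < P, σ''.mem (3 + (j * q + t) * m + v p) =
          if f (v p) j = t then 1 else 0 := fun p hp => by
        have h1 := row_mul_lt hj ht (hv p hp).2
        rw [hmem', hmem, overlay_neg, hM j hj t ht _ (hv p hp).2]
        rintro (⟨k, -, i, -, h⟩ | ⟨p', -, i, -, h⟩) <;> omega
      have hbd : ∀ p < P, j * q ≤ 8 * q ∧ (j * q + t) * m ≤ 8 * q * m ∧
          t * (if f (v p) j = t then 1 else 0) ≤ q ∧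
          (if f (v p) j < t then f (v p) j else 0) ≤ q := fun p hp => by
        have h1 := row_mul_lt hj ht (hv p hp).2
        refine ⟨Nat.mul_le_mul_right q hj.le, by omega, ?_, ?_⟩ <;> split_ifs <;> omega
      refine wp_seq (wp_assign (by simp) (fun p hp => ?_)
        (wp_assign (by simp) (fun p hp => ?_) ?_))
      · obtain ⟨a4, a7, a5, a6⟩ := hr' p hp
        obtain ⟨b1, b2, b3, b4⟩ := hbd p hp
        have hl := hload p hp
        have hl' : (if f (v p) j = t then 1 else 0) ≤ 1 := by split_ifs <;> omega
        have hvm := (hv p hp).2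
        simp only [Arith.Fits, Arith.eval,
          a4, a7, a5, a6, hσ''.hq p hp, hσ''.hm p hp, hl]
        omega
      · obtain ⟨a4, a7, a5, a6⟩ := hr' p hp
        simp [a5]
        omega
      · refine ⟨⟨(hσ''.assign (by norm_num) (by norm_num) _).assign (by norm_num) (by norm_num) _,
          fun p hp => ?_, hmem'⟩, by simp⟩
        obtain ⟨a4, a7, a5, a6⟩ := hr' p hp
        simp [a4, a5, a6, a7, hσ''.hq p hp, hσ''.hm p hp, hload p hp]
        split_ifs <;> omega
    · rintro σ'' t ⟨hσ'', hr', hmem'⟩ ht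
      have hb : ∀ p < P, j * q ≤ 8 * q ∧ (if f (v p) j < q then f (v p) j else 0) ≤ q :=
        fun p hp => ⟨Nat.mul_le_mul_right q hj.le, by split_ifs <;> omega⟩
      refine wp_seq (wp_write (by simp) (by simp) (fun p hp => ?_) (fun p hp => ?_)
        (wp_assign (by simp) (fun p hp => ?_) ?_))
      · obtain ⟨a4, a7, a5, a6⟩ := hr' p hp
        have hvm := (hv p hp).2
        simp [a4, a7, hσ''.hT p hp, hσ''.h8 p hp]
        omega
      · obtain ⟨a4, a7, a5, a6⟩ := hr' p hp
        obtain ⟨b1, b2⟩ := hb p hp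
        simp only [Arith.Fits, Arith.eval,
          a6, a7, hσ''.hSX p hp, hσ''.hq p hp]
        omega
      · obtain ⟨a4, a7, a5, a6⟩ := hr' p hp
        simp [a7]
        omega
      · refine ⟨⟨(hσ''.write _ _).assign (by norm_num) (by norm_num) _, fun p hp => ?_, ?_⟩, ?_⟩
        · obtain ⟨a4, a7, a5, a6⟩ := hr' p hp
          simp [a4, a7]
        · rw [Config.assign_mem]
          change parWrite P _ _ σ''.mem = _
          rw [hmem', hmem]
          have ha : ∀ p < P, Arith.eval p (σ''.reg p)
              (overlay (fun x => (∃ k, K k ∧ ∃ j < 8, x = addrT n₀ m q + 8 * k + j) ∨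
                ∃ p < P, ∃ i < j, x = addrT n₀ m q + 8 * v p + i) (tableMem n₀ m q f) M)
              (var 11 + var 15 * var 4 + var 7) = addrT n₀ m q + 8 * v p + j := fun p hp => by
            obtain ⟨a4, a7, a5, a6⟩ := hr' p hp
            simp [a4, a7, hσ''.hT p hp, hσ''.h8 p hp]
          refine parWrite_overlay (fun p hp => ?_) fun x => ?_
          · obtain ⟨a4, a7, a5, a6⟩ := hr' p hp
            rw [ha p hp, tableMem_apply f _ hj]
            simp [a6, a7, hσ''.hSX p hp, hσ''.hq p hp, tableEntry]
          · rw [or_assoc]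
            refine or_congr Iff.rfl ⟨?_, ?_⟩
            · rintro ⟨p, hp, i, hi, rfl⟩
              rcases Nat.lt_succ_iff_lt_or_eq.1 hi with h | rfl
              · exact Or.inl ⟨p, hp, i, h, rfl⟩
              · exact Or.inr ⟨p, hp, ha p hp⟩
            · rintro (⟨p, hp, i, hi, rfl⟩ | ⟨p, hp, rfl⟩)
              · exact ⟨p, hp, i, by omega, rfl⟩
              · exact ⟨p, hp, j, by omega, ha p hp⟩
        · simp
          omega
  · rintro σ' t ⟨hσ', hr, hmem⟩ ht
    refine ⟨hσ', fun p hp => (hr p hp).1, ?_, ?_⟩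
    · rw [hmem]
      congr 1
      funext x
      refine propext ⟨?_, ?_⟩
      · rintro (⟨k, hk, h⟩ | ⟨p, hp, i, hi, h⟩)
        · exact ⟨k, Or.inl hk, h⟩
        · exact ⟨v p, Or.inr ⟨p, hp, rfl⟩, i, hi, h⟩
      · rintro ⟨k, hk | ⟨p, hp, rfl⟩, h⟩
        · exact Or.inl ⟨k, hk, h⟩
        · exact Or.inr ⟨p, hp, h⟩
    · simp
      omega

end Table

/-! ### Voting and flipping in one round -/

section Rounds

variable {W P n₀ m q : ℕ}

/-- The memory after `i` rounds of bit flipping, when the syndrome and the estimate of the error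
are `st`. -/
structure RoundMem (n₀ : ℕ) {m q : ℕ} (f : Fin m → Fin 8 → Fin q) (M₀ : ℕ → ℕ) (i : ℕ)
    (st : (Fin 8 × Fin q → ZMod 2) × (Fin m → ZMod 2)) (M : ℕ → ℕ) : Prop where
  table : ∀ (k : Fin m) (j : Fin 8),
    M (addrT n₀ m q + 8 * k + j) = addrSX m q + j * q + f k j
  -- The row of the fictitious variable `m` in the table is blank, so that all its checks are cell
  -- `0`.
  sentinel : ∀ j : Fin 8, M (addrT n₀ m q + 8 * m + j) = 0
  synd : ∀ (j : Fin 8) (t : Fin q), M (addrSX m q + j * q + t) = (st.1 (j, t)).val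
  xbit : ∀ k : Fin m, (M (addrX n₀ m q + k * n₀) : ZMod 2) = st.2 k
  -- The case `k = m` is the counter of idle rounds. The bound keeps the flip counters from
  -- overflowing.
  xbound : ∀ k ≤ m, M (addrX n₀ m q + k * n₀) ≤ i
  rest : ∀ k < m, ∀ l, 0 < l → l < n₀ → M (addrX n₀ m q + k * n₀ + l) = 0
  zsynd : ∀ x, addrSZ m q ≤ x → x < addrX n₀ m q → M x = M₀ x
  -- Idle rounds overwrite cell `0`, whose content has already been read; only its size still
  -- matters.
  cell : M 0 ≤ n₀ + 1

theorem three_le_addrSX (m q : ℕ) : 3 ≤ addrSX m q := Nat.le_add_right _ _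

theorem addrSX_le_addrSZ (m q : ℕ) : addrSX m q ≤ addrSZ m q := Nat.le_add_right _ _

theorem addrSZ_le_addrX (n₀ m q : ℕ) : addrSZ m q ≤ addrX n₀ m q := Nat.le_add_right _ _

theorem addrX_le_addrT (n₀ m q : ℕ) : addrX n₀ m q ≤ addrT n₀ m q :=
  (Nat.le_add_right _ _).trans (Nat.le_add_right _ _)

theorem RoundMem.congr {f : Fin m → Fin 8 → Fin q} {M₀ : ℕ → ℕ} {i : ℕ}
    {st : (Fin 8 × Fin q → ZMod 2) × (Fin m → ZMod 2)} {M M' : ℕ → ℕ}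
    (h : RoundMem n₀ f M₀ i st M) (hM : ∀ x, x ≠ 1 → x ≠ 2 → M' x = M x) :
    RoundMem n₀ f M₀ i st M' := by
  have h1 := three_le_addrSX m q
  have h2 := addrSX_le_addrSZ m q
  have h3 := addrSZ_le_addrX n₀ m q
  have h4 := addrX_le_addrT n₀ m q
  constructor
  · intro k j
    rw [hM _ (by omega) (by omega), h.table]
  · intro j
    rw [hM _ (by omega) (by omega), h.sentinel]
  · intro j t
    rw [hM _ (by omega) (by omega), h.synd]
  · intro k
    rw [hM _ (by omega) (by omega), h.xbit]
  · intro k hk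
    rw [hM _ (by omega) (by omega)]
    exact h.xbound k hk
  · intro k hk l hl hl'
    rw [hM _ (by omega) (by omega), h.rest k hk l hl hl']
  · intro x hx hx'
    rw [hM _ (by omega) (by omega), h.zsynd x hx hx']
  · rw [hM _ (by omega) (by omega)]
    exact h.cell

/-- The number of unsatisfied checks of a variable among its first `j` checks. -/
def unsatBelow (f : Fin m → Fin 8 → Fin q) (s : Fin 8 × Fin q → ZMod 2) (k : Fin m) (j : ℕ) : ℕ :=
  (Finset.univ.filter fun i : Fin 8 => i.val < j ∧ s (i, f k i) ≠ 0).card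

theorem unsatBelow_zero (f : Fin m → Fin 8 → Fin q) (s : Fin 8 × Fin q → ZMod 2) (k : Fin m) :
    unsatBelow f s k 0 = 0 := by
  simp [unsatBelow]

theorem unsatBelow_succ (f : Fin m → Fin 8 → Fin q) (s : Fin 8 × Fin q → ZMod 2) (k : Fin m)
    (j : Fin 8) : unsatBelow f s k (j + 1) = unsatBelow f s k j + (s (j, f k j)).val := by
  have h : ∀ i : Fin 8, (if i.val < j.val + 1 ∧ s (i, f k i) ≠ 0 then 1 else 0) =
      (if i.val < j.val ∧ s (i, f k i) ≠ 0 then 1 else 0) +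
        if i = j then (s (j, f k j)).val else 0 := fun i => by
    by_cases hij : i = j
    · subst hij
      rcases zmod_two_cases (s (i, f k i)) with h | h <;> simp [h, ZMod.val_one]
    · have : i.val < j.val + 1 ↔ i.val < j.val := by
        have := Fin.val_ne_of_ne hij
        omega
      simp [this, hij]
  simp only [unsatBelow, Finset.card_filter, h, Finset.sum_add_distrib]
  simp

theorem unsatBelow_eight (f : Fin m → Fin 8 → Fin q) (s : Fin 8 × Fin q → ZMod 2) (k : Fin m) :
    unsatBelow f s k 8 = unsat f s k := by
  simp [unsatBelow, unsat]

theorem unsatBelow_le (f : Fin m → Fin 8 → Fin q) (s : Fin 8 × Fin q → ZMod 2) (k : Fin m)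
    (j : ℕ) : unsatBelow f s k j ≤ 8 :=
  (Finset.card_le_univ _).trans (by simp)

/-- The result of the votes of the variables in `K`. -/
def VoteMem (f : Fin m → Fin 8 → Fin q) (s : Fin 8 × Fin q → ZMod 2) (M₁ : ℕ → ℕ) (K : ℕ → Prop)
    (M : ℕ → ℕ) : Prop :=
  (∀ x, x ≠ 1 → x ≠ 2 → M x = M₁ x) ∧
    ((M 1 = m ∧ ∀ k : Fin m, K k → ¬ 4 < unsat f s k) ∨ ∃ k : Fin m, M 1 = k ∧ 4 < unsat f s k)

/-- Only qualified variables write to cell `1`, so its content is a qualified variable whoever wins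
the conflict; it is still `m` only if none of those treated qualified. Bit flipping does not care
which qualified variable is taken. -/
theorem wp_vote (hP : 0 < P) (hW : Roomy W n₀ m q) {f : Fin m → Fin 8 → Fin q} {M₀ : ℕ → ℕ} {i : ℕ}
    {st : (Fin 8 × Fin q → ZMod 2) × (Fin m → ZMod 2)} {M₁ : ℕ → ℕ}
    (hM₁ : RoundMem n₀ f M₀ i st M₁)
    (K : ℕ → Prop) (v : ℕ → ℕ) (σ : Config) (hσ : Env P n₀ m q σ)
    (hv : ∀ p < P, σ.reg p 4 = v p ∧ v p < m) (hK : VoteMem f st.1 M₁ K σ.mem) :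
    wp W P vote σ fun σ' t => Env P n₀ m q σ' ∧ (∀ p < P, σ'.reg p 4 = v p) ∧
      VoteMem f st.1 M₁ (fun k => K k ∨ ∃ p < P, v p = k) σ'.mem ∧ t ≤ 500 := by
  have hR : RoundMem n₀ f M₀ i st σ.mem := hM₁.congr hK.1
  simp only [Roomy] at hW
  have e1 := three_le_addrSX m q
  have e2 : addrSZ m q = addrSX m q + 8 * q := rfl
  have e3 := addrSZ_le_addrX n₀ m q
  have e4 := addrX_le_addrT n₀ m q
  refine wp_seq (wp_assign (by simp) (fun p hp => by simp; omega) ?_)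
  refine wp_seq (wp_assign (by simp) (fun p hp => by simp; omega) ?_)
  refine wp_seq (wp_loop 8 40 (fun j σ' => Env P n₀ m q σ' ∧
    (∀ p, ∀ hp : p < P, σ'.reg p 4 = v p ∧ σ'.reg p 7 = j ∧
      σ'.reg p 6 = unsatBelow f st.1 ⟨v p, (hv p hp).2⟩ j) ∧ σ'.mem = σ.mem)
    hP (by norm_num) ?_ ?_ ?_ ?_)
  · simpa using hσ.h8 0 hP
  · refine ⟨(hσ.assign (by norm_num) (by norm_num) _).assign (by norm_num) (by norm_num) _,
      fun p hp => ?_, rfl⟩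
    simp [(hv p hp).1, unsatBelow_zero]
  · rintro j hj σ' ⟨hσ', hr, hmem⟩
    have hT : ∀ p, ∀ hp : p < P, σ'.mem (addrT n₀ m q + 8 * v p + j) =
        addrSX m q + j * q + f ⟨v p, (hv p hp).2⟩ ⟨j, hj⟩ := fun p hp => by
      rw [hmem]
      exact hR.table ⟨v p, (hv p hp).2⟩ ⟨j, hj⟩
    have hS : ∀ p, ∀ hp : p < P, σ'.mem (addrSX m q + j * q + f ⟨v p, (hv p hp).2⟩ ⟨j, hj⟩) =
        (st.1 (⟨j, hj⟩, f ⟨v p, (hv p hp).2⟩ ⟨j, hj⟩)).val := fun p hp => by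
      rw [hmem]
      exact hR.synd ⟨j, hj⟩ _
    have hjq : j * q ≤ 8 * q := Nat.mul_le_mul_right q hj.le
    refine wp_seq (wp_assign (by simp) (fun p hp => ?_)
      (wp_assign (by simp) (fun p hp => ?_) ?_))
    · obtain ⟨a4, a7, a6⟩ := hr p hp
      have hvm := (hv p hp).2
      have hf := (f ⟨v p, (hv p hp).2⟩ ⟨j, hj⟩).isLt
      have hz := ZMod.val_lt (st.1 (⟨j, hj⟩, f ⟨v p, (hv p hp).2⟩ ⟨j, hj⟩))
      have hu := unsatBelow_le f st.1 ⟨v p, (hv p hp).2⟩ j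
      simp only [Arith.Fits, Arith.eval, a4, a7, a6, hσ'.hT p hp, hσ'.h8 p hp, hT p hp, hS p hp]
      omega
    · obtain ⟨a4, a7, a6⟩ := hr p hp
      simp [a7]
      omega
    · refine ⟨⟨(hσ'.assign (by norm_num) (by norm_num) _).assign (by norm_num) (by norm_num) _,
        fun p hp => ?_, hmem⟩, by simp⟩
      obtain ⟨a4, a7, a6⟩ := hr p hp
      have := unsatBelow_succ f st.1 ⟨v p, (hv p hp).2⟩ ⟨j, hj⟩
      simp [a4, a7, a6, hσ'.hT p hp, hσ'.h8 p hp, hT p hp, hS p hp, this]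
  · rintro σ' t ⟨hσ', hr, hmem⟩ ht
    have hu : ∀ p, ∀ hp : p < P, σ'.reg p 6 = unsat f st.1 ⟨v p, (hv p hp).2⟩ := fun p hp => by
      rw [(hr p hp).2.2, unsatBelow_eight]
    have hu8 : ∀ p, ∀ hp : p < P, unsat f st.1 ⟨v p, (hv p hp).2⟩ ≤ 8 := fun p hp => by
      rw [← unsatBelow_eight]
      exact unsatBelow_le _ _ _ _
    refine wp_write (by simp) (by simp) (fun p hp => ?_) (fun p hp => ?_) ?_
    · have := hu8 p hp
      simp [hu p hp, hσ'.h8 p hp]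
      omega
    · have := (hv p hp).2
      simp [(hr p hp).1]
      omega
    · refine ⟨hσ'.write _ _, fun p hp => (hr p hp).1, ?_, ?_⟩
      · change VoteMem f st.1 M₁ _ (parWrite P _ _ σ'.mem)
        have ha : ∀ p, ∀ hp : p < P, Arith.eval p (σ'.reg p) σ'.mem
            (lit 2 - (lit 1 - (lit 1 - (var 6 + var 6 - var 15)))) =
            if 4 < unsat f st.1 ⟨v p, (hv p hp).2⟩ then 1 else 2 := fun p hp => by
          simp only [Arith.eval_sub, Arith.eval, hu p hp, hσ'.h8 p hp]
          split_ifs <;> omega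
        constructor
        · intro x hx1 hx2
          rcases parWrite_cases P (fun p => Arith.eval p (σ'.reg p) σ'.mem
            (lit 2 - (lit 1 - (lit 1 - (var 6 + var 6 - var 15)))))
            (fun p => Arith.eval p (σ'.reg p) σ'.mem (var 4)) σ'.mem x with
            ⟨p, hp, h1, h2⟩ | ⟨h1, h2⟩
          · rw [ha p hp] at h1
            split_ifs at h1 <;> omega
          · rw [h2, hmem]
            exact hK.1 x hx1 hx2
        · rcases parWrite_cases P (fun p => Arith.eval p (σ'.reg p) σ'.mem
            (lit 2 - (lit 1 - (lit 1 - (var 6 + var 6 - var 15)))))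
            (fun p => Arith.eval p (σ'.reg p) σ'.mem (var 4)) σ'.mem 1 with
            ⟨p, hp, h1, h2⟩ | ⟨h1, h2⟩
          · right
            rw [h2]
            rw [ha p hp] at h1
            refine ⟨⟨v p, (hv p hp).2⟩, ?_, ?_⟩
            · simp [(hr p hp).1]
            · by_contra h
              rw [if_neg h] at h1
              omega
          · rw [h2, hmem]
            rcases hK.2 with ⟨h3, h4⟩ | h3
            · left
              refine ⟨h3, ?_⟩
              rintro k (hk | ⟨p, hp, hk⟩)
              · exact h4 k hk
              · have h5 := h1 p hp
                rw [ha p hp] at h5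
                have : k = ⟨v p, (hv p hp).2⟩ := Fin.ext hk.symm
                rw [this]
                intro h6
                exact h5 (if_pos h6)
            · exact Or.inr h3
      · simp
        omega

/-- Replace the bits in the cells `a 0`, …, `a (j - 1)` one after another by their complements. -/
def complementCells (a : ℕ → ℕ) (M : ℕ → ℕ) : ℕ → ℕ → ℕ
  | 0 => M
  | j + 1 => Function.update (complementCells a M j) (a j) (1 - complementCells a M j (a j))

theorem complementCells_of_ne {a M : ℕ → ℕ} {x : ℕ} (j : ℕ) (h : ∀ i < j, a i ≠ x) :
    complementCells a M j x = M x := by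
  induction j with
  | zero => rfl
  | succ j ih =>
    rw [complementCells, Function.update_of_ne (h j (by omega)).symm,
      ih fun i hi => h i (by omega)]

theorem complementCells_le {a M : ℕ → ℕ} (j x : ℕ) : complementCells a M j x ≤ max (M x) 1 := by
  induction j with
  | zero => exact le_max_left _ _
  | succ j ih =>
    rw [complementCells, Function.update_apply]
    split_ifs
    · exact (Nat.sub_le _ _).trans (le_max_right _ _)
    · exact ih

theorem complementCells_of_injOn {a M : ℕ → ℕ} (n : ℕ)
    (hinj : ∀ i < n, ∀ j < n, a i = a j → i = j) {i : ℕ} (hi : i < n) :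
    complementCells a M n (a i) = 1 - M (a i) := by
  induction n with
  | zero => omega
  | succ n ih =>
    rw [complementCells, Function.update_apply]
    by_cases h : i = n
    · subst h
      rw [if_pos rfl, complementCells_of_ne]
      intro j hj h
      have := hinj j (by omega) i (by omega) h
      omega
    · rw [if_neg fun h' => h (hinj i hi n (by omega) h')]
      exact ih (fun i hi j hj => hinj i (by omega) j (by omega)) (by omega)

/-- All processors do the same here, so a simultaneous write is a single update. The addresses in
the table point below the table; hence complementing cells does not disturb entries still to be
read. The value `w = m` is the idle case. -/
theorem wp_flip (hP : 0 < P) (hW : Roomy W n₀ m q) {σ : Config} (hσ : Env P n₀ m q σ) {w : ℕ}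
    (hw : σ.mem 1 = w) (hwm : w ≤ m)
    (ha : ∀ j < 8, σ.mem (addrT n₀ m q + 8 * w + j) < addrT n₀ m q)
    (hval : ∀ j < 8, σ.mem (σ.mem (addrT n₀ m q + 8 * w + j)) ≤ n₀ + 1)
    (hx : σ.mem (addrX n₀ m q + w * n₀) ≤ 8 * q) :
    wp W P flip σ fun σ' t => Env P n₀ m q σ' ∧ t ≤ 500 ∧
      σ'.mem = Function.update
        (complementCells (fun j => σ.mem (addrT n₀ m q + 8 * w + j)) σ.mem 8)
        (addrX n₀ m q + w * n₀)
        (complementCells (fun j => σ.mem (addrT n₀ m q + 8 * w + j)) σ.mem 8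
          (addrX n₀ m q + w * n₀) + 1) := by
  simp only [Roomy] at hW
  have e4 := addrX_le_addrT n₀ m q
  have hwn : w * n₀ ≤ m * n₀ := Nat.mul_le_mul_right n₀ hwm
  have e5 : addrT n₀ m q = addrX n₀ m q + m * n₀ + m * n₀ := rfl
  refine wp_seq (wp_assign (by simp) (fun p hp => by simp; omega) ?_)
  refine wp_seq (wp_assign (by simp) (fun p hp => by simp; omega) ?_)
  refine wp_seq (wp_loop 8 50 (fun j σ' => Env P n₀ m q σ' ∧
    (∀ p < P, σ'.reg p 9 = w ∧ σ'.reg p 7 = j) ∧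
    σ'.mem = complementCells (fun j => σ.mem (addrT n₀ m q + 8 * w + j)) σ.mem j)
    hP (by norm_num) ?_ ?_ ?_ ?_)
  · simpa using hσ.h8 0 hP
  · refine ⟨(hσ.assign (by norm_num) (by norm_num) _).assign (by norm_num) (by norm_num) _,
      fun p hp => ?_, rfl⟩
    simp [hw]
  · rintro j hj σ' ⟨hσ', hr, hmem⟩
    have hT : σ'.mem (addrT n₀ m q + 8 * w + j) = σ.mem (addrT n₀ m q + 8 * w + j) := by
      rw [hmem]
      refine complementCells_of_ne _ fun i hi => ?_
      have := ha i (by omega)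
      omega
    have haj := ha j hj
    have hv : σ'.mem (σ.mem (addrT n₀ m q + 8 * w + j)) ≤ n₀ + 1 := by
      rw [hmem]
      refine (complementCells_le _ _).trans ?_
      have := hval j hj
      omega
    refine wp_seq (wp_write (by simp) (by simp) (fun p hp => ?_) (fun p hp => ?_)
      (wp_assign (by simp) (fun p hp => ?_) ?_))
    · obtain ⟨a9, a7⟩ := hr p hp
      simp only [Arith.Fits, Arith.eval, a9, a7, hσ'.hT p hp, hσ'.h8 p hp, hT]
      omega
    · obtain ⟨a9, a7⟩ := hr p hp
      simp only [Arith.fits_sub, Arith.Fits, Arith.eval, a9, a7, hσ'.hT p hp, hσ'.h8 p hp, hT]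
      omega
    · obtain ⟨a9, a7⟩ := hr p hp
      simp [a7]
      omega
    · refine ⟨⟨(hσ'.write _ _).assign (by norm_num) (by norm_num) _, fun p hp => ?_, ?_⟩, by simp⟩
      · obtain ⟨a9, a7⟩ := hr p hp
        simp [a9, a7]
      · rw [Config.assign_mem]
        change parWrite P _ _ σ'.mem = _
        rw [parWrite_same hP (a := σ.mem (addrT n₀ m q + 8 * w + j))
          (b := 1 - σ'.mem (σ.mem (addrT n₀ m q + 8 * w + j)))]
        · rw [hmem]
          rfl
        · intro p hp
          obtain ⟨a9, a7⟩ := hr p hp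
          simp [a9, a7, hσ'.hT p hp, hσ'.h8 p hp, hT]
        · intro p hp
          obtain ⟨a9, a7⟩ := hr p hp
          simp [a9, a7, hσ'.hT p hp, hσ'.h8 p hp, hT]
  · rintro σ' t ⟨hσ', hr, hmem⟩ ht
    have hx' : σ'.mem (addrX n₀ m q + w * n₀) ≤ 8 * q + 1 := by
      rw [hmem]
      refine (complementCells_le _ _).trans ?_
      omega
    refine wp_write (by simp) (by simp) (fun p hp => ?_) (fun p hp => ?_) ?_
    · simp [(hr p hp).1, hσ'.hn p hp, hσ'.hX p hp]
      omega
    · simp [(hr p hp).1, hσ'.hn p hp, hσ'.hX p hp]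
      omega
    · refine ⟨hσ'.write _ _, by simp; omega, ?_⟩
      change parWrite P _ _ σ'.mem = _
      rw [← hmem]
      refine parWrite_same hP (fun p hp => ?_) fun p hp => ?_ <;>
        simp [(hr p hp).1, hσ'.hn p hp, hσ'.hX p hp]

end Rounds

/-! ### Complete rounds and majority decoding -/

section Phases

variable {W P n₀ m q : ℕ}

theorem mul_add_inj {n k k' l l' : ℕ} (hl : l < n) (hl' : l' < n) (h : k * n + l = k' * n + l') :
    k = k' ∧ l = l' := by
  have h1 : k = k' := by
    have := congrArg (· / n) h
    simpa [mul_comm _ n, Nat.mul_add_div (Nat.zero_lt_of_lt hl), Nat.div_eq_of_lt hl,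
      Nat.div_eq_of_lt hl'] using this
  subst h1
  exact ⟨rfl, by omega⟩

theorem mul_add_lt {n k m l : ℕ} (hl : l < n) (hk : k < m) : k * n + l < m * n := by
  have := Nat.mul_le_mul_right n (show k + 1 ≤ m from hk)
  rw [add_one_mul] at this
  omega

theorem RoundMem.flip (hn : 0 < n₀) {f : Fin m → Fin 8 → Fin q} {M₀ : ℕ → ℕ} {i : ℕ}
    {st : (Fin 8 × Fin q → ZMod 2) × (Fin m → ZMod 2)} {M : ℕ → ℕ}
    (h : RoundMem n₀ f M₀ i st M) (k : Fin m) {M' : ℕ → ℕ}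
    (hM' : M' = complementCells (fun j => M (addrT n₀ m q + 8 * k + j)) M 8) :
    RoundMem n₀ f M₀ (i + 1) (st.1 + checkCol f k, st.2 + Pi.single k 1)
      (Function.update M' (addrX n₀ m q + k * n₀) (M' (addrX n₀ m q + k * n₀) + 1)) := by
  have e1 := three_le_addrSX m q
  have e2 : addrSZ m q = addrSX m q + 8 * q := rfl
  have e3 := addrSZ_le_addrX n₀ m q
  have e4 : addrT n₀ m q = addrX n₀ m q + m * n₀ + m * n₀ := rfl
  have hkn : k * n₀ + 0 < m * n₀ := mul_add_lt hn k.isLt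
  have ha : ∀ j, ∀ hj : j < 8,
      M (addrT n₀ m q + 8 * k + j) = addrSX m q + j * q + f k ⟨j, hj⟩ :=
    fun j hj => h.table k ⟨j, hj⟩
  have hout : ∀ x, x < addrSX m q ∨ addrSZ m q ≤ x → M' x = M x := fun x hx => by
    rw [hM']
    refine complementCells_of_ne _ fun j hj => ?_
    have := mul_add_lt (f k ⟨j, hj⟩).isLt hj
    rw [ha j hj]
    omega
  constructor
  · intro k' j
    rw [Function.update_of_ne (by omega), hout _ (by omega), h.table]
  · intro j
    rw [Function.update_of_ne (by omega), hout _ (by omega), h.sentinel]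
  · intro j t
    have hlt := mul_add_lt t.isLt j.isLt
    rw [Function.update_of_ne (by omega)]
    change _ = (st.1 (j, t) + if f k j = t then 1 else 0 : ZMod 2).val
    by_cases hft : f k j = t
    -- The checks of a variable lie in eight different blocks, so each of them is complemented
    -- exactly once.
    · have h1 := complementCells_of_injOn (a := fun j => M (addrT n₀ m q + 8 * k + j)) (M := M) 8
        (fun i hi i' hi' hii => by
          simp only [ha i hi, ha i' hi'] at hii
          rw [add_assoc, add_assoc] at hii
          exact (mul_add_inj (f k ⟨i, hi⟩).isLt (f k ⟨i', hi'⟩).isLt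
            (Nat.add_left_cancel hii)).1) j.isLt
      simp only [ha j j.isLt] at h1
      rw [← hM', hft, h.synd] at h1
      rw [h1, if_pos hft]
      generalize st.1 (j, t) = z
      revert z
      decide
    · rw [if_neg hft, add_zero, hM', complementCells_of_ne, h.synd]
      intro i hi heq
      rw [ha i hi, add_assoc, add_assoc] at heq
      obtain ⟨h1, h2⟩ := mul_add_inj (f k ⟨i, hi⟩).isLt t.isLt (Nat.add_left_cancel heq)
      subst h1
      exact hft (Fin.ext h2)
  · intro k'
    by_cases hk : k' = k
    · subst hk
      rw [Function.update_self, hout _ (by omega), Nat.cast_add, h.xbit]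
      simp
    · rw [Function.update_of_ne, hout _ (by omega), h.xbit]
      · simp [hk]
      · intro heq
        exact hk (Fin.ext (Nat.eq_of_mul_eq_mul_right hn (Nat.add_left_cancel heq)))
  · intro k' hk'
    rw [Function.update_apply, hout _ (by omega), hout _ (by omega)]
    have h1 := h.xbound k' hk'
    have h2 := h.xbound k k.isLt.le
    split_ifs <;> omega
  · intro k' hk' l hl hl'
    rw [Function.update_of_ne, hout _ (by omega), h.rest k' hk' l hl hl']
    intro heq
    rw [add_assoc] at heq
    have := (mul_add_inj hl' hn (k := k') (k' := k) (by omega)).2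
    omega
  · intro x hx hx'
    rw [Function.update_of_ne (by omega), hout _ (by omega), h.zsynd x hx hx']
  · rw [Function.update_of_ne (by omega), hout _ (by omega)]
    exact h.cell

/-- Flipping the fictitious variable only touches cell `0` and the cell `addrX + m * n₀`. The latter
is the first cell of the Z-output, which majority decoding overwrites later. -/
theorem RoundMem.idle (hn : 0 < n₀) (hm : 0 < m) {f : Fin m → Fin 8 → Fin q} {M₀ : ℕ → ℕ} {i : ℕ}
    {st : (Fin 8 × Fin q → ZMod 2) × (Fin m → ZMod 2)} {M : ℕ → ℕ}
    (h : RoundMem n₀ f M₀ i st M) {M' : ℕ → ℕ}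
    (hM' : M' = complementCells (fun j => M (addrT n₀ m q + 8 * m + j)) M 8) :
    RoundMem n₀ f M₀ (i + 1) st
      (Function.update M' (addrX n₀ m q + m * n₀) (M' (addrX n₀ m q + m * n₀) + 1)) := by
  have e1 := three_le_addrSX m q
  have e2 : addrSZ m q = addrSX m q + 8 * q := rfl
  have e3 := addrSZ_le_addrX n₀ m q
  have e4 : addrT n₀ m q = addrX n₀ m q + m * n₀ + m * n₀ := rfl
  have ha : ∀ j < 8, M (addrT n₀ m q + 8 * m + j) = 0 := fun j hj => h.sentinel ⟨j, hj⟩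
  have hout : ∀ x, 0 < x → M' x = M x := fun x hx => by
    rw [hM']
    refine complementCells_of_ne _ fun j hj => ?_
    rw [ha j hj]
    omega
  constructor
  · intro k j
    have := mul_add_lt hn k.isLt
    rw [Function.update_of_ne (by omega), hout _ (by omega), h.table]
  · intro j
    have := mul_add_lt hn hm
    rw [Function.update_of_ne (by omega), hout _ (by omega), h.sentinel]
  · intro j t
    have hlt := mul_add_lt t.isLt j.isLt
    rw [Function.update_of_ne (by omega), hout _ (by omega), h.synd]
  · intro k
    have := mul_add_lt hn k.isLt
    rw [Function.update_of_ne (by omega), hout _ (by omega), h.xbit]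
  · intro k' hk'
    rw [Function.update_apply, hout _ (by omega), hout _ (by omega)]
    have h1 := h.xbound k' hk'
    have h2 := h.xbound m le_rfl
    split_ifs <;> omega
  · intro k' hk' l hl hl'
    have := mul_add_lt hl' hk'
    rw [Function.update_of_ne (by omega), hout _ (by omega), h.rest k' hk' l hl hl']
  · intro x hx hx'
    rw [Function.update_of_ne (by omega), hout _ (by omega), h.zsynd x hx hx']
  · rw [Function.update_of_ne (by omega), hM']
    refine (complementCells_le _ _).trans ?_
    have := h.cell
    omega

theorem wp_round {par : Bool} (hn : 0 < n₀) (hm : 0 < m) (hW : Roomy W n₀ m q)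
    {f : Fin m → Fin 8 → Fin q} {M₀ : ℕ → ℕ} {i : ℕ} (hi : i < 8 * q)
    {st : (Fin 8 × Fin q → ZMod 2) × (Fin m → ZMod 2)} {σ : Config}
    (hσ : Env (processors par m) n₀ m q σ) (h : RoundMem n₀ f M₀ i st σ.mem) :
    wp W (processors par m) (round par) σ fun σ' t => (Env (processors par m) n₀ m q σ' ∧
      ∃ st', FlipStep f st st' ∧ RoundMem n₀ f M₀ (i + 1) st' σ'.mem) ∧
      t ≤ 600 + repetitions par m * 510 := by
  have hP : 0 < processors par m := by
    unfold processors
    split_ifs <;> omega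
  have hW' := hW
  simp only [Roomy] at hW'
  refine wp_seq (wp_write (by simp) (by simp) (fun p hp => by simp; omega) (fun p hp => ?_) ?_)
  · simp [hσ.hm p hp]
    omega
  have hmem : (σ.write (processors par m) (lit 1) (var 1)).mem = Function.update σ.mem 1 m :=
    parWrite_same hP (fun p hp => by simp) fun p hp => by simp [hσ.hm p hp]
  refine wp_seq (wp_mono (wp_forEach hW 500 (VoteMem f st.1 σ.mem)
    (fun K v σ' h1 h2 h3 => wp_vote hP hW h K v σ' h1 h2 h3) (hσ.write _ _) ?_) ?_)
  · rw [hmem]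
    refine ⟨fun x hx _ => Function.update_of_ne hx _ _, Or.inl ⟨by simp, by simp⟩⟩
  rintro σ' t ⟨hσ', ⟨h1, h2⟩, ht⟩
  have hR := h.congr h1
  have e4 : addrT n₀ m q = addrX n₀ m q + m * n₀ + m * n₀ := rfl
  have e2 : addrSZ m q = addrSX m q + 8 * q := rfl
  have e3 := addrSZ_le_addrX n₀ m q
  have e1 := three_le_addrSX m q
  rcases h2 with ⟨hw, hno⟩ | ⟨k, hw, hk⟩
  · have ha : ∀ j < 8, σ'.mem (addrT n₀ m q + 8 * m + j) = 0 := fun j hj => hR.sentinel ⟨j, hj⟩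
    refine wp_mono (wp_flip hP hW hσ' hw le_rfl (fun j hj => ?_) (fun j hj => ?_)
      ((hR.xbound m le_rfl).trans hi.le)) ?_
    · rw [ha j hj]
      omega
    · rw [ha j hj]
      exact hR.cell
    · rintro σ'' t' ⟨h3, h4, h5⟩
      refine ⟨⟨h3, st, Or.inr ⟨fun w => hno w w.isLt, rfl⟩, ?_⟩, ?_⟩
      · rw [h5]
        exact hR.idle hn hm rfl
      · simp
        omega
  · have ha : ∀ j, ∀ hj : j < 8, σ'.mem (addrT n₀ m q + 8 * k + j) =
        addrSX m q + j * q + f k ⟨j, hj⟩ := fun j hj => hR.table k ⟨j, hj⟩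
    refine wp_mono (wp_flip hP hW hσ' hw k.isLt.le (fun j hj => ?_) (fun j hj => ?_)
      ((hR.xbound k k.isLt.le).trans hi.le)) ?_
    · have := mul_add_lt (f k ⟨j, hj⟩).isLt hj
      rw [ha j hj]
      omega
    · rw [ha j hj, hR.synd ⟨j, hj⟩]
      have := ZMod.val_lt (st.1 (⟨j, hj⟩, f k ⟨j, hj⟩))
      omega
    · rintro σ'' t' ⟨h3, h4, h5⟩
      refine ⟨⟨h3, (st.1 + checkCol f k, st.2 + Pi.single k 1), Or.inl ⟨k, hk, rfl, rfl⟩, ?_⟩, ?_⟩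
      · rw [h5]
        exact hR.flip hn k rfl
      · simp
        omega

/-- The number of ones in the syndrome of a block. -/
def blockCount (n₀ : ℕ) (z : ℕ → ℕ → ℕ) (k : ℕ) : ℕ := ∑ l ∈ Finset.range (n₀ - 1), z k l

/-- Whether the last qubit of a block suffers a `Z`-error, by majority decoding. -/
def blockFlip (n₀ : ℕ) (z : ℕ → ℕ → ℕ) (k : ℕ) : ℕ := if n₀ < 2 * blockCount n₀ z k then 1 else 0

/-- The result of majority decoding. -/
def majorityEntry (n₀ : ℕ) (z : ℕ → ℕ → ℕ) (k l : ℕ) : ℕ :=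
  if l < n₀ - 1 then z k l + blockFlip n₀ z k else blockFlip n₀ z k

/-- The result of majority decoding, as contents of the memory. -/
def majorityMem (n₀ m q : ℕ) (z : ℕ → ℕ → ℕ) (x : ℕ) : ℕ :=
  majorityEntry n₀ z ((x - addrZ n₀ m q) / n₀) ((x - addrZ n₀ m q) % n₀)

theorem majorityMem_apply (z : ℕ → ℕ → ℕ) (k : ℕ) {l : ℕ} (hl : l < n₀) :
    majorityMem n₀ m q z (addrZ n₀ m q + k * n₀ + l) = majorityEntry n₀ z k l := by
  have h : addrZ n₀ m q + k * n₀ + l - addrZ n₀ m q = n₀ * k + l := by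
    rw [mul_comm]
    omega
  rw [majorityMem, h, Nat.mul_add_div (Nat.zero_lt_of_lt hl), Nat.div_eq_of_lt hl, add_zero,
    Nat.mul_add_mod, Nat.mod_eq_of_lt hl]

theorem wp_majority (hP : 0 < P) (hn : 0 < n₀) (hW : Roomy W n₀ m q) {z : ℕ → ℕ → ℕ} {M : ℕ → ℕ}
    (hz : ∀ k < m, ∀ l < n₀ - 1, z k l ≤ 1)
    (hM : ∀ k < m, ∀ l < n₀ - 1, M (addrSZ m q + k * (n₀ - 1) + l) = z k l)
    (K : ℕ → Prop) (v : ℕ → ℕ) (σ : Config) (hσ : Env P n₀ m q σ)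
    (hv : ∀ p < P, σ.reg p 4 = v p ∧ v p < m)
    (hK : σ.mem = overlay (fun x => ∃ k, K k ∧ ∃ l < n₀, x = addrZ n₀ m q + k * n₀ + l)
      (majorityMem n₀ m q z) M) :
    wp W P majority σ fun σ' t => Env P n₀ m q σ' ∧ (∀ p < P, σ'.reg p 4 = v p) ∧
      σ'.mem = overlay (fun x => ∃ k, (K k ∨ ∃ p < P, v p = k) ∧
        ∃ l < n₀, x = addrZ n₀ m q + k * n₀ + l) (majorityMem n₀ m q z) M ∧
      t ≤ 100 + n₀ * 100 := by
  simp only [Roomy] at hW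
  have e1 : addrT n₀ m q = addrZ n₀ m q + m * n₀ := rfl
  have e2 : addrZ n₀ m q = addrX n₀ m q + m * n₀ := rfl
  have e3 : addrX n₀ m q = addrSZ m q + m * (n₀ - 1) := rfl
  have hcount : ∀ k < m, ∀ i ≤ n₀ - 1, ∑ l ∈ Finset.range i, z k l ≤ i := fun k hk i hi => by
    refine (Finset.sum_le_card_nsmul _ _ 1 fun l hl => hz k hk l ?_).trans (by simp)
    have := Finset.mem_range.1 hl
    omega
  have hflip : ∀ k, blockFlip n₀ z k ≤ 1 := fun k => by
    unfold blockFlip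
    split_ifs <;> omega
  -- The syndrome lies below the Z-output, so it can be read correctly at any stage of the writing.
  have hload : ∀ D : ℕ → Prop, (∀ x, D x → addrZ n₀ m q ≤ x) → ∀ p < P, ∀ l < n₀ - 1,
      overlay D (majorityMem n₀ m q z) M (addrSZ m q + v p * (n₀ - 1) + l) = z (v p) l :=
    fun D hD p hp l hl => by
      have := mul_add_lt hl (hv p hp).2
      rw [overlay_neg fun h => by have := hD _ h; omega, hM _ (hv p hp).2 _ hl]
  have hvn : ∀ p < P, v p * (n₀ - 1) ≤ m * (n₀ - 1) ∧ v p * n₀ ≤ m * n₀ := fun p hp =>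
    ⟨Nat.mul_le_mul_right _ (hv p hp).2.le, Nat.mul_le_mul_right _ (hv p hp).2.le⟩
  refine wp_seq (wp_assign (by simp) (fun p hp => by simp; omega) ?_)
  refine wp_seq (wp_assign (by simp) (fun p hp => by simp; omega) ?_)
  refine wp_seq (wp_assign (by simp) (fun p hp => ?_) ?_)
  · simp [hσ.hn p hp]
    omega
  refine wp_seq (wp_loop (n₀ - 1) 40 (fun i σ' => Env P n₀ m q σ' ∧
    (∀ p < P, σ'.reg p 4 = v p ∧ σ'.reg p 8 = n₀ - 1 ∧ σ'.reg p 5 = i ∧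
      σ'.reg p 6 = ∑ l ∈ Finset.range i, z (v p) l) ∧ σ'.mem = σ.mem)
    hP (by norm_num) ?_ ?_ ?_ ?_)
  · simp [hσ.hn 0 hP]
  · refine ⟨((hσ.assign (by norm_num) (by norm_num) _).assign (by norm_num) (by norm_num) _).assign
      (by norm_num) (by norm_num) _, fun p hp => ?_, rfl⟩
    simp [(hv p hp).1, hσ.hn p hp]
  · rintro i hi σ' ⟨hσ', hr, hmem⟩
    have hl : ∀ p < P, σ'.mem (addrSZ m q + v p * (n₀ - 1) + i) = z (v p) i := fun p hp => by
      rw [hmem, hK]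
      exact hload _ (fun x ⟨k, _, l, _, h⟩ => by omega) p hp i hi
    refine wp_seq (wp_assign (by simp) (fun p hp => ?_)
      (wp_assign (by simp) (fun p hp => ?_) ?_))
    · obtain ⟨a4, a8, a5, a6⟩ := hr p hp
      obtain ⟨b1, b2⟩ := hvn p hp
      have hz' := hz _ (hv p hp).2 i hi
      have hc := hcount _ (hv p hp).2 i hi.le
      have hvm := (hv p hp).2
      simp only [Arith.Fits, Arith.eval, a4, a8, a5, a6,
        hσ'.hSZ p hp, hl p hp]
      omega
    · obtain ⟨a4, a8, a5, a6⟩ := hr p hp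
      simp [a5]
      omega
    · refine ⟨⟨(hσ'.assign (by norm_num) (by norm_num) _).assign (by norm_num) (by norm_num) _,
        fun p hp => ?_, hmem⟩, by simp⟩
      obtain ⟨a4, a8, a5, a6⟩ := hr p hp
      simp [a4, a8, a5, a6, hσ'.hSZ p hp, hl p hp, Finset.sum_range_succ]
  rintro σ₁ t₁ ⟨hσ₁, hr₁, hmem₁⟩ ht₁
  refine wp_seq (wp_assign (by simp) (fun p hp => ?_) ?_)
  · obtain ⟨a4, a8, a5, a6⟩ := hr₁ p hp
    have hc := hcount _ (hv p hp).2 (n₀ - 1) le_rfl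
    simp [a6, hσ₁.hn p hp]
    omega
  refine wp_seq (wp_assign (by simp) (fun p hp => by simp; omega) ?_)
  refine wp_seq (wp_loop (n₀ - 1) 50 (fun i σ' => Env P n₀ m q σ' ∧
    (∀ p < P, σ'.reg p 4 = v p ∧ σ'.reg p 8 = n₀ - 1 ∧ σ'.reg p 5 = i ∧
      σ'.reg p 9 = blockFlip n₀ z (v p)) ∧
    σ'.mem = overlay (fun x => (∃ k, K k ∧ ∃ l < n₀, x = addrZ n₀ m q + k * n₀ + l) ∨
      ∃ p < P, ∃ l < i, x = addrZ n₀ m q + v p * n₀ + l) (majorityMem n₀ m q z) M)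
    hP (by norm_num) ?_ ?_ ?_ ?_)
  · simp [(hr₁ 0 hP).2.1]
  · refine ⟨(hσ₁.assign (by norm_num) (by norm_num) _).assign (by norm_num) (by norm_num) _,
      fun p hp => ?_, ?_⟩
    · obtain ⟨a4, a8, a5, a6⟩ := hr₁ p hp
      have hc : ∑ l ∈ Finset.range (n₀ - 1), z (v p) l = blockCount n₀ z (v p) := rfl
      simp only [Config.assign_reg, a4, a8, Arith.eval_sub, Arith.eval, a6,
        hσ₁.hn p hp, hc, blockFlip]
      refine ⟨rfl, rfl, rfl, ?_⟩
      simp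
      split_ifs <;> omega
    · rw [Config.assign_mem, Config.assign_mem, hmem₁, hK]
      simp
  · rintro i hi σ' ⟨hσ', hr, hmem⟩
    have hl : ∀ p < P, σ'.mem (addrSZ m q + v p * (n₀ - 1) + i) = z (v p) i := fun p hp => by
      rw [hmem]
      exact hload _ (by rintro x (⟨k, _, l, _, h⟩ | ⟨k, _, l, _, h⟩) <;> omega) p hp i hi
    refine wp_seq (wp_write (by simp) (by simp) (fun p hp => ?_) (fun p hp => ?_)
      (wp_assign (by simp) (fun p hp => ?_) ?_))
    · obtain ⟨a4, a8, a5, a9⟩ := hr p hp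
      obtain ⟨b1, b2⟩ := hvn p hp
      have hvm := (hv p hp).2
      simp only [Arith.Fits, Arith.eval, a4, a5,
        hσ'.hZ p hp, hσ'.hn p hp]
      omega
    · obtain ⟨a4, a8, a5, a9⟩ := hr p hp
      obtain ⟨b1, b2⟩ := hvn p hp
      have hz' := hz _ (hv p hp).2 i hi
      have hf := hflip (v p)
      have hvm := (hv p hp).2
      simp only [Arith.Fits, Arith.eval, a4, a8, a5, a9,
        hσ'.hSZ p hp, hl p hp]
      omega
    · obtain ⟨a4, a8, a5, a9⟩ := hr p hp
      simp [a5]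
      omega
    · refine ⟨⟨(hσ'.write _ _).assign (by norm_num) (by norm_num) _, fun p hp => ?_, ?_⟩, by simp⟩
      · obtain ⟨a4, a8, a5, a9⟩ := hr p hp
        simp [a4, a8, a5, a9]
      · rw [Config.assign_mem]
        change parWrite P _ _ σ'.mem = _
        have ha : ∀ p < P, Arith.eval p (σ'.reg p) σ'.mem
            (var 14 + var 4 * var 0 + var 5) = addrZ n₀ m q + v p * n₀ + i := fun p hp => by
          obtain ⟨a4, a8, a5, a9⟩ := hr p hp
          simp [a4, a5, hσ'.hZ p hp, hσ'.hn p hp]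
        have hb : ∀ p < P, Arith.eval p (σ'.reg p) σ'.mem
            (.load (var 13 + var 4 * var 8 + var 5) + var 9) =
            majorityMem n₀ m q z (addrZ n₀ m q + v p * n₀ + i) := fun p hp => by
          obtain ⟨a4, a8, a5, a9⟩ := hr p hp
          rw [majorityMem_apply z _ (by omega), majorityEntry, if_pos hi]
          simp [a4, a5, a8, a9, hσ'.hSZ p hp, hl p hp]
        rw [parWrite_congr _ ha hb, hmem]
        refine parWrite_overlay (fun p hp => rfl) fun x => ?_
        rw [or_assoc]
        refine or_congr Iff.rfl ⟨?_, ?_⟩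
        · rintro ⟨p, hp, l, hl, rfl⟩
          rcases Nat.lt_succ_iff_lt_or_eq.1 hl with h | rfl
          · exact Or.inl ⟨p, hp, l, h, rfl⟩
          · exact Or.inr ⟨p, hp, rfl⟩
        · rintro (⟨p, hp, l, hl, rfl⟩ | ⟨p, hp, rfl⟩)
          · exact ⟨p, hp, l, by omega, rfl⟩
          · exact ⟨p, hp, i, by omega, rfl⟩
  rintro σ₂ t₂ ⟨hσ₂, hr₂, hmem₂⟩ ht₂
  refine wp_write (by simp) (by simp) (fun p hp => ?_) (fun p hp => ?_) ?_
  · obtain ⟨a4, a8, a5, a9⟩ := hr₂ p hp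
    obtain ⟨b1, b2⟩ := hvn p hp
    have hvm := (hv p hp).2
    simp only [Arith.Fits, Arith.eval, a4, a8,
      hσ₂.hZ p hp, hσ₂.hn p hp]
    omega
  · obtain ⟨a4, a8, a5, a9⟩ := hr₂ p hp
    have hf := hflip (v p)
    simp [a9]
    omega
  · refine ⟨hσ₂.write _ _, fun p hp => (hr₂ p hp).1, ?_, ?_⟩
    · change parWrite P _ _ σ₂.mem = _
      have ha : ∀ p < P, Arith.eval p (σ₂.reg p) σ₂.mem
          (var 14 + var 4 * var 0 + var 8) = addrZ n₀ m q + v p * n₀ + (n₀ - 1) := fun p hp => by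
        obtain ⟨a4, a8, a5, a9⟩ := hr₂ p hp
        simp [a4, a8, hσ₂.hZ p hp, hσ₂.hn p hp]
      have hb : ∀ p < P, Arith.eval p (σ₂.reg p) σ₂.mem (var 9) =
          majorityMem n₀ m q z (addrZ n₀ m q + v p * n₀ + (n₀ - 1)) := fun p hp => by
        obtain ⟨a4, a8, a5, a9⟩ := hr₂ p hp
        rw [majorityMem_apply z _ (by omega), majorityEntry, if_neg (lt_irrefl _)]
        simp [a9]
      rw [parWrite_congr _ ha hb, hmem₂]
      refine parWrite_overlay (fun p hp => rfl) fun x => ⟨?_, ?_⟩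
      · rintro ⟨k, hk | ⟨p, hp, rfl⟩, l, hl, rfl⟩
        · exact Or.inl (Or.inl ⟨k, hk, l, hl, rfl⟩)
        · by_cases h : l < n₀ - 1
          · exact Or.inl (Or.inr ⟨p, hp, l, h, rfl⟩)
          · exact Or.inr ⟨p, hp, by omega⟩
      · rintro ((⟨k, hk, h⟩ | ⟨p, hp, l, hl, h⟩) | ⟨p, hp, h⟩)
        · exact ⟨k, Or.inl hk, h⟩
        · exact ⟨v p, Or.inr ⟨p, hp, rfl⟩, l, by omega, h⟩
        · exact ⟨v p, Or.inr ⟨p, hp, rfl⟩, n₀ - 1, by omega, h.symm⟩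
    · simp
      omega

end Phases

/-! ### Correctness and running time of the whole program -/

section Decoder

variable {W P n₀ m q : ℕ}

/-- The vector `x` is a possible result of bit flipping on the graph `f` with syndrome `s`. -/
def FlipResult (m q : ℕ) (f : ℕ → ℕ → ℕ) (s : Fin 8 × Fin q → ZMod 2) (x : Fin m → ZMod 2) : Prop :=
  -- For `q = 0` and `m > 0` no `g` as below exists, so the result has to be recorded separately.
  (q = 0 → x = 0) ∧
  ∀ g : Fin m → Fin 8 → Fin q, (∀ k j, (g k j : ℕ) = f k j) →
    ∃ st : ℕ → (Fin 8 × Fin q → ZMod 2) × (Fin m → ZMod 2), st 0 = (s, 0) ∧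
      (∀ i < 8 * q, FlipStep g (st i) (st (i + 1))) ∧ (st (8 * q)).2 = x

/-- The input of the decoder, as contents of the memory. -/
structure InputMem (n₀ m q : ℕ) (f : ℕ → ℕ → ℕ) (s : Fin 8 × Fin q → ZMod 2) (z : ℕ → ℕ → ℕ)
    (M : ℕ → ℕ) : Prop where
  zero : M 0 = n₀
  one : M 1 = m
  two : M 2 = 8 * q
  matrix : ∀ j < 8, ∀ t < q, ∀ v < m, M (3 + (j * q + t) * m + v) = if f v j = t then 1 else 0
  syndX : ∀ (j : Fin 8) (t : Fin q), M (addrSX m q + j * q + t) = (s (j, t)).val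
  syndZ : ∀ k < m, ∀ l < n₀ - 1, M (addrSZ m q + k * (n₀ - 1) + l) = z k l
  syndZ_le : ∀ k < m, ∀ l < n₀ - 1, z k l ≤ 1
  blank : ∀ x, addrX n₀ m q ≤ x → M x = 0

/-- The memory after bit flipping. -/
structure FlippedMem (n₀ m q : ℕ) (M₀ : ℕ → ℕ) (x : Fin m → ZMod 2) (M : ℕ → ℕ) : Prop where
  xbit : ∀ k : Fin m, (M (addrX n₀ m q + k * n₀) : ZMod 2) = x k
  rest : ∀ k < m, ∀ l, 0 < l → l < n₀ → M (addrX n₀ m q + k * n₀ + l) = 0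
  zsynd : ∀ x, addrSZ m q ≤ x → x < addrX n₀ m q → M x = M₀ x

theorem wp_rounds {par : Bool} (hn : 0 < n₀) (hm : 0 < m) (hW : Roomy W n₀ m q)
    {f : ℕ → ℕ → ℕ} {s : Fin 8 × Fin q → ZMod 2} {z : ℕ → ℕ → ℕ} {M₀ : ℕ → ℕ}
    (hM₀ : InputMem n₀ m q f s z M₀) (hf : 0 < q → ∀ v < m, ∀ j < 8, f v j < q)
    {σ : Config} (hσ : Env (processors par m) n₀ m q σ)
    (hmem : σ.mem = overlay (fun x => ∃ k < m, ∃ j < 8, x = addrT n₀ m q + 8 * k + j)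
      (tableMem n₀ m q f) M₀) :
    wp W (processors par m) (.loop 2 (round par)) σ fun σ' t =>
      Env (processors par m) n₀ m q σ' ∧ (∃ x, FlipResult m q f s x ∧
        FlippedMem n₀ m q M₀ x σ'.mem) ∧ t ≤ 1 + 8 * q * (600 + repetitions par m * 510 + 1) := by
  have hP : 0 < processors par m := by
    unfold processors
    split_ifs <;> omega
  have e1 := three_le_addrSX m q
  have e2 : addrSZ m q = addrSX m q + 8 * q := rfl
  have e3 := addrSZ_le_addrX n₀ m q
  have e4 : addrT n₀ m q = addrX n₀ m q + m * n₀ + m * n₀ := rfl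
  have hlow : ∀ x < addrT n₀ m q, σ.mem x = M₀ x := fun x hx => by
    rw [hmem, overlay_neg]
    rintro ⟨k, -, j, -, h⟩
    omega
  have hX : ∀ x, addrX n₀ m q ≤ x → x < addrT n₀ m q → σ.mem x = 0 := fun x h1 h2 => by
    rw [hlow x h2, hM₀.blank x h1]
  rcases Nat.eq_zero_or_pos q with hq | hq
  · refine wp_loop (8 * q) (600 + repetitions par m * 510)
      (fun _ σ' => Env (processors par m) n₀ m q σ' ∧ σ'.mem = σ.mem) hP
      (by norm_num) (hσ.hr 0 hP) ⟨hσ, rfl⟩ (fun i hi => by omega) ?_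
    rintro σ' t ⟨hσ', hmem'⟩ ht
    refine ⟨hσ', ⟨0, ⟨fun _ => rfl, fun g _ => ?_⟩, ?_⟩, ht⟩
    · exact absurd (g ⟨0, hm⟩ 0).isLt (by omega)
    · rw [hmem']
      refine ⟨fun k => ?_, fun k hk l _ hl => ?_, fun x _ hx => hlow x (by omega)⟩
      · have := mul_add_lt hn k.isLt
        rw [hX _ (by omega) (by omega)]
        rfl
      · have := mul_add_lt hl hk
        exact hX _ (by omega) (by omega)
  · let g : Fin m → Fin 8 → Fin q := fun k j => ⟨f k j, hf hq k k.isLt j j.isLt⟩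
    refine wp_loop (8 * q) (600 + repetitions par m * 510)
      (fun i σ' => Env (processors par m) n₀ m q σ' ∧
        ∃ st : ℕ → (Fin 8 × Fin q → ZMod 2) × (Fin m → ZMod 2), st 0 = (s, 0) ∧
          (∀ i' < i, FlipStep g (st i') (st (i' + 1))) ∧ RoundMem n₀ g M₀ i (st i) σ'.mem) hP
      (by norm_num) (hσ.hr 0 hP) ⟨hσ, fun _ => (s, 0), rfl, by simp, ?_⟩ ?_ ?_
    · have := mul_add_lt hn hm
      constructor
      · intro k j
        rw [hmem, overlay_pos ⟨k, k.isLt, j, j.isLt, rfl⟩, tableMem_apply f k j.isLt, tableEntry,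
          if_pos (hf hq k k.isLt j j.isLt)]
      · intro j
        rw [hmem, overlay_neg, hM₀.blank _ (by omega)]
        rintro ⟨k, hk, i, hi, h⟩
        omega
      · intro j t
        have := mul_add_lt t.isLt j.isLt
        rw [hlow _ (by omega), hM₀.syndX]
      · intro k
        have := mul_add_lt hn k.isLt
        rw [hX _ (by omega) (by omega)]
        rfl
      · intro k hk
        have := Nat.mul_le_mul_right n₀ hk
        rw [hX _ (by omega) (by omega)]
      · intro k hk l _ hl
        have := mul_add_lt hl hk
        exact hX _ (by omega) (by omega)
      · exact fun x _ hx => hlow x (by omega)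
      · rw [hlow 0 (by omega), hM₀.zero]
        omega
    · rintro i hi σ' ⟨hσ', st, h1, h2, h3⟩
      refine wp_mono (wp_round hn hm hW hi hσ' h3) ?_
      rintro σ'' t ⟨⟨h4, st', h5, h6⟩, h7⟩
      -- The trajectory is built along the loop; each round prescribes one further state.
      refine ⟨⟨h4, Function.update st (i + 1) st', ?_, ?_, ?_⟩, h7⟩
      · rw [Function.update_of_ne (by omega), h1]
      · intro i' hi'
        rcases Nat.lt_succ_iff_lt_or_eq.1 hi' with h | rfl
        · rw [Function.update_of_ne (by omega), Function.update_of_ne (by omega)]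
          exact h2 i' h
        · rw [Function.update_of_ne (by omega), Function.update_self]
          exact h5
      · rw [Function.update_self]
        exact h6
    · rintro σ' t ⟨hσ', st, h1, h2, h3⟩ ht
      refine ⟨hσ', ⟨(st (8 * q)).2, ⟨fun h => by omega, fun g' hg' => ?_⟩, h3.xbit, h3.rest,
        h3.zsynd⟩, ht⟩
      have : g' = g := funext fun k => funext fun j => Fin.ext (hg' k j)
      rw [this]
      exact ⟨st, h1, h2, rfl⟩

theorem wp_decoder {par : Bool} (hn : 0 < n₀) (hm : 0 < m) (hqm : q ≤ m) (hW : Roomy W n₀ m q)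
    {f : ℕ → ℕ → ℕ} {s : Fin 8 × Fin q → ZMod 2} {z : ℕ → ℕ → ℕ} {σ : Config}
    (hM₀ : InputMem n₀ m q f s z σ.mem) (hf : 0 < q → ∀ v < m, ∀ j < 8, f v j < q) :
    wp W (processors par m) (decoder par) σ fun σ' t =>
      (∃ x, FlipResult m q f s x ∧
        (∀ k : Fin m, (σ'.mem (addrX n₀ m q + k * n₀) : ZMod 2) = x k)) ∧
      (∀ k < m, ∀ l, 0 < l → l < n₀ → σ'.mem (addrX n₀ m q + k * n₀ + l) = 0) ∧
      (∀ k < m, ∀ l < n₀, σ'.mem (addrZ n₀ m q + k * n₀ + l) = majorityEntry n₀ z k l) ∧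
      t ≤ 20000 * (repetitions par m * (m + n₀)) := by
  have hP : 0 < processors par m := by
    unfold processors
    split_ifs <;> omega
  have hrep : 0 < repetitions par m := by
    unfold repetitions
    split_ifs <;> omega
  refine wp_seq (wp_mono (wp_setup hP hW hM₀.zero hM₀.one hM₀.two) ?_)
  rintro σ₁ t₁ ⟨hσ₁, hmem₁, ht₁⟩
  refine wp_seq (wp_mono (wp_forEach hW (8 * (q * 50 + 60) + 20)
    (fun K M => M = overlay (fun x => ∃ k, K k ∧ ∃ j < 8, x = addrT n₀ m q + 8 * k + j)
      (tableMem n₀ m q f) σ.mem)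
      (fun K v σ' h1 h2 h3 => wp_tabulate hP hW hM₀.matrix K v σ' h1 h2 h3)
    hσ₁ ?_) ?_)
  · simp [overlay_false, hmem₁]
  rintro σ₂ t₂ ⟨hσ₂, hmem₂, ht₂⟩
  refine wp_seq (wp_mono (wp_rounds hn hm hW hM₀ hf hσ₂ hmem₂) ?_)
  rintro σ₃ t₃ ⟨hσ₃, ⟨x, hx, h₃⟩, ht₃⟩
  have e3 : addrX n₀ m q = addrSZ m q + m * (n₀ - 1) := rfl
  have e5 : addrZ n₀ m q = addrX n₀ m q + m * n₀ := rfl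
  have hZ : ∀ k < m, ∀ l < n₀ - 1, σ₃.mem (addrSZ m q + k * (n₀ - 1) + l) = z k l :=
    fun k hk l hl => by
      have := mul_add_lt hl hk
      rw [h₃.zsynd _ (by omega) (by omega), hM₀.syndZ k hk l hl]
  refine wp_mono (wp_forEach hW (100 + n₀ * 100)
    (fun K M => M = overlay (fun x => ∃ k, K k ∧ ∃ l < n₀, x = addrZ n₀ m q + k * n₀ + l)
      (majorityMem n₀ m q z) σ₃.mem)
    (fun K v σ' h1 h2 h3 => wp_majority hP hn hW hM₀.syndZ_le hZ K v σ' h1 h2 h3) hσ₃ ?_) ?_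
  · simp [overlay_false]
  rintro σ₄ t₄ ⟨-, hmem₄, ht₄⟩
  have hlow : ∀ x < addrZ n₀ m q, σ₄.mem x = σ₃.mem x := fun x hx => by
    rw [hmem₄, overlay_neg]
    rintro ⟨k, -, l, -, h⟩
    omega
  refine ⟨⟨x, hx, fun k => ?_⟩, fun k hk l hl hl' => ?_, fun k hk l hl => ?_, ?_⟩
  · have := mul_add_lt hn k.isLt
    rw [hlow _ (by omega), h₃.xbit]
  · have := mul_add_lt hl' hk
    rw [hlow _ (by omega), h₃.rest k hk l hl hl']
  · rw [hmem₄, overlay_pos ⟨k, hk, l, hl, rfl⟩, majorityMem_apply z k hl]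
  -- Tabulating costs `O(R q)`, the `8q` rounds cost `O(R)` each, and the majority vote costs `O(R
  -- n₀)`; `q ≤ m` bounds the sum.
  · generalize repetitions par m = R at *
    have h1 : R * q ≤ R * m := Nat.mul_le_mul_left R hqm
    have h2 : q ≤ R * q := Nat.le_mul_of_pos_left q hrep
    have h3 : n₀ ≤ R * n₀ := Nat.le_mul_of_pos_left n₀ hrep
    have h4 : R ≤ R * m := Nat.le_mul_of_pos_right R hm
    ring_nf at ht₁ ht₂ ht₃ ht₄ h1 h2 h3 h4 ⊢
    omega

theorem getD_append_add {l l' : List ℕ} (i : ℕ) : (l ++ l').getD (l.length + i) 0 =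
    l'.getD i 0 := by
  rw [List.getD_append_right _ _ _ _ (Nat.le_add_right _ _), Nat.add_sub_cancel_left]

theorem getD_ofFn {k : ℕ} (g : Fin k → ℕ) (i : Fin k) : (List.ofFn g).getD i 0 = g i := by
  rw [List.getD_eq_getElem _ _ (by simp)]
  simp

theorem length_decoderInput {r : ℕ} (H₂ : Matrix (Fin r) (Fin m) (ZMod 2)) (sX : Fin r → ZMod 2)
    (sZ : Fin m × Fin (n₀ - 1) → ZMod 2) :
    (decoderInput n₀ H₂ sX sZ).length = 3 + r * m + r + m * (n₀ - 1) := by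
  simp only [decoderInput, List.length_append, List.length_ofFn, List.length_cons, List.length_nil]

/-- The parity check matrix of the code given by a bipartite graph. -/
def graphMatrix (m q : ℕ) (f : ℕ → ℕ → ℕ) : Matrix (Fin (8 * q)) (Fin m) (ZMod 2) := fun c v =>
  if f v (finProdFinEquiv.symm c).1 = (finProdFinEquiv.symm c).2 then 1 else 0

theorem inputMem_initConfig (f : ℕ → ℕ → ℕ) (sX : Fin (8 * q) → ZMod 2)
    (sZ : Fin m × Fin (n₀ - 1) → ZMod 2) :
    InputMem n₀ m q f (fun c => sX (finProdFinEquiv c))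
      (fun k l => if h : k < m ∧ l < n₀ - 1 then (sZ (⟨k, h.1⟩, ⟨l, h.2⟩)).val else 0)
      (initConfig (decoderInput n₀ (graphMatrix m q f) sX sZ)).mem := by
  constructor
  · rfl
  · rfl
  · rfl
  · intro j hj t ht v hv
    have h1 := mul_add_lt ht hj
    have h2 := mul_add_lt hv h1
    have hc : (j * q + t) = (finProdFinEquiv ((⟨j, hj⟩ : Fin 8), (⟨t, ht⟩ : Fin q)) : ℕ) := by
      simp [finProdFinEquiv, mul_comm, add_comm]
    have hi : (j * q + t) * m + v = (finProdFinEquiv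
        (finProdFinEquiv ((⟨j, hj⟩ : Fin 8), (⟨t, ht⟩ : Fin q)), (⟨v, hv⟩ : Fin m)) : ℕ) := by
      rw [hc]
      simp [finProdFinEquiv, mul_comm, add_comm]
    change (decoderInput _ _ _ _).getD _ 0 = _
    rw [decoderInput, List.append_assoc, List.append_assoc, add_assoc]
    refine (getD_append_add (l := [n₀, m, 8 * q]) _).trans ?_
    rw [List.getD_append _ _ _ _ (by simpa using h2), hi, getD_ofFn, Equiv.symm_apply_apply,
      graphMatrix, Equiv.symm_apply_apply]
    simp only
    split_ifs <;> simp [ZMod.val_one]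
  · intro j t
    have hc : (j * q + t : ℕ) = (finProdFinEquiv (j, t) : ℕ) := by
      simp [finProdFinEquiv, mul_comm, add_comm]
    change (decoderInput _ _ _ _).getD _ 0 = _
    rw [decoderInput, List.append_assoc, add_assoc, hc,
      show addrSX m q = ([n₀, m, 8 * q] ++ List.ofFn (fun i : Fin (8 * q * m) =>
        (graphMatrix m q f (finProdFinEquiv.symm i).1 (finProdFinEquiv.symm i).2).val)).length by
        rw [List.length_append, List.length_ofFn]; rfl, getD_append_add,
      List.getD_append _ _ _ _ (by rw [List.length_ofFn]; exact (finProdFinEquiv (j, t)).isLt),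
      getD_ofFn]
  · intro k hk l hl
    have hc : (k * (n₀ - 1) + l : ℕ) =
        (finProdFinEquiv ((⟨k, hk⟩ : Fin m), (⟨l, hl⟩ : Fin (n₀ - 1))) : ℕ) := by
      simp [finProdFinEquiv, mul_comm, add_comm]
    change (decoderInput _ _ _ _).getD _ 0 = _
    rw [decoderInput, add_assoc, hc,
      show addrSZ m q = ([n₀, m, 8 * q] ++ List.ofFn (fun i : Fin (8 * q * m) =>
        (graphMatrix m q f (finProdFinEquiv.symm i).1 (finProdFinEquiv.symm i).2).val) ++
        List.ofFn (fun i : Fin (8 * q) => (sX i).val)).length by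
        rw [List.length_append, List.length_append, List.length_ofFn, List.length_ofFn]; rfl,
      getD_append_add, getD_ofFn, Equiv.symm_apply_apply, dif_pos ⟨hk, hl⟩]
  · intro k hk l hl
    rw [dif_pos ⟨hk, hl⟩]
    have := ZMod.val_lt (sZ (⟨k, hk⟩, ⟨l, hl⟩))
    omega
  · intro x hx
    change (decoderInput _ _ _ _).getD _ 0 = _
    rw [List.getD_eq_default]
    rw [length_decoderInput]
    exact hx

/-- With `Y` the power of two just above `N`, all addresses are `O(Y²)`, since `8 * q * m ≤ m²`.
There are `Y^8` words, and `Y ≥ 4` absorbs the constants. -/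
theorem roomy_wordCount (hn : 0 < n₀) (hm : 0 < m) (hN : 1 < n₀ * m) (hq : 8 * q ≤ m) :
    Roomy (wordCount 8 (n₀ * m)) n₀ m q := by
  obtain ⟨Y, hY⟩ : ∃ Y, Y = 2 ^ (Nat.log 2 (n₀ * m) + 1) := ⟨_, rfl⟩
  have h1 : n₀ * m < Y := by
    rw [hY]
    exact Nat.lt_pow_succ_log_self (by norm_num) _
  have h4 : 4 ≤ Y := by
    rw [hY]
    have : 1 ≤ Nat.log 2 (n₀ * m) := Nat.log_pos (by norm_num) hN
    calc 4 = 2 ^ (1 + 1) := by norm_num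
      _ ≤ _ := Nat.pow_le_pow_right (by norm_num) (by omega)
  have hw : wordCount 8 (n₀ * m) = Y ^ 8 := by
    rw [wordCount, hY, ← pow_mul, mul_comm]
  have hmY : m ≤ Y := (Nat.le_mul_of_pos_left m hn).trans h1.le
  have hnY : n₀ ≤ Y := (Nat.le_mul_of_pos_right n₀ hm).trans h1.le
  have h2 : 8 * q * m ≤ Y * Y := Nat.mul_le_mul (hq.trans hmY) hmY
  have h3 : m * n₀ ≤ Y := by
    rw [mul_comm]
    exact h1.le
  have h5 : m * (n₀ - 1) ≤ m * n₀ := Nat.mul_le_mul_left m (Nat.sub_le _ _)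
  have h6 : 4 * Y ≤ Y * Y := Nat.mul_le_mul_right Y h4
  have h7 : 4 ^ 6 * (Y * Y) ≤ Y ^ 8 := by
    rw [show Y ^ 8 = Y ^ 6 * (Y * Y) by ring]
    exact Nat.mul_le_mul_right _ (Nat.pow_le_pow_left h4 6)
  rw [Roomy, hw]
  simp only [addrT, addrZ, addrX, addrSZ, addrSX]
  omega

/-- What the decoder computes, and in how many steps. -/
theorem decoder_spec (par : Bool) (hn : 0 < n₀) (hm : 0 < m) (hN : 1 < n₀ * m) (hq : 8 * q ≤ m)
    {f : ℕ → ℕ → ℕ} (hf : 0 < q → ∀ v < m, ∀ j < 8, f v j < q) (sX : Fin (8 * q) → ZMod 2)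
    (sZ : Fin m × Fin (n₀ - 1) → ZMod 2) :
    decoderTime (decoder par) 8 (processors par m) n₀ (graphMatrix m q f) sX sZ ≤
      20000 * (repetitions par m * (m + n₀)) ∧
    (∃ x, FlipResult m q f (fun c => sX (finProdFinEquiv c)) x ∧
      (decoderOutput (decoder par) 8 (processors par m) n₀ (graphMatrix m q f) sX sZ).1 =
        firstQubits hn x) ∧
    ∀ k l,
      (decoderOutput (decoder par) 8 (processors par m) n₀ (graphMatrix m q f) sX sZ).2 (k, l) =
      majorityEntry n₀ (fun k l => if h : k < m ∧ l < n₀ - 1 then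
        (sZ (⟨k, h.1⟩, ⟨l, h.2⟩)).val else 0) k l := by
  obtain ⟨σ', hsim, ⟨x, hx, hx1⟩, hx2, hz, ht⟩ :=
    wp_decoder (par := par) hn hm (by omega) (roomy_wordCount hn hm hN hq)
      (inputMem_initConfig f sX sZ) hf _ ⟨rfl, fun _ _ _ _ => rfl⟩
  have hL : (decoderInput n₀ (graphMatrix m q f) sX sZ).length = addrX n₀ m q :=
    length_decoderInput _ _ _
  have hidx : ∀ (k : Fin m) (l : Fin n₀), (finProdFinEquiv (k, l) : ℕ) = k * n₀ + l := fun k l => by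
    simp [finProdFinEquiv, mul_comm, add_comm]
  refine ⟨ht, ⟨x, hx, funext fun ⟨k, l⟩ => ?_⟩, fun k l => ?_⟩
  · change (((decoderRun _ _ _ _ _ _ _).1.mem
      ((decoderInput n₀ (graphMatrix m q f) sX sZ).length +
        finProdFinEquiv (k, l)) : ℕ) : ZMod 2) = _
    rw [hL, hidx, firstQubits]
    change (((Prog.run _ _ _ _).1.mem _ : ℕ) : ZMod 2) = _
    rw [hsim.1, ← add_assoc]
    by_cases hl : l = ⟨0, hn⟩
    · subst hl
      simpa using hx1 k
    · have h0 : 0 < (l : ℕ) := Nat.pos_of_ne_zero fun h => hl (Fin.ext h)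
      rw [hx2 k k.isLt l h0 l.isLt]
      simp [hl]
  · change (((decoderRun _ _ _ _ _ _ _).1.mem ((decoderInput n₀ (graphMatrix m q f) sX sZ).length +
      (m * n₀ + finProdFinEquiv (k, l))) : ℕ) : ZMod 2) = _
    rw [hL, hidx]
    change (((Prog.run _ _ _ _).1.mem _ : ℕ) : ZMod 2) = _
    rw [hsim.1, ← hz k k.isLt l l.isLt, ← add_assoc, ← add_assoc]
    rfl

end Decoder

/-! ### The outer expander code -/

section Graphs

variable {n₀ m q : ℕ}

/-- Every set of at most `T` vertices has more than six neighbours per vertex. -/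
def Expands (f : Fin m → Fin 8 → Fin q) (T : ℕ) : Prop :=
  ∀ S : Finset (Fin m), S.Nonempty → S.card ≤ T → 6 * S.card < (nbrs f S).card

theorem graphMatrix_mulVec {f : ℕ → ℕ → ℕ} {g : Fin m → Fin 8 → Fin q}
    (hg : ∀ k j, (g k j : ℕ) = f k j) (y : Fin m → ZMod 2) (c : Fin 8 × Fin q) :
    (graphMatrix m q f *ᵥ y) (finProdFinEquiv c) = synd g y c := by
  rw [Matrix.mulVec, dotProduct, synd]
  refine Finset.sum_congr rfl fun v _ => ?_
  rw [graphMatrix, Equiv.symm_apply_apply, ← hg]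
  simp [Fin.ext_iff]

/-- With `q = m / 16` positive, `m ≤ 32 * q` and `(m / 2^23) * 2^18 ≤ q`, as the union bound
requires. The graph takes values in `ℕ` because there are no checks for `m < 16`, where `Fin q` is
empty. -/
theorem exists_expanding_graph (m : ℕ) : ∃ f : ℕ → ℕ → ℕ,
    (0 < m / 16 → ∀ v < m, ∀ j < 8, f v j < m / 16) ∧
    ∀ g : Fin m → Fin 8 → Fin (m / 16), (∀ k j, (g k j : ℕ) = f k j) → Expands g (m / 2 ^ 23) := by
  rcases Nat.eq_zero_or_pos (m / 16) with h | h
  · refine ⟨fun _ _ => 0, fun h' => absurd h' (by omega), fun g _ S hS hT => ?_⟩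
    obtain ⟨v, -⟩ := hS
    exact absurd (g v 0).isLt (by omega)
  · obtain ⟨g, hg⟩ := exists_expander (m := m) (T := m / 2 ^ 23) h (by omega) (by omega)
    refine ⟨fun v j => if h : v < m ∧ j < 8 then g ⟨v, h.1⟩ ⟨j, h.2⟩ else 0, fun _ v hv j hj => ?_,
      fun g' hg' => ?_⟩
    · simp only [hv, hj, and_self, dif_pos]
      exact Fin.isLt _
    · have : g' = g := funext fun k => funext fun j => Fin.ext (by simpa using hg' k j)
      rw [this]
      exact hg

/-- The Tanner graph of the outer code with `m` bits and `8 * (m / 16)` checks. -/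
noncomputable def outerGraph (m : ℕ) : ℕ → ℕ → ℕ := (exists_expanding_graph m).choose

/-- The parity check matrix of the outer code. -/
noncomputable def outerMatrix (m : ℕ) : Matrix (Fin (8 * (m / 16))) (Fin m) (ZMod 2) :=
  graphMatrix m (m / 16) (outerGraph m)

theorem outerGraph_lt (m : ℕ) (h : 0 < m / 16) : ∀ v < m, ∀ j < 8, outerGraph m v j < m / 16 :=
  (exists_expanding_graph m).choose_spec.1 h

theorem outerGraph_expands (m : ℕ) (g : Fin m → Fin 8 → Fin (m / 16))
    (hg : ∀ k j, (g k j : ℕ) = outerGraph m k j) : Expands g (m / 2 ^ 23) :=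
  (exists_expanding_graph m).choose_spec.2 g hg

theorem exists_fin_outerGraph (m : ℕ) (h : 0 < m / 16) :
    ∃ g : Fin m → Fin 8 → Fin (m / 16), ∀ k j, (g k j : ℕ) = outerGraph m k j :=
  ⟨fun k j => ⟨outerGraph m k j, outerGraph_lt m h k k.isLt j j.isLt⟩, fun _ _ => rfl⟩

/-- A nonzero vector within the expanding range has unsatisfied checks. Without checks the bound is
just `1`. -/
theorem lt_weight_of_outerMatrix_mulVec {y : Fin m → ZMod 2} (h : outerMatrix m *ᵥ y = 0)
    (hy : y ≠ 0) : m / 2 ^ 23 + 1 ≤ weight y := by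
  have h0 : weight y ≠ 0 := fun h => hy (weight_eq_zero h)
  rcases Nat.eq_zero_or_pos (m / 16) with hq | hq
  · omega
  · obtain ⟨g, hg⟩ := exists_fin_outerGraph m hq
    by_contra! hT
    have h1 := four_mul_weight_lt (outerGraph_expands m g hg) hy (by omega)
    have h2 : synd g y = 0 := funext fun c => by
      rw [← graphMatrix_mulVec hg]
      exact congrFun h _
    rw [h2, weight_zero] at h1
    omega

/-- There are at most `m / 2` checks, so the kernel is not trivial. -/
theorem exists_outerMatrix_mulVec_eq_zero (hm : 0 < m) :
    ∃ y, outerMatrix m *ᵥ y = 0 ∧ y ≠ 0 := by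
  have h := LinearMap.ker_ne_bot_of_finrank_lt (f := (outerMatrix m).mulVecLin) (by
    rw [Module.finrank_fin_fun, Module.finrank_fin_fun]
    omega)
  obtain ⟨y, hy, hy0⟩ := Submodule.exists_mem_ne_zero_of_ne_bot h
  exact ⟨y, hy, hy0⟩

theorem flipResult_eq {e x : Fin m → ZMod 2}
    (hx : FlipResult m (m / 16) (outerGraph m)
      (fun c => (outerMatrix m *ᵥ e) (finProdFinEquiv c)) x)
    (he : 2 * weight e ≤ m / 2 ^ 23) : x = e := by
  rcases Nat.eq_zero_or_pos (m / 16) with hq | hq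
  · rw [hx.1 hq, weight_eq_zero (y := e) (by omega)]
  · obtain ⟨g, hg⟩ := exists_fin_outerGraph m hq
    obtain ⟨st, h0, hst, rfl⟩ := hx.2 g hg
    refine flipSteps_correct (outerGraph_expands m g hg) he (h0.trans ?_) hst
    rw [show synd g e = _ from funext fun c => (graphMatrix_mulVec hg e c).symm]
    rfl

end Graphs

/-! ### Majority vote in the repetition code -/

section Majority

variable {n₀ m : ℕ}

theorem weight_eq_sum_val {κ : Type} [Fintype κ] (y : κ → ZMod 2) : weight y = ∑ i, (y i).val := by
  rw [weight, Finset.card_filter]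
  refine Finset.sum_congr rfl fun i _ => ?_
  rcases zmod_two_cases (y i) with h | h <;> simp [h, ZMod.val_one]

theorem val_add_one (a : ZMod 2) : (a + 1).val + a.val = 1 := by
  revert a
  decide

/-- The syndrome bits are the error bits plus the last one. If the last bit is right, they contain
as many ones as there are errors, fewer than half of `n₀`. If it is wrong, they contain `n₀` minus
that number, more than half. So the count reveals the last bit, and then all others. -/
theorem majorityEntry_eq (hn : 0 < n₀) {b : Bits (Qubit n₀ m)} (k : Fin m)
    (hb : 2 * weight (fun i => b (k, i)) < n₀) (l : Fin n₀) :
    ((majorityEntry n₀ (fun k l => if h : k < m ∧ l < n₀ - 1 then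
      ((checkZ n₀ m *ᵥ b) (⟨k, h.1⟩, ⟨l, h.2⟩)).val else 0) k l : ℕ) : ZMod 2) = b (k, l) := by
  obtain ⟨n, rfl⟩ : ∃ n, n₀ = n + 1 := ⟨n₀ - 1, by omega⟩
  set z : ℕ → ℕ → ℕ := fun k l => if h : k < m ∧ l < n + 1 - 1 then
      ((checkZ (n + 1) m *ᵥ b) (⟨k, h.1⟩, ⟨l, h.2⟩)).val else 0 with hz
  have hz' : ∀ i : Fin n, z k i = (b (k, i.castSucc) + b (k, Fin.last n)).val := fun i => by
    have h : (k : ℕ) < m ∧ (i : ℕ) < n + 1 - 1 := ⟨k.isLt, i.isLt⟩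
    rw [hz]
    simp only [dif_pos h]
    exact congrArg ZMod.val (checkZ_mulVec n b k i)
  have hcount : blockCount (n + 1) z k =
      ∑ i : Fin n, (b (k, i.castSucc) + b (k, Fin.last n)).val := by
    rw [blockCount, Nat.add_sub_cancel, Finset.sum_range]
    exact Finset.sum_congr rfl fun i _ => hz' i
  rw [weight_eq_sum_val, Fin.sum_univ_castSucc] at hb
  have hflip : ((blockFlip (n + 1) z k : ℕ) : ZMod 2) = b (k, Fin.last n) := by
    rw [blockFlip, hcount]
    rcases zmod_two_cases (b (k, Fin.last n)) with h | h
    · rw [h] at hb ⊢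
      simp only [add_zero, ZMod.val_zero] at hb ⊢
      rw [if_neg (by omega), Nat.cast_zero]
    · rw [h] at hb ⊢
      have hs : ∑ i : Fin n, (b (k, i.castSucc) + 1).val + ∑ i : Fin n, (b (k, i.castSucc)).val =
          n := by
        rw [← Finset.sum_add_distrib]
        simp [val_add_one]
      rw [ZMod.val_one] at hb
      rw [if_pos (by omega), Nat.cast_one]
  rw [majorityEntry]
  induction l using Fin.lastCases with
  | last => rw [if_neg (by simp), hflip]
  | cast i =>
    rw [if_pos (by simp), Nat.cast_add, hflip, Fin.val_castSucc, hz', ZMod.natCast_zmod_val,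
      add_assoc, CharTwo.add_self_eq_zero, add_zero]

end Majority

/-! ### Decoding guarantees and the failure probability -/

section Decoding

variable {n₀ m : ℕ}

theorem decoderTime_le (par : Bool) (hn : 0 < n₀) (hm : 0 < m) (hN : 1 < n₀ * m)
    (sX : Fin (8 * (m / 16)) → ZMod 2) (sZ : Fin m × Fin (n₀ - 1) → ZMod 2) :
    decoderTime (decoder par) 8 (processors par m) n₀ (outerMatrix m) sX sZ ≤
      20000 * (repetitions par m * (m + n₀)) :=
  (decoder_spec par hn hm hN (by omega) (outerGraph_lt m) sX sZ).1

/-- Bit flipping recovers the block parities of `a`, and `code_corrects` asks for no more; the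
majority votes recover `b` itself. -/
theorem decoder_corrects (par : Bool) (hn : 0 < n₀) (hm : 0 < m) (hN : 1 < n₀ * m)
    {a b : Bits (Qubit n₀ m)} (ha : 2 * weight (blockParity a) ≤ m / 2 ^ 23)
    (hb : ∀ k, 2 * weight (fun i => b (k, i)) < n₀) :
    DecoderCorrects (decoder par) 8 (processors par m) n₀ (outerMatrix m) a b := by
  obtain ⟨-, ⟨x, hx, hx'⟩, hz⟩ := decoder_spec par hn hm hN (by omega) (outerGraph_lt m)
    (checkX n₀ (outerMatrix m) *ᵥ a) (checkZ n₀ m *ᵥ b)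
  rw [checkX_mulVec] at hx
  refine code_corrects hn ?_ (funext fun ⟨k, l⟩ => ?_)
  · rw [← flipResult_eq hx ha, ← blockParity_firstQubits hn x, ← hx']
    rfl
  · rw [← majorityEntry_eq hn k (hb k) l]
    exact hz k l

theorem sum_zmod_two (F : ZMod 2 → ℝ) : ∑ x, F x = F 0 + F 1 :=
  Fin.sum_univ_two F

/-- The exponential moment of the number of `Z`-errors in one block. -/
theorem sum_prod_mul_pow_weight {p : ℝ} (k : Fin m) :
    ∑ b : Bits (Qubit n₀ m), (∏ i, if b i = 1 then p else 1 - p) *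
      4 ^ weight (fun i => b (k, i)) = (1 + 3 * p) ^ n₀ := by
  -- The weight factor is distributed over the qubits. The sum then factors into `1 - p + 4p` for
  -- each qubit of block `k` and `1` for every other qubit.
  have h1 : ∀ b : Bits (Qubit n₀ m), (∏ i, if b i = 1 then p else 1 - p) *
      4 ^ weight (fun i => b (k, i)) =
      ∏ i : Qubit n₀ m, ((if b i = 1 then p else 1 - p) *
        if i.1 = k ∧ b i = 1 then (4 : ℝ) else 1) := fun b => by
    rw [Finset.prod_mul_distrib]
    congr 1
    rw [Fintype.prod_prod_type, Finset.prod_eq_single k _ (by simp), weight_eq_sum_val,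
      ← Finset.prod_pow_eq_pow_sum]
    · refine Finset.prod_congr rfl fun i _ => ?_
      rcases zmod_two_cases (b (k, i)) with h | h <;> simp [h, ZMod.val_one]
    · intro k' _ hk'
      simp [hk']
  have h2 := Finset.prod_univ_sum (fun _ : Qubit n₀ m => (Finset.univ : Finset (ZMod 2)))
    (fun i x => (if x = 1 then p else 1 - p) * if i.1 = k ∧ x = 1 then (4 : ℝ) else 1)
  rw [Fintype.piFinset_univ] at h2
  rw [Finset.sum_congr rfl fun b _ => h1 b, ← h2, Fintype.prod_prod_type,
    Finset.prod_eq_single k _ (by simp)]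
  · have : ∀ i : Fin n₀, ∑ x : ZMod 2, ((if x = 1 then p else 1 - p) *
        if ((k, i) : Qubit n₀ m).1 = k ∧ x = 1 then (4 : ℝ) else 1) = 1 + 3 * p := fun i => by
      rw [sum_zmod_two]
      simp
      ring
    rw [Finset.prod_congr rfl fun i _ => this i]
    simp
  · intro k' _ hk'
    refine Finset.prod_eq_one fun i _ => ?_
    rw [sum_zmod_two]
    simp [hk']

/-- A Chernoff bound: failure needs a block with weight `w ≥ n₀ / 2`, where `4^w / 2^n₀ ≥ 1`. The
expectation of this quantity is `((1 + 3p) / 2)^n₀`, at most `(7/8)^n₀` for `p < 1/4`. Then one sums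
over the blocks. -/
theorem failProb_le (par : Bool) (hn : 0 < n₀) (hm : 0 < m) (hN : 1 < n₀ * m) {p : ℝ}
    (hp : 0 ≤ p) (hp' : p < 1 / 4) :
    failProb (decoder par) 8 (processors par m) n₀ (outerMatrix m) p ≤ m * (7 / 8) ^ n₀ := by
  have hw : ∀ b : Bits (Qubit n₀ m), 0 ≤ ∏ i, if b i = 1 then p else 1 - p := fun b =>
    Finset.prod_nonneg fun i _ => by split_ifs <;> linarith
  have key : ∀ b : Bits (Qubit n₀ m),
      {b | ¬ DecoderCorrects (decoder par) 8 (processors par m) n₀ (outerMatrix m) 0 b}.indicator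
        (fun b => ∏ i, if b i = 1 then p else 1 - p) b ≤
      ∑ k, (1 / 2) ^ n₀ * ((∏ i, if b i = 1 then p else 1 - p) *
        4 ^ weight (fun i => b (k, i))) := fun b => by
    have hnn : ∀ k, 0 ≤ (1 / 2 : ℝ) ^ n₀ * ((∏ i, if b i = 1 then p else 1 - p) *
        4 ^ weight (fun i => b (k, i))) := fun k =>
      mul_nonneg (by positivity) (mul_nonneg (hw b) (by positivity))
    refine Set.indicator_apply_le' (fun hb => ?_) fun _ => Finset.sum_nonneg fun k _ => hnn k
    obtain ⟨k, hk⟩ : ∃ k, n₀ ≤ 2 * weight (fun i => b (k, i)) := by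
      by_contra! h
      refine hb (decoder_corrects par hn hm hN ?_ h)
      rw [show blockParity (0 : Bits (Qubit n₀ m)) = 0 from funext fun v => by simp [blockParity],
        weight_zero]
      omega
    refine le_trans ?_ (Finset.single_le_sum (fun k _ => hnn k) (Finset.mem_univ k))
    have h1 : (1 : ℝ) ≤ (1 / 2) ^ n₀ * 4 ^ weight (fun i => b (k, i)) := by
      rw [show (4 : ℝ) = 2 ^ 2 by norm_num, ← pow_mul, one_div, inv_pow, ← div_eq_inv_mul,
        one_le_div (by positivity)]
      exact pow_le_pow_right₀ (by norm_num) hk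
    rw [mul_left_comm]
    exact le_mul_of_one_le_right (hw b) h1
  calc failProb (decoder par) 8 (processors par m) n₀ (outerMatrix m) p
      ≤ ∑ b : Bits (Qubit n₀ m), ∑ k, (1 / 2) ^ n₀ * ((∏ i, if b i = 1 then p else 1 - p) *
        4 ^ weight (fun i => b (k, i))) := Finset.sum_le_sum fun b _ => key b
    _ = m * ((1 + 3 * p) / 2) ^ n₀ := by
      rw [Finset.sum_comm]
      simp_rw [← Finset.mul_sum, sum_prod_mul_pow_weight]
      rw [Finset.sum_const, Finset.card_univ, Fintype.card_fin, nsmul_eq_mul, mul_left_comm,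
        ← mul_pow]
      congr 2
      ring
    _ ≤ m * (7 / 8) ^ n₀ :=
      mul_le_mul_of_nonneg_left (pow_le_pow_left₀ (by linarith) (by linarith) _) (by positivity)

/-- Exponential decay in the block length beats every power of `N`. -/
theorem exists_forall_pow_mul_le {α : ℝ} (hα : 0 < α) (e : ℕ) {ε : ℝ} (hε : 0 < ε) :
    ∃ N₀ : ℕ, ∀ n₀ N : ℕ, N₀ ≤ N → α * √(N : ℝ) ≤ n₀ → (N : ℝ) ^ e * (7 / 8) ^ n₀ ≤ ε := by
  -- Since `N ≤ (n₀ / α)²`, the factor `N^e` costs only `n₀^(2e)`, up to the constant `α^(2e)`.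
  have h := tendsto_pow_const_mul_const_pow_of_lt_one (2 * e) (r := (7 / 8 : ℝ))
    (by norm_num) (by norm_num)
  obtain ⟨K, hK⟩ := Filter.eventually_atTop.1
    (h.eventually_le_const (show (0 : ℝ) < ε * α ^ (2 * e) by positivity))
  refine ⟨⌈(K / α) ^ 2⌉₊, fun n₀ N hN hn => ?_⟩
  have h1 : (K / α) ^ 2 ≤ (N : ℝ) := (Nat.le_ceil _).trans (by exact_mod_cast hN)
  have h2 : (K : ℝ) ≤ n₀ := by
    refine le_trans ?_ hn
    rw [← div_le_iff₀' hα]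
    exact Real.le_sqrt_of_sq_le h1
  have h3 := hK n₀ (by exact_mod_cast h2)
  have h4 : (α ^ (2 * e)) * (N : ℝ) ^ e ≤ (n₀ : ℝ) ^ (2 * e) := by
    have := pow_le_pow_left₀ (by positivity) hn (2 * e)
    rwa [mul_pow, pow_mul (√(N : ℝ)), Real.sq_sqrt (Nat.cast_nonneg N)] at this
  have h5 : 0 < α ^ (2 * e) := by positivity
  have h6 : (α ^ (2 * e)) * ((N : ℝ) ^ e * (7 / 8) ^ n₀) ≤ α ^ (2 * e) * ε := by
    rw [← mul_assoc, mul_comm _ ε]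
    exact (mul_le_mul_of_nonneg_right h4 (by positivity)).trans h3
  exact le_of_mul_le_mul_left h6 h5

end Decoding

/-! ### Comparing the number of blocks with the square root of the length -/

section Constants

variable {α β : ℝ} {n₀ m N : ℕ}

theorem mul_blocks_le_sqrt (hN : N = n₀ * m) (h : α * √(N : ℝ) ≤ n₀) (hN1 : 1 < N) :
    α * m ≤ √(N : ℝ) := by
  have hs : 0 < √(N : ℝ) := Real.sqrt_pos.2 (by exact_mod_cast (by omega : 0 < N))
  have h1 : √(N : ℝ) * √(N : ℝ) = n₀ * m := by
    rw [Real.mul_self_sqrt (Nat.cast_nonneg N), hN]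
    push_cast
    rfl
  refine le_of_mul_le_mul_right ?_ hs
  rw [h1, mul_right_comm]
  exact mul_le_mul_of_nonneg_right h (Nat.cast_nonneg m)

theorem sqrt_le_mul_blocks (hN : N = n₀ * m) (h : (n₀ : ℝ) ≤ β * √(N : ℝ)) (hN1 : 1 < N) :
    √(N : ℝ) ≤ β * m := by
  have hs : 0 < √(N : ℝ) := Real.sqrt_pos.2 (by exact_mod_cast (by omega : 0 < N))
  have h1 : √(N : ℝ) * √(N : ℝ) = n₀ * m := by
    rw [Real.mul_self_sqrt (Nat.cast_nonneg N), hN]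
    push_cast
    rfl
  refine le_of_mul_le_mul_right ?_ hs
  rw [h1, mul_right_comm]
  exact mul_le_mul_of_nonneg_right h (Nat.cast_nonneg m)

end Constants

/-! ### Distance and guaranteed decoding radius of the concatenated code -/

section Code

variable {α β : ℝ} {n₀ m N : ℕ}

theorem le_minDist_outerMatrix {w : ℝ} (hn : 0 < n₀) (hm : 0 < m) (h₁ : w * 2 ^ 23 ≤ m)
    (h₂ : w ≤ n₀) : w ≤ minDist (stab n₀ (outerMatrix m)) := by
  have h := le_minDist (d := min (m / 2 ^ 23 + 1) n₀) hn (min_le_right _ _)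
    (fun y hy hy0 => (min_le_left _ _).trans (lt_weight_of_outerMatrix_mulVec hy hy0))
    (exists_outerMatrix_mulVec_eq_zero hm)
  refine le_trans ?_ (Nat.cast_le.2 h)
  rw [Nat.cast_min]
  refine le_min ?_ h₂
  have h3 : m ≤ (m / 2 ^ 23 + 1) * 2 ^ 23 := by omega
  have h4 : (m : ℝ) ≤ ((m / 2 ^ 23 + 1 : ℕ) : ℝ) * 2 ^ 23 := by exact_mod_cast h3
  exact le_of_mul_le_mul_right (h₁.trans h4) (by positivity)

theorem decoder_corrects_of_weight_lt (par : Bool) {w : ℝ} (hn : 0 < n₀) (hm : 0 < m)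
    (hN : 1 < n₀ * m) (h₁ : w * 2 ^ 23 ≤ m) (h₂ : w ≤ n₀) {a b : Bits (Qubit n₀ m)}
    (hw : 2 * (pauliWeight a b : ℝ) < w) :
    DecoderCorrects (decoder par) 8 (processors par m) n₀ (outerMatrix m) a b := by
  have h3 : 2 * pauliWeight a b < n₀ := by exact_mod_cast hw.trans_le h₂
  have h4 : 2 * pauliWeight a b * 2 ^ 23 ≤ m := by
    have : 2 * (pauliWeight a b : ℝ) * 2 ^ 23 ≤ m := by linarith
    rw [← Nat.cast_le (α := ℝ)]
    push_cast
    linarith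
  have ha := (weight_blockParity_le a).trans (weight_le_pauliWeight_left a b)
  refine decoder_corrects par hn hm hN ?_ fun k => ?_
  · exact (Nat.le_div_iff_mul_le (by norm_num)).2
      ((Nat.mul_le_mul_right _ (Nat.mul_le_mul_left 2 ha)).trans h4)
  · have := (weight_block_le b k).trans (weight_le_pauliWeight_right a b)
    omega

end Code

end PCCSS

/-! ### Choice of the constants and conclusion -/

theorem corollary2 :
    ∃ (r : ℕ → ℕ) (H₂ : ∀ m : ℕ, Matrix (Fin (r m)) (Fin m) (ZMod 2))
      (seqDec parDec : PCCSS.Prog) (κ : ℕ) (procs : ℕ → ℕ → ℕ),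
      (∀ m, r m ≤ m) ∧
      ∀ α β : ℝ, 0 < α → 0 < β →
        (∃ c C : ℝ, 0 < c ∧ 0 < C ∧
          ∀ n₀ m N : ℕ, 1 < n₀ → 1 < N → N = n₀ * m →
            α * √(N : ℝ) ≤ n₀ → (n₀ : ℝ) ≤ β * √(N : ℝ) →
            -- parameters
            (∃ k : ℕ, Module.finrank ℂ (PCCSS.code n₀ (H₂ m)) = 2 ^ k ∧ c * √(N : ℝ) ≤ k) ∧
            c * √(N : ℝ) ≤ PCCSS.minDist (PCCSS.stab n₀ (H₂ m)) ∧
            -- sequential decoding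
            (∀ sX sZ, (PCCSS.decoderTime seqDec κ 1 n₀ (H₂ m) sX sZ : ℝ) ≤ C * N) ∧
            (∀ a b, 2 * (PCCSS.pauliWeight a b : ℝ) < c * √(N : ℝ) →
              PCCSS.DecoderCorrects seqDec κ 1 n₀ (H₂ m) a b) ∧
            -- parallel decoding
            0 < procs n₀ m ∧ (procs n₀ m : ℝ) ≤ C * √(N : ℝ) ∧
            (∀ sX sZ, (PCCSS.decoderTime parDec κ (procs n₀ m) n₀ (H₂ m) sX sZ : ℝ) ≤
              C * √(N : ℝ)) ∧
            (∀ a b, 2 * (PCCSS.pauliWeight a b : ℝ) < c * √(N : ℝ) →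
              PCCSS.DecoderCorrects parDec κ (procs n₀ m) n₀ (H₂ m) a b) ∧
            -- encoding
            (∃ circ : PCCSS.Circuit (PCCSS.Qubit n₀ m), circ.Encodes (PCCSS.code n₀ (H₂ m)) ∧
              (circ.size : ℝ) ≤ C * N ∧ (circ.depth : ℝ) ≤ C * √(N : ℝ))) ∧
        -- random `Z`-errors
        (∀ p : ℝ, 0 ≤ p → p < 1 / 4 → ∀ e : ℕ, ∀ ε : ℝ, 0 < ε → ∃ N₀ : ℕ,
          ∀ n₀ m N : ℕ, 1 < n₀ → N₀ ≤ N → N = n₀ * m →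
            α * √(N : ℝ) ≤ n₀ → (n₀ : ℝ) ≤ β * √(N : ℝ) →
            (N : ℝ) ^ e * PCCSS.failProb seqDec κ 1 n₀ (H₂ m) p ≤ ε ∧
            (N : ℝ) ^ e * PCCSS.failProb parDec κ (procs n₀ m) n₀ (H₂ m) p ≤ ε) := by
  refine ⟨fun m => 8 * (m / 16), PCCSS.outerMatrix, PCCSS.decoder false, PCCSS.decoder true, 8,
    fun _ m => m, fun m => (by omega : 8 * (m / 16) ≤ m), fun α β hα hβ => ⟨?_, ?_⟩⟩
  -- The two entries of the minimum give `c√N ≤ n₀` and `c√N ≤ m / 2^23`. In `C`, the terms account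
  -- for `m ≤ √N / α`, `n₀ ≤ β√N` and `m² ≤ N / α²`, and `20000` is the factor in the running time.
  · refine ⟨min α (1 / (2 ^ 23 * β)), 20000 * (1 + 1 / α + β + 1 / α ^ 2), by positivity,
      by positivity, fun n₀ m N hn hN1 hN hα' hβ' => ?_⟩
    have hm : 0 < m := Nat.pos_of_ne_zero fun h => by simp [h] at hN; omega
    have hN' : 1 < n₀ * m := hN ▸ hN1
    have hs : 1 ≤ √(N : ℝ) := Real.one_le_sqrt.2 (by exact_mod_cast hN1.le)
    have hNN : √(N : ℝ) * √(N : ℝ) = N := Real.mul_self_sqrt (Nat.cast_nonneg N)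
    have hlow := PCCSS.sqrt_le_mul_blocks hN hβ' hN1
    have hup := PCCSS.mul_blocks_le_sqrt hN hα' hN1
    set s := √(N : ℝ) with hs'
    have hup1 : (m : ℝ) ≤ 1 / α * s := by
      rw [div_mul_eq_mul_div, one_mul, le_div_iff₀' hα]
      exact hup
    have hsq : (m : ℝ) * m ≤ 1 / α ^ 2 * N := by
      rw [← hNN, show 1 / α ^ 2 * (s * s) = (1 / α * s) * (1 / α * s) by field_simp]
      exact mul_le_mul hup1 hup1 (by positivity) (by positivity)
    have hw2 : min α (1 / (2 ^ 23 * β)) * s ≤ n₀ :=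
      (mul_le_mul_of_nonneg_right (min_le_left _ _) (by positivity)).trans hα'
    have hw1 : min α (1 / (2 ^ 23 * β)) * s * 2 ^ 23 ≤ m := by
      calc min α (1 / (2 ^ 23 * β)) * s * 2 ^ 23 ≤ 1 / (2 ^ 23 * β) * (β * m) * 2 ^ 23 := by
            gcongr
            exact min_le_right _ _
        _ = (m : ℝ) := by field_simp
    have hCs : 0 < 1 / α * s ∧ 0 < β * s ∧ 0 < 1 / α ^ 2 * s := by
      refine ⟨?_, ?_, ?_⟩ <;> positivity
    have hCN : 0 < 1 / α * N ∧ 0 < β * N ∧ 0 < 1 / α ^ 2 * N := by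
      have : (0 : ℝ) < N := by exact_mod_cast (by omega : 0 < N)
      refine ⟨?_, ?_, ?_⟩ <;> positivity
    have hNr : (N : ℝ) = n₀ * m := by rw [hN, Nat.cast_mul]
    obtain ⟨⟨k, hk, hmk⟩, circ, hcirc, hsize, hdepth⟩ :=
      PCCSS.exists_encoder (n₀ := n₀) hm (by omega) (PCCSS.outerMatrix m)
    have hn0 : 0 < n₀ := by omega
    refine ⟨⟨k, hk, ?_⟩, PCCSS.le_minDist_outerMatrix hn0 hm hw1 hw2, fun sX sZ => ?_,
      fun a b => PCCSS.decoder_corrects_of_weight_lt false hn0 hm hN' hw1 hw2, hm, ?_,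
      fun sX sZ => ?_, fun a b => PCCSS.decoder_corrects_of_weight_lt true hn0 hm hN' hw1 hw2,
      circ, hcirc, ?_, ?_⟩
    -- The outer code has at most `m / 2` checks, hence rate at least one half.
    · have h1 : m ≤ 2 * k := by omega
      have h2 : (m : ℝ) ≤ 2 * k := by exact_mod_cast h1
      linarith
    · have h : (_ : ℝ) ≤ _ := Nat.cast_le.2 (PCCSS.decoderTime_le false hn0 hm hN' sX sZ)
      refine h.trans ?_
      simp only [PCCSS.repetitions]
      push_cast
      nlinarith
    · nlinarith
    · have h : (_ : ℝ) ≤ _ := Nat.cast_le.2 (PCCSS.decoderTime_le true hn0 hm hN' sX sZ)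
      refine h.trans ?_
      simp only [PCCSS.repetitions]
      push_cast
      nlinarith
    · have h : (circ.size : ℝ) ≤ m * m + 2 * (n₀ * m) := by exact_mod_cast hsize
      nlinarith
    · have h : (circ.depth : ℝ) ≤ m + 1 + n₀ := by exact_mod_cast hdepth
      nlinarith
  · intro p hp hp' e ε hε
    -- The extra power of `N` absorbs the factor `m ≤ N` from the union over the blocks.
    obtain ⟨N₀, hN₀⟩ := PCCSS.exists_forall_pow_mul_le hα (e + 1) hε
    refine ⟨max N₀ 2, fun n₀ m N hn hNN hN hα' _ => ?_⟩
    have hm : 0 < m := Nat.pos_of_ne_zero fun h => by simp [h] at hN; omega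
    have h2 : 1 < n₀ * m := hN ▸ (le_max_right N₀ 2).trans hNN
    have hmN : (m : ℝ) ≤ N := by
      rw [hN]
      exact_mod_cast Nat.le_mul_of_pos_left m (by omega)
    have h (par : Bool) : (N : ℝ) ^ e * PCCSS.failProb (PCCSS.decoder par) 8
        (PCCSS.processors par m) n₀ (PCCSS.outerMatrix m) p ≤ ε := by
      refine le_trans ?_ (hN₀ n₀ N ((le_max_left _ _).trans hNN) hα')
      rw [pow_succ, mul_assoc]
      refine mul_le_mul_of_nonneg_left ?_ (by positivity)
      refine (PCCSS.failProb_le par (by omega) hm h2 hp hp').trans ?_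
      exact mul_le_mul_of_nonneg_right hmN (by positivity)
    exact ⟨h false, h true⟩
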